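/- For real $a,b,z>0$ let $M(a,b,z)=\sum_{n\ge0}\frac{(a)_n}{(b)_n}\frac{z^n}{n!}$ be Kummer's function and define $\widetilde M$ by $M(a,b,z)=e^{z}\frac{\Gamma(b)}{\Gamma(a)}z^{a-b}\,\widetilde M(a,b,z)$. Put $$\alpha=\frac az,\quad \beta=\frac bz,\quad \mu=\beta-\alpha,\quad \tau=\frac{2}{\beta+1+\sqrt{(\beta+1)^2-4\mu}},\quad t_0=\mu\tau,\quad \mathcal A=\mu(\tau-\ln\tau-1)-\alpha\ln(1-\mu\tau).$$ Let $\phi(t)=t-\alpha\ln(1-t)-\mu\ln t$ and $\psi(s)=s-\mu\ln s$, and let $t=t(s)<1$ be the analytic function given by $\phi(t)-\phi(t_0)=\psi(s)-\psi(\mu)$, $\operatorname{sign}(t-t_0)=\operatorname{sign}(s-\mu)$, $\operatorname{sign}t=\operatorname{sign}s$ (where $\ln t-\ln t_0$ and $\ln s-\ln\mu$ are read as $\ln|t/t_0|$ and $\ln|s/\mu|$, and the logarithmic terms with factor $\mu$ are absent if $\mu=0$). Let $f(s)=\frac{s}{t(1-t)}\frac{dt}{ds}$, $f_0(s)=f(s)$,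 $f_{k}(s)=s\frac{d}{ds}\frac{f_{k-1}(s)-f_{k-1}(\mu)}{s-\mu}$ for $k\ge1$, and $\widetilde f_n(\mu)=f_n(\mu)/f_0(\mu)$ (removable singularities being removed). Then, for $\mu$ of either sign, $$f_0(\mu)=\frac1{\sqrt{\beta\mu\tau^2-2\mu\tau+1}},\quad \widetilde f_0(\mu)=1,\quad \widetilde f_1(\mu)=\frac{\mu\tau^{2}(\mu^{2}\tau^{5}-13\mu^{2}\tau^{4}-\mu\tau^{4}+21\mu\tau^{3}+4\mu\tau^{2}-9\tau^{2}-2\tau-1)}{12(\mu\tau^{2}-1)^{3}(1-\mu\tau)},$$ and the expansions $$M(a,b,z)\sim e^{z-z\mathcal A}\frac{\Gamma(b)}{\Gamma(a)}z^{a-b}f_0(\mu)\sum_{n=0}^\infty\frac{\widetilde f_n(\mu)}{z^n},\qquad \widetilde M(a,b,z)\sim e^{-z\mathcal A}f_0(\mu)\sum_{n=0}^\infty\frac{\widetilde f_n(\mu)}{z^n},\qquad z\to\infty,$$ hold, with the same coefficients, uniformly for $b\ge a\ge a_0$ with $t_0\le\rho$ as well as for $b_0\le b\le a$ (where $\mu\le0$),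 for any fixed $a_0>0$, $b_0>0$ and $\rho<1$. That is, for every $N$ there are $C$ and $z_0>0$, depending only on $a_0,b_0,\rho,N$, such that for all $z\ge z_0$ and all such $a,b$ the difference between the left-hand side and the front factor times $\sum_{n<N}\widetilde f_n(\mu)z^{-n}$ is at most $C z^{-N}$ times the front factor (the factor before the sum). -/

import Mathlib

noncomputable section

namespace KummerExpansion

/-- Kummer's function `M(a,b,z) = ∑ (a)ₙ / (b)ₙ * zⁿ / n!` (real arguments; the series converges
absolutely as soon as `b` is not `0, -1, -2, …`). -/
def kummerM (a b z : ℝ) : ℝ :=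
  ∑' n : ℕ, (ascPochhammer ℝ n).eval a / (ascPochhammer ℝ n).eval b * z ^ n / (n.factorial : ℝ)

/-- The scaled function `M̃`, determined by `M(a,b,z) = e^z Γ(b)/Γ(a) z^(a-b) M̃(a,b,z)`
(the factor is positive for positive `a, b, z`). -/
def scaledM (a b z : ℝ) : ℝ :=
  kummerM a b z / (Real.exp z * (Real.Gamma b / Real.Gamma a) * z ^ (a - b))

/-- `μ = β - α`. -/
def mu (α β : ℝ) : ℝ := β - α

/-- `τ = t₀ / μ`, in the form that is also valid for `μ = 0`. -/
def tau (α β : ℝ) : ℝ := 2 / (β + 1 + Real.sqrt ((β + 1) ^ 2 - 4 * mu α β))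

/-- The saddle point `t₀`: the smaller zero of `t² - (β+1) t + μ`. -/
def t0 (α β : ℝ) : ℝ := (β + 1) / 2 - Real.sqrt ((β + 1) ^ 2 - 4 * mu α β) / 2

/-- The exponent `𝒜 = μ (τ - log τ - 1) - α log (1 - μ τ)`. -/
def expA (α β : ℝ) : ℝ :=
  mu α β * (tau α β - Real.log (tau α β) - 1) - α * Real.log (1 - mu α β * tau α β)

/-- `φ(t) = t - α log (1-t) - μ log t`.  As `Real.log t = log |t|`, this also makes sense for
`t < 0`; a difference `φ(t) - φ(t₀)` with `t, t₀` of the same sign contains `log (t / t₀)`. -/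
def phi (α β t : ℝ) : ℝ := t - α * Real.log (1 - t) - mu α β * Real.log t

/-- `ψ(s) = s - μ log s`, with saddle point `s₀ = μ`. -/
def psi (α β s : ℝ) : ℝ := s - mu α β * Real.log s

/-- The points `s` and `t` correspond under the transformation
`φ(t) - φ(t₀) = ψ(s) - ψ(μ)`, `sign (t - t₀) = sign (s - μ)`.  Here `t < 1`, and `t` and `s`
have the same sign, so `t` and `s` vanish together.
For `α, β > 0` there is exactly one such `t` for every real `s`. -/
def Corresponds (α β s t : ℝ) : Prop :=
  t < 1 ∧ SignType.sign t = SignType.sign s ∧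
    SignType.sign (t - t0 α β) = SignType.sign (s - mu α β) ∧
    (s ≠ 0 → phi α β t - phi α β (t0 α β) = psi α β s - psi α β (mu α β))

/-- The transformation `s ↦ t(s)`. -/
def tOf (α β s : ℝ) : ℝ := Classical.epsilon (Corresponds α β s)

/-- `f(s) = s / (t (1-t)) * dt/ds`.  The quotient `t / s` is written as a divided difference, which
gives it its limit `t'(0)` at the removable singularity `s = 0` (there `t(0) = 0`). -/
def f (α β s : ℝ) : ℝ :=
  deriv (tOf α β) s / (dslope (tOf α β) 0 s * (1 - tOf α β s))

/-- The functions of the integration by parts procedure: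
`f₀ = f`, `fₖ₊₁(s) = s * d/ds [(fₖ(s) - fₖ(μ)) / (s - μ)]`
(`dslope` is the difference quotient, with its limit as value at `s = μ`). -/
def fIter (α β : ℝ) : ℕ → ℝ → ℝ
  | 0 => f α β
  | k + 1 => fun s => s * deriv (dslope (fIter α β k) (mu α β)) s

/-- The coefficient `fₙ(μ)`, the value of the function `fₙ` at `s = μ`. -/
def coeff (α β : ℝ) (n : ℕ) : ℝ := fIter α β n (mu α β)

/-- The normalised coefficient `f̃ₙ(μ) = fₙ(μ) / f₀(μ)`. -/
def ncoeff (α β : ℝ) (n : ℕ) : ℝ := coeff α β n / coeff α β 0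

/-- The partial sum `∑_{n < N} f̃ₙ(μ) / zⁿ` with `α = a/z`, `β = b/z`. -/
def partialSum (a b z : ℝ) (N : ℕ) : ℝ :=
  ∑ n ∈ Finset.range N, ncoeff (a / z) (b / z) n / z ^ n

/-- The front term `e^(-z𝒜) f₀(μ)` of the expansion of `M̃`. -/
def frontScaled (a b z : ℝ) : ℝ :=
  Real.exp (-z * expA (a / z) (b / z)) * coeff (a / z) (b / z) 0

/-- The front term `e^(z - z𝒜) Γ(b)/Γ(a) z^(a-b) f₀(μ)` of the expansion of `M`. -/
def front (a b z : ℝ) : ℝ :=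
  Real.exp (z - z * expA (a / z) (b / z)) * (Real.Gamma b / Real.Gamma a) * z ^ (a - b) *
    coeff (a / z) (b / z) 0

end KummerExpansion

end

noncomputable section

namespace KummerExpansion

/-! Fix `a`, `b` and let `z` vary; primes are z-derivatives. The exponential `expFactor` has
logarithmic derivative 1 − t₀. Writing M as Γ(b)/Γ(a) times `expFactor` times S therefore turns
Kummer's equation into S'' + (t₁ − t₀) S' + k S = 0, with k = t₀(1 − t₀)/(z(t₁ − t₀)). The theorem
says that S is approximated by the sum of Eₙ = fₙ(μ)/zⁿ. These terms form a formal solution: (t₁ −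
t₀) E₀' + k E₀ = 0 and (t₁ − t₀) Eₙ₊₁' + k Eₙ₊₁ = −Eₙ''.

This recursion is algebra. For μ ≠ 0 the number fₙ(μ) is obtained from the Taylor series of f at μ
by n applications of the formal operator `partsOp`. In the variable zs − (b − a) the operator no
longer contains z, and the series of t evolves by ∂t/∂z = −t(1 − t)/(z(t₁ − t))
(`hasCoeffDerivAt_tSeries`). From this follow `hasDerivAt_expTerm` and `hasDerivAt_auxTerm`, which
contain the recursion. As z → ∞ with a, b fixed, the transformation becomes the identity, so E₀ → 1
and Eₙ → 0 for n ≥ 1. Integrating the recursion from infinity gives Eₙ/E₀ = O(z⁻ⁿ), together with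
its derivatives, uniformly where t₀/(t₁ − t₀) and 1/(t₁ − t₀) are bounded (`symbolBound_expTerm`).

For the true function, v = M'/M solves a Riccati equation. The difference of v and the logarithmic
derivative of the expansion truncated after E_N solves a linear equation with damping rate v + (t₁ −
1) + O(1/z) and forcing O(z^(−N−2)). Lower bounds for the rate on a window [qz, z] make the
difference O(z^(−N−2)) (`abs_logDiff_le`). The logarithm of the quotient of M and the truncated
expansion tends to 0 for fixed a, b (`tendsto_scaledM`), so integration from infinity bounds it by
O(z^(−N−1)), with uniform constants.

The case a = b is exact, since M = e^z. The closed forms of the first coefficients come from the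
Taylor coefficients of f up to degree two (`first_coefficients`). -/

/-- The larger zero of `t² - (β+1) t + μ`. -/
def t1 (α β : ℝ) : ℝ := (β + 1) / 2 + Real.sqrt ((β + 1) ^ 2 - 4 * mu α β) / 2

/-- The distance `t₁ - t₀` of the two zeros. -/
def gap (α β : ℝ) : ℝ := Real.sqrt ((β + 1) ^ 2 - 4 * mu α β)

/-! ### The saddle points t₀ and t₁: Vieta relations and location. -/

section Saddle

variable {α β : ℝ}

lemma discr_eq (α β : ℝ) : (β + 1) ^ 2 - 4 * mu α β = (1 - β) ^ 2 + 4 * α := by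
  unfold mu; ring

lemma discr_pos (hα : 0 < α) : 0 < (β + 1) ^ 2 - 4 * mu α β := by
  rw [discr_eq]; positivity

lemma gap_pos (hα : 0 < α) : 0 < gap α β := Real.sqrt_pos.2 (discr_pos hα)

lemma gap_sq (hα : 0 < α) : gap α β ^ 2 = (1 - β) ^ 2 + 4 * α := by
  rw [gap, Real.sq_sqrt (discr_pos hα).le, discr_eq]

lemma t0_eq (α β : ℝ) : t0 α β = (β + 1 - gap α β) / 2 := by unfold t0 gap; ring

lemma t1_eq (α β : ℝ) : t1 α β = (β + 1 + gap α β) / 2 := by unfold t1 gap; ring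

lemma t1_sub_t0 (α β : ℝ) : t1 α β - t0 α β = gap α β := by rw [t0_eq, t1_eq]; ring

lemma t0_add_t1 (α β : ℝ) : t0 α β + t1 α β = β + 1 := by rw [t0_eq, t1_eq]; ring

lemma t0_mul_t1 (hα : 0 < α) : t0 α β * t1 α β = mu α β := by
  rw [t0_eq, t1_eq, mu]; nlinarith [gap_sq (β := β) hα]

/-- The quadratic t² − (β+1)t + μ takes the value −α at t = 1, so 1 separates its zeros. -/
lemma one_sub_t0_mul (hα : 0 < α) : (1 - t0 α β) * (t1 α β - 1) = α := by
  have h1 := t0_mul_t1 (β := β) hα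
  have h2 := t0_add_t1 α β
  rw [mu] at h1
  linear_combination h2 - h1

lemma abs_one_sub_lt_gap (hα : 0 < α) : |1 - β| < gap α β := by
  apply abs_lt_of_sq_lt_sq _ (gap_pos hα).le
  rw [gap_sq hα]; linarith

lemma t0_lt_one (hα : 0 < α) : t0 α β < 1 := by
  have := (abs_lt.1 (abs_one_sub_lt_gap (β := β) hα)).1
  rw [t0_eq]; linarith

lemma one_lt_t1 (hα : 0 < α) : 1 < t1 α β := by
  have := (abs_lt.1 (abs_one_sub_lt_gap (β := β) hα)).2
  rw [t1_eq]; linarith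

lemma tau_eq (α β : ℝ) : tau α β = 1 / t1 α β := by
  rw [tau, t1_eq, gap, one_div_div]

lemma mu_mul_tau (hα : 0 < α) : mu α β * tau α β = t0 α β := by
  have := one_lt_t1 (β := β) hα
  rw [tau_eq, ← t0_mul_t1 hα]; field_simp

lemma sign_t0 (hα : 0 < α) : SignType.sign (t0 α β) = SignType.sign (mu α β) := by
  have := one_lt_t1 (β := β) hα
  rw [← t0_mul_t1 hα, sign_mul, sign_pos (by linarith : 0 < t1 α β), mul_one]

lemma t0_nonneg (hα : 0 < α) (h : α ≤ β) : 0 ≤ t0 α β := by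
  have h1 := one_lt_t1 (β := β) hα
  have h2 := t0_mul_t1 (β := β) hα
  have : 0 ≤ mu α β := by unfold mu; linarith
  by_contra! h3
  nlinarith

lemma t0_nonpos (hα : 0 < α) (h : β ≤ α) : t0 α β ≤ 0 := by
  have h1 := one_lt_t1 (β := β) hα
  have h2 := t0_mul_t1 (β := β) hα
  have : mu α β ≤ 0 := by unfold mu; linarith
  by_contra! h3
  nlinarith

end Saddle

/-! ### Derivatives in z at fixed a and b. -/

section Ray

variable {a b z : ℝ}

lemma hasDerivAt_const_div (a : ℝ) (hz : 0 < z) :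
    HasDerivAt (fun x => a / x) (-(a / z) / z) z := by
  have := (hasDerivAt_inv hz.ne').const_mul a
  simp only [← div_eq_mul_inv] at this
  exact this.congr_deriv (by field_simp)

lemma hasDerivAt_gap (ha : 0 < a) (hz : 0 < z) :
    HasDerivAt (fun x => gap (a / x) (b / x))
      (((1 - b / z) * (b / z) - 2 * (a / z)) / (z * gap (a / z) (b / z))) z := by
  have hg : (fun x => gap (a / x) (b / x)) =
      fun x => Real.sqrt ((1 - b / x) ^ 2 + 4 * (a / x)) := by
    funext x; rw [gap, discr_eq]
  have hgz := congrFun hg z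
  have hpos := gap_pos (β := b / z) (div_pos ha hz)
  have h1 := (((hasDerivAt_const_div b hz).const_sub 1).pow 2).add
    ((hasDerivAt_const_div a hz).const_mul 4)
  have h2 := h1.sqrt (by
    have := div_pos ha hz
    simp only [Pi.add_apply, Pi.pow_apply]
    positivity)
  rw [hg]
  refine h2.congr_deriv ?_
  simp only [Pi.add_apply, Pi.pow_apply]
  rw [← hgz]
  generalize gap (a / z) (b / z) = g at *
  generalize a / z = α at *
  generalize b / z = β at *
  field_simp
  ring

lemma hasDerivAt_t0 (ha : 0 < a) (hz : 0 < z) :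
    HasDerivAt (fun x => t0 (a / x) (b / x))
      (-(t0 (a / z) (b / z) * (1 - t0 (a / z) (b / z))) / (z * gap (a / z) (b / z))) z := by
  have hf : (fun x => t0 (a / x) (b / x)) = fun x => (b / x + 1 - gap (a / x) (b / x)) / 2 := by
    funext x; rw [t0_eq]
  have hpos := gap_pos (β := b / z) (div_pos ha hz)
  have hsq := gap_sq (β := b / z) (div_pos ha hz)
  rw [hf]
  refine ((((hasDerivAt_const_div b hz).add_const 1).sub
    (hasDerivAt_gap (b := b) ha hz)).div_const 2).congr_deriv ?_
  rw [t0_eq]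
  generalize gap (a / z) (b / z) = g at *
  generalize a / z = α at *
  generalize b / z = β at *
  field_simp
  linear_combination -hsq

lemma hasDerivAt_t1 (ha : 0 < a) (hz : 0 < z) :
    HasDerivAt (fun x => t1 (a / x) (b / x))
      (-(t1 (a / z) (b / z) * (t1 (a / z) (b / z) - 1)) / (z * gap (a / z) (b / z))) z := by
  have hf : (fun x => t1 (a / x) (b / x)) = fun x => (b / x + 1 + gap (a / x) (b / x)) / 2 := by
    funext x; rw [t1_eq]
  have hpos := gap_pos (β := b / z) (div_pos ha hz)
  have hsq := gap_sq (β := b / z) (div_pos ha hz)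
  rw [hf]
  refine ((((hasDerivAt_const_div b hz).add_const 1).add
    (hasDerivAt_gap (b := b) ha hz)).div_const 2).congr_deriv ?_
  rw [t1_eq]
  generalize gap (a / z) (b / z) = g at *
  generalize a / z = α at *
  generalize b / z = β at *
  field_simp
  linear_combination hsq

/-- z𝒜 is the critical value z(φ(t₀) − ψ(μ)), so only the explicit dependence on z contributes to
its derivative. With the factor z^(a−b) this produces the logarithmic derivative 1 − t₀ of
`expFactor`. -/
lemma hasDerivAt_mul_expA (ha : 0 < a) (hz : 0 < z) :
    HasDerivAt (fun x => x * expA (a / x) (b / x))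
      (t0 (a / z) (b / z) - mu (a / z) (b / z)) z := by
  have hα := div_pos ha hz
  have h0 := t0_lt_one (β := b / z) hα
  have h1 := one_lt_t1 (β := b / z) hα
  have hg := gap_pos (β := b / z) hα
  have hf : (fun x => x * expA (a / x) (b / x)) =ᶠ[nhds z] fun x =>
      (b - a) * ((t1 (a / x) (b / x))⁻¹ + Real.log (t1 (a / x) (b / x)) - 1)
        - a * Real.log (1 - t0 (a / x) (b / x)) := by
    filter_upwards [lt_mem_nhds hz] with x hx
    rw [expA, mu_mul_tau (div_pos ha hx), tau_eq, one_div, Real.log_inv, mu]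
    field_simp
    ring
  refine HasDerivAt.congr_of_eventuallyEq ?_ hf
  have d0 := hasDerivAt_t0 (b := b) ha hz
  have d1 := hasDerivAt_t1 (b := b) ha hz
  have e1 := (((d1.inv (by linarith)).add (d1.log (by linarith))).sub_const 1).const_mul (b - a)
  have e2 := ((d0.const_sub 1).log (by linarith)).const_mul a
  refine (e1.sub e2).congr_deriv ?_
  have hm := t0_mul_t1 (β := b / z) hα
  have ho := one_sub_t0_mul (β := b / z) hα
  have hd := t1_sub_t0 (a / z) (b / z)
  have hm' : b - a = z * (t0 (a / z) (b / z) * t1 (a / z) (b / z)) := by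
    rw [hm, mu]; field_simp
  have ho' : a = z * ((1 - t0 (a / z) (b / z)) * (t1 (a / z) (b / z) - 1)) := by
    rw [ho]; field_simp
  rw [← hm]
  generalize t0 (a / z) (b / z) = p at *
  generalize t1 (a / z) (b / z) = q at *
  generalize gap (a / z) (b / z) = g at *
  rw [hm']
  have h3 : (1 - p) ≠ 0 := by linarith
  have h4 : q ≠ 0 := by linarith
  have h5 : a * (-(-(p * (1 - p)) / (z * g)) / (1 - p)) = p * (1-p) * (q - 1) / g := by
    field_simp
    rw [ho']; field_simp
  rw [h5, ← hd]
  have h6 : q - p ≠ 0 := by linarith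
  field_simp
  ring

end Ray

/-! ### Limits for z → ∞ at fixed a and b. -/

section Limits

variable {a b : ℝ}
open Filter Topology

lemma tendsto_const_div (a : ℝ) : Tendsto (fun z : ℝ => a / z) atTop (𝓝 0) :=
  tendsto_const_nhds.div_atTop tendsto_id

lemma tendsto_gap (a b : ℝ) : Tendsto (fun z => gap (a / z) (b / z)) atTop (𝓝 1) := by
  have : Tendsto (fun z => Real.sqrt ((1 - b / z) ^ 2 + 4 * (a / z))) atTop
      (𝓝 (Real.sqrt ((1 - 0) ^ 2 + 4 * 0))) :=
    ((((tendsto_const_div b).const_sub 1).pow 2).add ((tendsto_const_div a).const_mul 4)).sqrt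
  simpa [gap, discr_eq] using this

lemma tendsto_t0 (a b : ℝ) : Tendsto (fun z => t0 (a / z) (b / z)) atTop (𝓝 0) := by
  have := (((tendsto_const_div b).add_const 1).sub (tendsto_gap a b)).div_const 2
  simpa [t0_eq] using this

lemma tendsto_t1 (a b : ℝ) : Tendsto (fun z => t1 (a / z) (b / z)) atTop (𝓝 1) := by
  have := (((tendsto_const_div b).add_const 1).add (tendsto_gap a b)).div_const 2
  simp only [t1_eq]
  convert this using 2
  norm_num

lemma tendsto_mul_expA (ha : 0 < a) :
    Tendsto (fun z => z * expA (a / z) (b / z)) atTop (𝓝 0) := by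
  have h1 := tendsto_t1 a b
  have h2 := ((tendsto_t0 a b).const_sub 1)
  have h3 := (((h1.inv₀ one_ne_zero).add (h1.log one_ne_zero)).sub_const 1).const_mul (b - a)
  have h4 := (h2.log (by norm_num)).const_mul a
  have h5 := h3.sub h4
  simp only [inv_one, Real.log_one, sub_zero, add_zero, sub_self, mul_zero] at h5
  refine h5.congr' ?_
  filter_upwards [eventually_gt_atTop 0] with x hx
  rw [expA, mu_mul_tau (div_pos ha hx), tau_eq, one_div, Real.log_inv, mu]
  field_simp
  ring

end Limits

end KummerExpansion
end

noncomputable section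

namespace KummerExpansion

/-! ### Formal Taylor series of analytic functions. -/

section TaylorSeries

open PowerSeries Filter Topology

/-- The formal Taylor series of `f` at `c`. -/
def taylorSeries (f : ℝ → ℝ) (c : ℝ) : PowerSeries ℝ :=
  PowerSeries.mk fun k => iteratedDeriv k f c / (k.factorial : ℝ)

variable {f g : ℝ → ℝ} {c : ℝ}

lemma coeff_taylorSeries (f : ℝ → ℝ) (c : ℝ) (k : ℕ) :
    PowerSeries.coeff k (taylorSeries f c) = iteratedDeriv k f c / (k.factorial : ℝ) := by
  simp [taylorSeries]

lemma constantCoeff_taylorSeries (f : ℝ → ℝ) (c : ℝ) :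
    constantCoeff (taylorSeries f c) = f c := by
  rw [← coeff_zero_eq_constantCoeff_apply, coeff_taylorSeries]; simp

lemma coeff_one_taylorSeries (f : ℝ → ℝ) (c : ℝ) :
    PowerSeries.coeff 1 (taylorSeries f c) = deriv f c := by
  rw [coeff_taylorSeries]; simp

lemma taylorSeries_congr (h : f =ᶠ[𝓝 c] g) : taylorSeries f c = taylorSeries g c := by
  ext k
  rw [coeff_taylorSeries, coeff_taylorSeries, h.iteratedDeriv_eq]

lemma taylorSeries_mul (hf : AnalyticAt ℝ f c) (hg : AnalyticAt ℝ g c) :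
    taylorSeries (fun x => f x * g x) c = taylorSeries f c * taylorSeries g c := by
  ext k
  rw [coeff_mul, coeff_taylorSeries, iteratedDeriv_fun_mul hf.contDiffAt hg.contDiffAt,
    Finset.Nat.sum_antidiagonal_eq_sum_range_succ_mk, Finset.sum_div]
  refine Finset.sum_congr rfl fun i hi => ?_
  have hik : i ≤ k := Nat.lt_succ_iff.1 (Finset.mem_range.1 hi)
  rw [coeff_taylorSeries, coeff_taylorSeries, Nat.cast_choose ℝ hik]
  have h1 : (i.factorial : ℝ) ≠ 0 := by positivity
  have h2 : ((k - i).factorial : ℝ) ≠ 0 := by positivity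
  have h3 : (k.factorial : ℝ) ≠ 0 := by positivity
  field_simp

lemma taylorSeries_sub (hf : AnalyticAt ℝ f c) (hg : AnalyticAt ℝ g c) :
    taylorSeries (fun x => f x - g x) c = taylorSeries f c - taylorSeries g c := by
  ext k
  rw [map_sub, coeff_taylorSeries, iteratedDeriv_fun_sub hf.contDiffAt hg.contDiffAt,
    coeff_taylorSeries, coeff_taylorSeries, sub_div]

lemma taylorSeries_const (r c : ℝ) : taylorSeries (fun _ => r) c = C r := by
  ext k
  rw [coeff_taylorSeries, coeff_C, iteratedDeriv_const]
  split_ifs with h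
  · simp [h]
  · simp

lemma taylorSeries_id (c : ℝ) : taylorSeries (fun x => x) c = C c + X := by
  ext k
  rw [coeff_taylorSeries, map_add, coeff_C, coeff_X]
  rcases k with _ | _ | k
  · simp
  · simp
  · rw [iteratedDeriv_succ', iteratedDeriv_succ']
    have : deriv (deriv fun x : ℝ => x) = fun _ => 0 := by
      funext x; simp
    rw [this, iteratedDeriv_const]
    simp

lemma taylorSeries_deriv (f : ℝ → ℝ) (c : ℝ) :
    taylorSeries (deriv f) c = d⁄dX ℝ (taylorSeries f c) := by
  ext k
  rw [coeff_taylorSeries, coeff_derivative, coeff_taylorSeries, ← iteratedDeriv_succ',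
    Nat.factorial_succ]
  have : (k.factorial : ℝ) ≠ 0 := by positivity
  push_cast
  field_simp

lemma analyticAt_dslope (hf : AnalyticAt ℝ f c) : AnalyticAt ℝ (dslope f c) c := by
  obtain ⟨p, hp⟩ := hf
  exact ⟨_, hp.has_fpower_series_dslope_fslope⟩

/-- Passing to the divided difference at the centre shifts the Taylor coefficients by one place. -/
lemma taylorSeries_dslope (hf : AnalyticAt ℝ f c) :
    X * taylorSeries (dslope f c) c = taylorSeries f c - C (f c) := by
  have h1 : (fun x => (x - c) * dslope f c x) = fun x => f x - f c := by
    funext x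
    simpa using sub_smul_dslope f c x
  have h2 := taylorSeries_mul (f := fun x => x - c) (analyticAt_id.sub analyticAt_const)
    (analyticAt_dslope hf)
  rw [h1, taylorSeries_sub hf analyticAt_const, taylorSeries_const,
    taylorSeries_sub (f := fun x => x) analyticAt_id analyticAt_const, taylorSeries_id,
    taylorSeries_const] at h2
  rw [h2]; ring

end TaylorSeries

/-! ### The integration by parts operator on formal power series. -/

section PartsOperator

open PowerSeries

/-- The formal version of `g ↦ s * d/ds [(g(s) - g(μ)) / (s - μ)]` in the variable `s - μ`. -/
def partsOp (m : ℝ) (g : PowerSeries ℝ) : PowerSeries ℝ :=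
  PowerSeries.mk fun k => m * ((k + 1 : ℝ) * PowerSeries.coeff (k + 2) g) + k * PowerSeries.coeff (k + 1) g

lemma coeff_partsOp (m : ℝ) (g : PowerSeries ℝ) (k : ℕ) :
    PowerSeries.coeff k (partsOp m g) = m * ((k + 1 : ℝ) * PowerSeries.coeff (k + 2) g) + k * PowerSeries.coeff (k + 1) g := by
  simp [partsOp]

lemma coeff_C_add_X_mul (m : ℝ) (g : PowerSeries ℝ) (k : ℕ) :
    PowerSeries.coeff k ((C m + X) * d⁄dX ℝ g) = m * ((k + 1 : ℝ) * PowerSeries.coeff (k + 1) g) + k * PowerSeries.coeff k g := by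
  rw [add_mul, map_add, coeff_C_mul, coeff_derivative]
  rcases k with _ | k
  · simp
  · rw [coeff_succ_X_mul, coeff_derivative]; push_cast; ring

lemma partsOp_X_mul (m : ℝ) (g : PowerSeries ℝ) :
    partsOp m (X * g) = (C m + X) * d⁄dX ℝ g := by
  ext k
  rw [coeff_C_add_X_mul, coeff_partsOp, coeff_succ_X_mul, coeff_succ_X_mul]

lemma partsOp_eq_of_X_mul {m r : ℝ} {g h : PowerSeries ℝ} (hgh : X * h = g - C r) :
    partsOp m g = (C m + X) * d⁄dX ℝ h := by
  have : g = X * h + C r := by rw [hgh]; ring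
  ext k
  rw [← partsOp_X_mul, this, coeff_partsOp, coeff_partsOp]
  simp

/-- The divided difference of a linear function is constant. This freedom to drop multiples of `X`
is used in `hasDerivAt_auxTerm`. -/
lemma partsOp_X (m : ℝ) : partsOp m X = 0 := by
  have := partsOp_X_mul m 1
  rw [mul_one] at this
  rw [this, derivative_one, mul_zero]

lemma partsOp_sub (m : ℝ) (g h : PowerSeries ℝ) :
    partsOp m (g - h) = partsOp m g - partsOp m h := by
  ext k; simp only [coeff_partsOp, map_sub]; ring

lemma partsOp_C_mul (m r : ℝ) (g : PowerSeries ℝ) :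
    partsOp m (C r * g) = C r * partsOp m g := by
  ext k; simp only [coeff_partsOp, coeff_C_mul]; ring

/-- The operator is homogeneous under dilations, which is how the powers z⁻ⁿ of the expansion are
absorbed into a rescaled series. -/
lemma partsOp_rescale (m r : ℝ) (hr : r ≠ 0) (g : PowerSeries ℝ) :
    partsOp (m / r) (rescale r g) = C r * rescale r (partsOp m g) := by
  ext k
  simp only [coeff_partsOp, coeff_C_mul, coeff_rescale]
  field_simp
  ring

/-- The `n`-th coefficient functional: the constant coefficient of `partsOp^n g`. -/
def partsCoeff (m : ℝ) (n : ℕ) (g : PowerSeries ℝ) : ℝ := constantCoeff ((partsOp m)^[n] g)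

lemma partsCoeff_zero (m : ℝ) (g : PowerSeries ℝ) : partsCoeff m 0 g = constantCoeff g := rfl

lemma partsCoeff_succ (m : ℝ) (n : ℕ) (g : PowerSeries ℝ) :
    partsCoeff m (n + 1) g = partsCoeff m n (partsOp m g) := rfl

lemma partsCoeff_sub (m : ℝ) (n : ℕ) (g h : PowerSeries ℝ) :
    partsCoeff m n (g - h) = partsCoeff m n g - partsCoeff m n h := by
  induction n generalizing g h with
  | zero => simp [partsCoeff_zero]
  | succ n ih => rw [partsCoeff_succ, partsOp_sub, ih]; rfl

lemma partsCoeff_C_mul (m : ℝ) (n : ℕ) (r : ℝ) (g : PowerSeries ℝ) :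
    partsCoeff m n (C r * g) = r * partsCoeff m n g := by
  induction n generalizing g with
  | zero => simp [partsCoeff_zero]
  | succ n ih => rw [partsCoeff_succ, partsOp_C_mul, ih]; rfl

lemma partsCoeff_zero_series (m : ℝ) (n : ℕ) : partsCoeff m n 0 = 0 := by
  simpa using partsCoeff_C_mul m n 0 0

lemma partsCoeff_rescale (m r : ℝ) (hr : r ≠ 0) (n : ℕ) (g : PowerSeries ℝ) :
    partsCoeff (m / r) n (rescale r g) = r ^ n * partsCoeff m n g := by
  induction n generalizing g with
  | zero =>
    simp only [partsCoeff_zero, ← coeff_zero_eq_constantCoeff_apply, coeff_rescale]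
  | succ n ih =>
    rw [partsCoeff_succ, partsOp_rescale m r hr, partsCoeff_C_mul, ih, partsCoeff_succ]; ring

lemma rescale_derivative (r : ℝ) (g : PowerSeries ℝ) :
    d⁄dX ℝ (rescale r g) = C r * rescale r (d⁄dX ℝ g) := by
  ext k
  simp only [coeff_derivative, coeff_C_mul, coeff_rescale]; ring

end PartsOperator

end KummerExpansion
end

noncomputable section

namespace KummerExpansion

open Filter Topology

/-! ### Square coordinates at a nondegenerate minimum. -/

section Quadratic

lemma analyticAt_sqrt {x : ℝ} (hx : 0 < x) : AnalyticAt ℝ Real.sqrt x :=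
  (Real.contDiffAt_sqrt (n := ⊤) hx.ne').analyticAt

lemma analyticAt_log' {x : ℝ} (hx : x ≠ 0) : AnalyticAt ℝ Real.log x :=
  (Real.contDiffAt_log (n := ⊤).2 hx).analyticAt

/-- Near a nondegenerate minimum an analytic function is the square of an analytic coordinate. -/
lemma exists_sq_coordinate {g k : ℝ → ℝ} {c : ℝ} (hg : AnalyticAt ℝ g c) (hk : AnalyticAt ℝ k c)
    (hgk : ∀ᶠ s in 𝓝 c, deriv g s = (s - c) * k s) (hkc : 0 < k c) :
    ∃ P : ℝ → ℝ, AnalyticAt ℝ P c ∧ P c = 0 ∧ 0 < deriv P c ∧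
      ∀ᶠ s in 𝓝 c, g s - g c = P s ^ 2 ∧ SignType.sign (P s) = SignType.sign (s - c) := by
  have hd := analyticAt_dslope hg
  have hG := analyticAt_dslope hd
  have h0 : dslope g c c = 0 := by
    rw [dslope_same, hgk.self_of_nhds, sub_self, zero_mul]
  -- With g(s) − g(c) = (s − c)² G(s), comparing Taylor coefficients gives G(c) = k(c)/2 > 0. The
  -- coordinate is then (s − c)√G(s).
  have e1 := taylorSeries_dslope hg
  have e2 := taylorSeries_dslope hd
  have e3 := taylorSeries_congr hgk
  rw [taylorSeries_deriv, taylorSeries_mul (f := fun x => x - c) (analyticAt_id.sub analyticAt_const)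
    hk, taylorSeries_sub (f := fun x => x) analyticAt_id analyticAt_const, taylorSeries_id,
    taylorSeries_const, add_sub_cancel_left] at e3
  have e4 := congrArg (PowerSeries.coeff 1) e3
  have e1' := congrArg (PowerSeries.coeff 2) e1
  have e2' := congrArg (PowerSeries.coeff 1) e2
  rw [PowerSeries.coeff_succ_X_mul] at e4 e1' e2'
  rw [PowerSeries.coeff_derivative] at e4
  simp only [PowerSeries.coeff_zero_eq_constantCoeff_apply, constantCoeff_taylorSeries, map_sub,
    PowerSeries.coeff_C] at e4 e1' e2'
  norm_num at e4 e1' e2'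
  set G := dslope (dslope g c) c with hGdef
  have hGc : 0 < G c := by
    have : G c = deriv (dslope g c) c := by rw [hGdef, dslope_same]
    rw [this, e2', e1']; linarith
  have hfac : ∀ s, g s - g c = (s - c) ^ 2 * G s := by
    intro s
    have a1 := sub_smul_dslope g c s
    have a2 := sub_smul_dslope (dslope g c) c s
    rw [h0] at a2
    simp only [smul_eq_mul, sub_zero] at a1 a2
    rw [← a1, ← a2]; ring
  have hsq := (analyticAt_sqrt hGc).fun_comp hG
  refine ⟨fun s => (s - c) * Real.sqrt (G s), (analyticAt_id.sub analyticAt_const).mul hsq,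
    by simp, ?_, ?_⟩
  · have : HasDerivAt (fun s => (s - c) * Real.sqrt (G s)) _ c :=
      ((hasDerivAt_id c).sub_const c).mul hsq.differentiableAt.hasDerivAt
    rw [this.deriv]
    simpa using hGc
  · filter_upwards [hG.continuousAt.eventually (lt_mem_nhds hGc)] with s hs
    refine ⟨?_, ?_⟩
    · rw [hfac, mul_pow, Real.sq_sqrt hs.le]
    · rw [sign_mul, sign_pos (Real.sqrt_pos.2 hs), mul_one]

end Quadratic

/-! ### Uniqueness and local analyticity of the transformation s ↦ t(s). -/

section Transformation

variable {α β : ℝ}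

lemma hasDerivAt_phi (hα : 0 < α) {t : ℝ} (ht0 : t ≠ 0) (ht1 : t < 1) :
    HasDerivAt (phi α β) ((t - t0 α β) * (t1 α β - t) / (t * (1 - t))) t := by
  have h1 : (1 : ℝ) - t ≠ 0 := by linarith
  have := ((hasDerivAt_id t).sub ((((hasDerivAt_id t).const_sub 1).log h1).const_mul α)).sub
    ((Real.hasDerivAt_log ht0).const_mul (mu α β))
  refine this.congr_deriv ?_
  have hm := t0_mul_t1 (β := β) hα
  have ho := one_sub_t0_mul (β := β) hα
  simp only [id]
  field_simp
  linear_combination (1-t) * hm - t * ho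

lemma hasDerivAt_psi {s : ℝ} (hs : s ≠ 0) :
    HasDerivAt (psi α β) ((s - mu α β) / s) s := by
  have := (hasDerivAt_id s).sub ((Real.hasDerivAt_log hs).const_mul (mu α β))
  refine this.congr_deriv ?_
  field_simp

lemma analyticAt_phi {t : ℝ} (ht0 : t ≠ 0) (ht1 : t < 1) : AnalyticAt ℝ (phi α β) t := by
  have h1 : AnalyticAt ℝ (fun t : ℝ => Real.log (1 - t)) t :=
    (analyticAt_log' (by linarith : (1:ℝ) - t ≠ 0)).fun_comp (analyticAt_const.sub analyticAt_id)
  exact (analyticAt_id.sub (analyticAt_const.mul h1)).sub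
    (analyticAt_const.mul (analyticAt_log' ht0))

lemma analyticAt_psi {s : ℝ} (hs : s ≠ 0) : AnalyticAt ℝ (psi α β) s :=
  analyticAt_id.sub (analyticAt_const.mul (analyticAt_log' hs))

lemma sign_eq_of_mem_Icc {x y w : ℝ} (h : SignType.sign x = SignType.sign y) (h1 : x ≤ w)
    (h2 : w ≤ y) : SignType.sign w = SignType.sign x := by
  rcases lt_trichotomy x 0 with hx | hx | hx
  · rw [sign_neg hx] at h ⊢
    have := sign_eq_neg_one_iff.1 h.symm
    exact sign_neg (by linarith)
  · rw [hx, sign_zero] at h ⊢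
    have := sign_eq_zero_iff.1 h.symm
    rw [sign_eq_zero_iff]; linarith
  · rw [sign_pos (by linarith), sign_pos hx]

/-- Two distinct solutions would lie on the same side of 0 and of t₀. Rolle's theorem then gives a
zero of φ' strictly between them, but for t < 1 < t₁ the only zero of φ' is t₀. -/
lemma corresponds_unique (hα : 0 < α) {s t t' : ℝ} (hs : s ≠ 0) (h : Corresponds α β s t)
    (h' : Corresponds α β s t') : t = t' := by
  wlog hlt : t < t' generalizing t t'
  · rcases lt_trichotomy t t' with h1 | h1 | h1
    · exact this h h' h1
    · exact h1
    · exact (this h' h h1).symm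
  exfalso
  obtain ⟨a1, a2, a3, a4⟩ := h
  obtain ⟨b1, b2, b3, b4⟩ := h'
  have hsg : SignType.sign t = SignType.sign t' := a2.trans b2.symm
  have hst : SignType.sign (t - t0 α β) = SignType.sign (t' - t0 α β) := a3.trans b3.symm
  have hne : ∀ w, t ≤ w → w ≤ t' → w ≠ 0 := by
    intro w h1 h2 h0
    have := (sign_eq_of_mem_Icc hsg h1 h2).trans a2
    rw [h0, sign_zero] at this
    exact hs (sign_eq_zero_iff.1 this.symm)
  obtain ⟨w, ⟨hw1, hw2⟩, hw⟩ := exists_hasDerivAt_eq_zero (f := phi α β) hlt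
    (fun w hw => (hasDerivAt_phi hα (hne w hw.1 hw.2)
      (hw.2.trans_lt b1)).continuousAt.continuousWithinAt)
    (by have := a4 hs; have := b4 hs; linarith)
    (fun w hw => hasDerivAt_phi hα (hne w hw.1.le hw.2.le) (hw.2.trans b1))
  have c1 := hne w hw1.le hw2.le
  have c2 := one_lt_t1 (β := β) hα
  have c3 : w ≠ t0 α β := by
    intro h0
    have h1 := sign_eq_of_mem_Icc hst (w := w - t0 α β) (by linarith) (by linarith)
    rw [h0, sub_self, sign_zero] at h1
    have := sign_eq_zero_iff.1 h1.symm
    rw [h1.symm] at hst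
    have := sign_eq_zero_iff.1 hst.symm
    linarith
  have c4 : (w - t0 α β) * (t1 α β - w) / (w * (1 - w)) ≠ 0 := by
    refine div_ne_zero (mul_ne_zero (sub_ne_zero.2 c3) ?_) (mul_ne_zero c1 ?_) <;> linarith
  exact c4 hw

lemma tOf_eq (hα : 0 < α) {s t : ℝ} (hs : s ≠ 0) (h : Corresponds α β s t) :
    tOf α β s = t :=
  corresponds_unique hα hs (Classical.epsilon_spec (p := Corresponds α β s) ⟨t, h⟩) h

lemma tOf_zero (hα : 0 < α) : tOf α β 0 = 0 := by
  have h : Corresponds α β 0 0 := by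
    refine ⟨one_pos, rfl, ?_, fun h => absurd rfl h⟩
    rw [zero_sub, zero_sub, Left.sign_neg, Left.sign_neg, sign_t0 hα]
  have := (Classical.epsilon_spec (p := Corresponds α β 0) ⟨0, h⟩).2.1
  rw [sign_zero] at this
  exact sign_eq_zero_iff.1 this

/-- Local structure of the transformation at the saddle point. -/
lemma tOf_local (hα : 0 < α) (hμ : mu α β ≠ 0) :
    AnalyticAt ℝ (tOf α β) (mu α β) ∧ tOf α β (mu α β) = t0 α β ∧
      0 < deriv (tOf α β) (mu α β) ∧
      ∀ᶠ s in 𝓝 (mu α β), s * (tOf α β s - t0 α β) * (t1 α β - tOf α β s) * deriv (tOf α β) s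
        = (s - mu α β) * (tOf α β s * (1 - tOf α β s)) := by
  set m := mu α β with hm
  set p := t0 α β with hp
  set q := t1 α β with hq
  have hpq : p * q = m := t0_mul_t1 hα
  have hq1 : 1 < q := one_lt_t1 hα
  have hp1 : p < 1 := t0_lt_one hα
  have hp0 : p ≠ 0 := by rintro h; rw [h, zero_mul] at hpq; exact hμ hpq.symm
  -- Since t₀ and μ have the same sign, multiplying φ and ψ by μ makes both saddle points minima,
  -- whatever that sign is.
  have hφa : AnalyticAt ℝ (phi α β) p := analyticAt_phi hp0 hp1
  have hψa : AnalyticAt ℝ (psi α β) m := analyticAt_psi hμ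
  -- square coordinates
  obtain ⟨P, hPa, hP0, hPd, hP⟩ := exists_sq_coordinate (g := fun t => m * phi α β t)
    (k := fun t => m * (q - t) / (t * (1 - t))) (c := p) (analyticAt_const.mul hφa)
    ((analyticAt_const.mul (analyticAt_const.sub analyticAt_id)).div
      (analyticAt_id.mul (analyticAt_const.sub analyticAt_id))
      (mul_ne_zero hp0 (sub_ne_zero.2 hp1.ne')))
    (by
      filter_upwards [isOpen_ne.mem_nhds hp0, gt_mem_nhds hp1] with t ht0 ht1
      rw [((hasDerivAt_phi hα ht0 ht1).const_mul m).deriv]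
      ring)
    (by
      rw [← hpq]
      have h1 : p * q * (q - p) / (p * (1 - p)) = q * (q - p) / (1 - p) := by
        have : 1 - p ≠ 0 := by linarith
        field_simp
      rw [h1]
      exact div_pos (mul_pos (by linarith) (by linarith)) (by linarith))
  obtain ⟨Q, hQa, hQ0, hQd, hQ⟩ := exists_sq_coordinate (g := fun t => m * psi α β t)
    (k := fun t => m / t) (c := m) (analyticAt_const.mul hψa)
    (analyticAt_const.div analyticAt_id hμ)
    (by
      filter_upwards [isOpen_ne.mem_nhds hμ] with t ht0
      rw [((hasDerivAt_psi ht0).const_mul m).deriv]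
      ring)
    (by rw [div_self hμ]; exact one_pos)
  -- the local inverse
  set r := hPa.hasStrictDerivAt.localInverse _ _ _ hPd.ne' with hr
  have hra : AnalyticAt ℝ r (P p) := hPa.analyticAt_localInverse hPd.ne'
  have hrp : r (P p) = p := HasStrictFDerivAt.localInverse_apply_image ..
  have hri : ∀ᶠ y in 𝓝 (P p), P (r y) = y := HasStrictDerivAt.eventually_right_inverse ..
  have hQP : Q m = P p := by rw [hQ0, hP0]
  have hτa : AnalyticAt ℝ (fun s => r (Q s)) m := by
    refine AnalyticAt.fun_comp ?_ hQa
    rw [hQP]; exact hra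
  have hτm : r (Q m) = p := by rw [hQP, hrp]
  have hτt : Tendsto (fun s => r (Q s)) (𝓝 m) (𝓝 p) := by
    have := hτa.continuousAt.tendsto
    rwa [hτm] at this
  have hPτ : ∀ᶠ s in 𝓝 m, P (r (Q s)) = Q s := by
    have := hQa.continuousAt.tendsto
    rw [hQP] at this
    exact this.eventually hri
  have hsgn : ∀ {x : ℝ}, x ≠ 0 → ∀ᶠ y in 𝓝 x, SignType.sign y = SignType.sign x := by
    intro x hx
    rcases lt_or_gt_of_ne hx with h | h
    · filter_upwards [gt_mem_nhds h] with y hy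
      rw [sign_neg h, sign_neg hy]
    · filter_upwards [lt_mem_nhds h] with y hy
      rw [sign_pos h, sign_pos hy]
  -- P and Q carry the signs of t − t₀ and s − μ, so the equation P(t) = Q(s) encodes the sign rule
  -- as well as the equality of exponents. Uniqueness then identifies the local branch with `tOf`.
  have heq : tOf α β =ᶠ[𝓝 m] fun s => r (Q s) := by
    filter_upwards [hPτ, hQ, hτt.eventually hP, hsgn hμ, hτt.eventually (hsgn hp0),
      hτt.eventually (gt_mem_nhds hp1), isOpen_ne.mem_nhds hμ] with s h1 h2 h3 h4 h5 h6 h7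
    refine tOf_eq hα h7 ⟨h6, ?_, ?_, fun _ => ?_⟩
    · rw [h4, h5, sign_t0 hα]
    · rw [← hp, ← h3.2, h1, h2.2]
    · have e1 := h3.1
      rw [h1, ← h2.1] at e1
      apply mul_left_cancel₀ hμ
      rw [← hp, ← hm]
      linear_combination e1
  have hta : AnalyticAt ℝ (tOf α β) m := hτa.congr heq.symm
  have htm : tOf α β m = p := heq.self_of_nhds.trans hτm
  have htt : Tendsto (tOf α β) (𝓝 m) (𝓝 p) := by
    have := hta.continuousAt.tendsto
    rwa [htm] at this
  have hPt : (fun s => P (tOf α β s)) =ᶠ[𝓝 m] Q := by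
    filter_upwards [heq, hPτ] with s h1 h2
    rw [h1, h2]
  refine ⟨hta, htm, ?_, ?_⟩
  · have h1 : HasDerivAt (fun s => P (tOf α β s)) (deriv P p * deriv (tOf α β) m) m := by
      refine HasDerivAt.comp m ?_ hta.differentiableAt.hasDerivAt
      rw [htm]; exact hPa.differentiableAt.hasDerivAt
    have h2 := (h1.congr_of_eventuallyEq hPt.symm).deriv
    rw [h2] at hQd
    exact pos_of_mul_pos_right hQd hPd.le
  · have hrel : ∀ᶠ s in 𝓝 m, phi α β (tOf α β s) - phi α β p = psi α β s - psi α β m := by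
      filter_upwards [hPt, hQ, htt.eventually hP] with s h1 h2 h3
      have e1 := h3.1
      have h1' : P (tOf α β s) = Q s := h1
      rw [h1', ← h2.1] at e1
      apply mul_left_cancel₀ hμ
      linear_combination e1
    filter_upwards [hrel.eventually_nhds, hta.eventually_analyticAt,
      htt.eventually (isOpen_ne.mem_nhds hp0), htt.eventually (gt_mem_nhds hp1),
      isOpen_ne.mem_nhds hμ] with s h1 h2 h3 h4 h5
    have d1 := ((hasDerivAt_phi (β := β) hα h3 h4).comp s
      h2.differentiableAt.hasDerivAt).sub_const (phi α β p)
    have d2 := (hasDerivAt_psi (α := α) (β := β) h5).sub_const (psi α β m)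
    have d3 := (d2.congr_of_eventuallyEq h1).unique d1
    have : 1 - tOf α β s ≠ 0 := by linarith
    rw [← hp, ← hq, ← hm] at d3
    field_simp at d3
    linear_combination -d3

/-- For μ = 0 the relation is t − α log(1 − t) = s, whose left side has derivative 1 + α at 0. A
nonzero t'(0) is needed because f(0) is then the quotient t'(0)/t'(0). -/
lemma deriv_tOf_zero_ne (hα : 0 < α) (hμ : mu α β = 0) : deriv (tOf α β) 0 ≠ 0 := by
  have ht0 : t0 α β = 0 := by
    have h1 := t0_mul_t1 (β := β) hα
    have h2 := one_lt_t1 (β := β) hα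
    rw [hμ] at h1
    rcases mul_eq_zero.1 h1 with h | h
    · exact h
    · linarith
  set w : ℝ → ℝ := fun t => t - α * Real.log (1 - t) with hw
  have hwa : AnalyticAt ℝ w 0 := by
    have h1 : AnalyticAt ℝ (fun t : ℝ => Real.log (1 - t)) 0 :=
      (analyticAt_log' (by norm_num : (1:ℝ) - 0 ≠ 0)).fun_comp (analyticAt_const.sub analyticAt_id)
    exact analyticAt_id.sub (analyticAt_const.mul h1)
  have hwd : HasDerivAt w (1 + α) 0 := by
    have := (hasDerivAt_id (0:ℝ)).sub
      ((((hasDerivAt_id (0:ℝ)).const_sub 1).log (by norm_num)).const_mul α)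
    refine this.congr_deriv ?_
    simp
  have hwd' : deriv w 0 ≠ 0 := by rw [hwd.deriv]; positivity
  have hw0 : w 0 = 0 := by simp [hw]
  have hpos : ∀ {t}, 0 < t → t < 1 → 0 < w t := by
    intro t h1 h2
    have := Real.log_neg (by linarith : 0 < 1 - t) (by linarith)
    simp only [hw]; nlinarith
  have hneg : ∀ {t}, t < 0 → w t < 0 := by
    intro t h1
    have := Real.log_pos (by linarith : 1 < 1 - t)
    simp only [hw]; nlinarith
  have hsign : ∀ {t}, t < 1 → SignType.sign (w t) = SignType.sign t := by
    intro t h1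
    rcases lt_trichotomy t 0 with h | h | h
    · rw [sign_neg h, sign_neg (hneg h)]
    · rw [h, hw0]
    · rw [sign_pos h, sign_pos (hpos h h1)]
  set r := hwa.hasStrictDerivAt.localInverse _ _ _ hwd' with hr
  have hra : AnalyticAt ℝ r (w 0) := hwa.analyticAt_localInverse hwd'
  have hrp : r (w 0) = 0 := HasStrictFDerivAt.localInverse_apply_image ..
  have hri : ∀ᶠ y in 𝓝 (w 0), w (r y) = y := HasStrictDerivAt.eventually_right_inverse ..
  rw [hw0] at hra hrp hri
  have hrt : Tendsto r (𝓝 0) (𝓝 0) := by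
    have := hra.continuousAt.tendsto
    rwa [hrp] at this
  have heq : tOf α β =ᶠ[𝓝 0] r := by
    filter_upwards [hri, hrt.eventually (gt_mem_nhds one_pos)] with s h1 h2
    by_cases hs : s = 0
    · rw [hs, hrp, tOf_zero hα]
    · have h3 : SignType.sign (r s) = SignType.sign s := by rw [← hsign h2, h1]
      refine tOf_eq hα hs ⟨h2, h3, ?_, fun _ => ?_⟩
      · rw [ht0, hμ, sub_zero, sub_zero, h3]
      · simp only [phi, psi, hμ, ht0]
        simp only [hw] at h1
        simp [h1]
  have h1 : HasDerivAt (fun s => w (r s)) ((1 + α) * deriv r 0) 0 := by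
    refine HasDerivAt.comp (h₂ := w) 0 ?_ hra.differentiableAt.hasDerivAt
    rw [hrp]; exact hwd
  have h2 := (h1.congr_of_eventuallyEq (f₁ := fun s => s)
    (hri.mono fun _ h => h.symm)).unique (hasDerivAt_id 0)
  rw [heq.deriv_eq]
  intro h
  rw [h, mul_zero] at h2
  exact zero_ne_one h2

end Transformation

end KummerExpansion
end

noncomputable section

namespace KummerExpansion

open Filter Topology PowerSeries

/-! ### The coefficients fₙ(μ) from the Taylor series of f, for μ ≠ 0. -/

section Jets

variable {α β : ℝ}

lemma t0_ne_zero (hα : 0 < α) (hμ : mu α β ≠ 0) : t0 α β ≠ 0 := by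
  intro h
  have := t0_mul_t1 (β := β) hα
  rw [h, zero_mul] at this
  exact hμ this.symm

lemma f_eventuallyEq (hα : 0 < α) (hμ : mu α β ≠ 0) :
    f α β =ᶠ[𝓝 (mu α β)] fun s => s * deriv (tOf α β) s / (tOf α β s * (1 - tOf α β s)) := by
  filter_upwards [isOpen_ne.mem_nhds hμ] with s hs
  have hs' : s ≠ 0 := hs
  rw [f, dslope_of_ne _ hs', slope_def_field, tOf_zero hα, sub_zero, sub_zero,
    div_mul_eq_mul_div, div_div_eq_mul_div, mul_comm s]

lemma tOf_mul_ne_zero (hα : 0 < α) (hμ : mu α β ≠ 0) :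
    ∀ᶠ s in 𝓝 (mu α β), tOf α β s * (1 - tOf α β s) ≠ 0 := by
  obtain ⟨ha, hm, -, -⟩ := tOf_local hα hμ
  have h : AnalyticAt ℝ (fun s => tOf α β s * (1 - tOf α β s)) (mu α β) :=
    ha.mul (analyticAt_const.sub ha)
  refine h.continuousAt.eventually_ne ?_
  have h1 := t0_lt_one (β := β) hα
  rw [hm]
  exact mul_ne_zero (t0_ne_zero hα hμ) (by linarith)

lemma analyticAt_f (hα : 0 < α) (hμ : mu α β ≠ 0) : AnalyticAt ℝ (f α β) (mu α β) := by
  obtain ⟨ha, -, -, -⟩ := tOf_local hα hμ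
  refine AnalyticAt.congr ?_ (f_eventuallyEq hα hμ).symm
  exact (analyticAt_id.mul ha.deriv).div (ha.mul (analyticAt_const.sub ha))
    (tOf_mul_ne_zero hα hμ).self_of_nhds

/-- Analyticity survives each step, so divided difference, derivative and multiplication by s can
all be carried out on Taylor series; from here on the coefficients are algebraic objects. -/
lemma fIter_analytic_taylor (hα : 0 < α) (hμ : mu α β ≠ 0) (n : ℕ) :
    AnalyticAt ℝ (fIter α β n) (mu α β) ∧
      taylorSeries (fIter α β n) (mu α β) =
        (partsOp (mu α β))^[n] (taylorSeries (f α β) (mu α β)) := by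
  induction n with
  | zero => exact ⟨analyticAt_f hα hμ, rfl⟩
  | succ n ih =>
    obtain ⟨h1, h2⟩ := ih
    have h3 := (analyticAt_dslope h1).deriv
    refine ⟨analyticAt_id.mul h3, ?_⟩
    rw [Function.iterate_succ_apply', ← h2, partsOp_eq_of_X_mul (taylorSeries_dslope h1),
      ← taylorSeries_deriv, ← taylorSeries_id, ← taylorSeries_mul (f := fun x => x) analyticAt_id h3]
    rfl

lemma coeff_eq_partsCoeff (hα : 0 < α) (hμ : mu α β ≠ 0) (n : ℕ) :
    coeff α β n = partsCoeff (mu α β) n (taylorSeries (f α β) (mu α β)) := by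
  rw [partsCoeff, ← (fIter_analytic_taylor hα hμ n).2, constantCoeff_taylorSeries]
  rfl

lemma taylorSeries_tOf_ode (hα : 0 < α) (hμ : mu α β ≠ 0) :
    (C (mu α β) + X) * (taylorSeries (tOf α β) (mu α β) - C (t0 α β)) *
        (C (t1 α β) - taylorSeries (tOf α β) (mu α β)) *
        d⁄dX ℝ (taylorSeries (tOf α β) (mu α β)) =
      X * (taylorSeries (tOf α β) (mu α β) * (1 - taylorSeries (tOf α β) (mu α β))) := by
  obtain ⟨ha, -, -, hode⟩ := tOf_local hα hμ
  have hc : ∀ r : ℝ, AnalyticAt ℝ (fun _ : ℝ => r) (mu α β) := fun r => analyticAt_const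
  have hi : AnalyticAt ℝ (fun s : ℝ => s) (mu α β) := analyticAt_id
  have := taylorSeries_congr hode
  rw [taylorSeries_mul (((hi.fun_mul (ha.fun_sub (hc _))).fun_mul ((hc _).fun_sub ha))) ha.deriv,
    taylorSeries_mul (hi.fun_mul (ha.fun_sub (hc _))) ((hc _).fun_sub ha),
    taylorSeries_mul hi (ha.fun_sub (hc _)), taylorSeries_sub ha (hc _), taylorSeries_sub (hc _) ha,
    taylorSeries_mul (hi.fun_sub (hc _)) (ha.fun_mul ((hc _).fun_sub ha)), taylorSeries_mul ha ((hc _).fun_sub ha),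
    taylorSeries_sub hi (hc _), taylorSeries_sub (hc 1) ha, taylorSeries_deriv] at this
  simp only [taylorSeries_const, taylorSeries_id, add_sub_cancel_left, map_one] at this
  exact this

lemma taylorSeries_f_mul (hα : 0 < α) (hμ : mu α β ≠ 0) :
    taylorSeries (f α β) (mu α β) *
        (taylorSeries (tOf α β) (mu α β) * (1 - taylorSeries (tOf α β) (mu α β))) =
      (C (mu α β) + X) * d⁄dX ℝ (taylorSeries (tOf α β) (mu α β)) := by
  obtain ⟨ha, -, -, -⟩ := tOf_local hα hμ
  have hc : ∀ r : ℝ, AnalyticAt ℝ (fun _ : ℝ => r) (mu α β) := fun r => analyticAt_const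
  have hi : AnalyticAt ℝ (fun s : ℝ => s) (mu α β) := analyticAt_id
  have h : (fun s => f α β s * (tOf α β s * (1 - tOf α β s))) =ᶠ[𝓝 (mu α β)]
      fun s => s * deriv (tOf α β) s := by
    filter_upwards [f_eventuallyEq hα hμ, tOf_mul_ne_zero hα hμ] with s h1 h2
    rw [h1, div_mul_cancel₀ _ h2]
  have := taylorSeries_congr h
  rw [taylorSeries_mul (analyticAt_f hα hμ) (ha.fun_mul ((hc _).fun_sub ha)),
    taylorSeries_mul ha ((hc _).fun_sub ha), taylorSeries_sub (hc 1) ha,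
    taylorSeries_mul hi ha.deriv, taylorSeries_deriv] at this
  simpa only [taylorSeries_const, taylorSeries_id, map_one] using this

end Jets

/-! ### Rescaling to the variable zs − (b − a). -/

section Scaled

/-- The Taylor series of `t` at the saddle point, in the variable `z s - (b - a)`. -/
def tSeries (a b z : ℝ) : PowerSeries ℝ :=
  rescale (1 / z) (taylorSeries (tOf (a / z) (b / z)) (mu (a / z) (b / z)))

/-- The Taylor series of `f` at the saddle point, in the variable `z s - (b - a)`. -/
def fSeries (a b z : ℝ) : PowerSeries ℝ :=
  rescale (1 / z) (taylorSeries (f (a / z) (b / z)) (mu (a / z) (b / z)))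

variable {a b z : ℝ}

lemma mu_div_ne_zero (hab : a ≠ b) (hz : 0 < z) : mu (a / z) (b / z) ≠ 0 := by
  rw [mu, ← sub_div]
  exact div_ne_zero (sub_ne_zero.2 hab.symm) hz.ne'

lemma mu_div_inv (a b : ℝ) (hz : 0 < z) : mu (a / z) (b / z) / (1 / z) = b - a := by
  rw [mu]; field_simp

/-- After rescaling, the operator has parameter b − a, constant along the ray; the whole dependence
on z sits in `fSeries`. -/
lemma coeff_div_pow_eq (ha : 0 < a) (hab : a ≠ b) (hz : 0 < z) (n : ℕ) :
    coeff (a / z) (b / z) n / z ^ n = partsCoeff (b - a) n (fSeries a b z) := by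
  rw [coeff_eq_partsCoeff (div_pos ha hz) (mu_div_ne_zero hab hz), fSeries,
    ← mu_div_inv a b hz, partsCoeff_rescale _ _ (by positivity), one_div, inv_pow]
  field_simp

lemma constantCoeff_tSeries (ha : 0 < a) (hab : a ≠ b) (hz : 0 < z) :
    constantCoeff (tSeries a b z) = t0 (a / z) (b / z) := by
  rw [tSeries, ← coeff_zero_eq_constantCoeff_apply, coeff_rescale, pow_zero, one_mul,
    coeff_zero_eq_constantCoeff_apply, constantCoeff_taylorSeries,
    (tOf_local (div_pos ha hz) (mu_div_ne_zero hab hz)).2.1]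

lemma coeff_one_tSeries_pos (ha : 0 < a) (hab : a ≠ b) (hz : 0 < z) :
    0 < PowerSeries.coeff 1 (tSeries a b z) := by
  rw [tSeries, coeff_rescale, pow_one, coeff_one_taylorSeries]
  exact mul_pos (by positivity) (tOf_local (div_pos ha hz) (mu_div_ne_zero hab hz)).2.2.1

lemma rescale_C (r x : ℝ) : rescale r (C x) = C x := by
  ext k
  rw [coeff_rescale, coeff_C]
  split_ifs with h
  · simp [h]
  · simp

lemma rescale_deriv_eq {r : ℝ} (hr : r ≠ 0) (g : PowerSeries ℝ) :
    rescale r (d⁄dX ℝ g) = C r⁻¹ * d⁄dX ℝ (rescale r g) := by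
  rw [rescale_derivative, ← mul_assoc, ← map_mul, inv_mul_cancel₀ hr, map_one, one_mul]

lemma rescale_C_add_X (a b : ℝ) (hz : 0 < z) :
    rescale (1 / z) (C (mu (a / z) (b / z)) + X) * C (1 / z)⁻¹ = C (b - a) + X := by
  rw [map_add, rescale_C, rescale_X, add_mul, ← map_mul, mul_right_comm, ← map_mul,
    mul_inv_cancel₀ (by positivity), map_one, one_mul, ← div_eq_mul_inv, mu_div_inv a b hz]

lemma tSeries_ode (ha : 0 < a) (hab : a ≠ b) (hz : 0 < z) :
    (C (b - a) + X) * (tSeries a b z - C (t0 (a / z) (b / z))) *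
        (C (t1 (a / z) (b / z)) - tSeries a b z) * d⁄dX ℝ (tSeries a b z) =
      C (1 / z) * X * (tSeries a b z * (1 - tSeries a b z)) := by
  have h := congrArg (rescale (1 / z))
    (taylorSeries_tOf_ode (div_pos ha hz) (mu_div_ne_zero hab hz))
  simp only [map_mul, map_sub, rescale_C, map_one, rescale_X] at h
  rw [rescale_deriv_eq (by positivity : 1 / z ≠ 0)] at h
  rw [← rescale_C_add_X a b hz]
  unfold tSeries
  linear_combination h

lemma fSeries_mul (ha : 0 < a) (hab : a ≠ b) (hz : 0 < z) :
    fSeries a b z * (tSeries a b z * (1 - tSeries a b z)) =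
      (C (b - a) + X) * d⁄dX ℝ (tSeries a b z) := by
  have h := congrArg (rescale (1 / z))
    (taylorSeries_f_mul (div_pos ha hz) (mu_div_ne_zero hab hz))
  simp only [map_mul, map_sub, map_one] at h
  rw [rescale_deriv_eq (by positivity : 1 / z ≠ 0)] at h
  rw [← rescale_C_add_X a b hz]
  unfold tSeries fSeries
  linear_combination h

lemma tSeries_mul_ne_zero (ha : 0 < a) (hab : a ≠ b) (hz : 0 < z) :
    tSeries a b z * (1 - tSeries a b z) ≠ 0 := by
  intro h
  have h1 := congrArg constantCoeff h
  rw [map_mul, map_sub, constantCoeff_tSeries ha hab hz, map_one, map_zero] at h1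
  have h2 := t0_lt_one (β := b / z) (div_pos ha hz)
  have h3 := t0_ne_zero (div_pos ha hz) (mu_div_ne_zero hab hz)
  rcases mul_eq_zero.1 h1 with h | h
  · exact h3 h
  · linarith

/-- Eliminating dt/ds between the definition of f and the differential equation of t leaves f·(t −
t₀)(t₁ − t) = s − μ. -/
lemma fSeries_mul_factors (ha : 0 < a) (hab : a ≠ b) (hz : 0 < z) :
    fSeries a b z * (tSeries a b z - C (t0 (a / z) (b / z))) *
      (C (t1 (a / z) (b / z)) - tSeries a b z) = C (1 / z) * X := by
  apply mul_right_cancel₀ (tSeries_mul_ne_zero ha hab hz)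
  linear_combination (tSeries a b z - C (t0 (a / z) (b / z))) *
    (C (t1 (a / z) (b / z)) - tSeries a b z) * fSeries_mul ha hab hz + tSeries_ode ha hab hz

end Scaled

end KummerExpansion
end

noncomputable section

namespace KummerExpansion

open Filter Topology PowerSeries

/-! ### The formal differential equation of t and its linearisation. -/

section FormalOde

/-- The left-hand side of the formal differential equation of the transformation. -/
def odeLhs (m p q e : ℝ) (T : PowerSeries ℝ) : PowerSeries ℝ :=
  (C m + X) * (T - C p) * (C q - T) * d⁄dX ℝ T - C e * X * (T * (1 - T))

lemma exists_eq_C_add_X_mul (S : PowerSeries ℝ) :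
    ∃ H : PowerSeries ℝ, S = C (constantCoeff S) + X * H ∧
      constantCoeff H = PowerSeries.coeff 1 S := by
  have h : X ∣ S - C (constantCoeff S) := by
    rw [X_dvd_iff]; simp
  obtain ⟨H, hH⟩ := h
  refine ⟨H, by rw [← hH]; ring, ?_⟩
  have := congrArg (PowerSeries.coeff 1) hH
  rw [coeff_succ_X_mul] at this
  simpa [coeff_C] using this.symm

/-- A perturbation of order n + 2 first enters at degree n + 2, and does so linearly:
differentiation contributes the factor n + 2, and the factor T − p contributes one more. The
multiplier is nonzero when m, q − p and the first coefficient of S are, so the equation is a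
recursion. -/
lemma coeff_odeLhs_add (m p q e : ℝ) (S W : PowerSeries ℝ) (n : ℕ) (hS : constantCoeff S = p) :
    PowerSeries.coeff (n + 2) (odeLhs m p q e (S + X ^ (n + 2) * W)) =
      PowerSeries.coeff (n + 2) (odeLhs m p q e S) +
        m * (q - p) * (n + 3) * PowerSeries.coeff 1 S * constantCoeff W := by
  obtain ⟨H, hH, hH0⟩ := exists_eq_C_add_X_mul S
  rw [hS] at hH
  have hd : d⁄dX ℝ (X ^ (n + 2) * W) =
      X ^ (n + 1) * (X * d⁄dX ℝ W + C (n + 2 : ℝ) * W) := by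
    rw [Derivation.leibniz, derivative_pow, derivative_X, smul_eq_mul, smul_eq_mul]
    simp only [map_add, map_natCast, map_ofNat]
    push_cast
    ring_nf
  have key : odeLhs m p q e (S + X ^ (n + 2) * W) = odeLhs m p q e S + X ^ (n + 2) *
      ((C m + X) * (H * (C q - S) * (X * d⁄dX ℝ W + C (n + 2 : ℝ) * W)
        - X * H * W * (d⁄dX ℝ S + X ^ (n + 1) * (X * d⁄dX ℝ W + C (n + 2 : ℝ) * W))
        + W * (C q - S - X ^ (n + 2) * W) *
          (d⁄dX ℝ S + X ^ (n + 1) * (X * d⁄dX ℝ W + C (n + 2 : ℝ) * W)))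
        - C e * X * W * (1 - 2 * S - X ^ (n + 2) * W)) := by
    have hSH : S - C p = X * H := by rw [hH]; ring
    unfold odeLhs
    rw [map_add, hd, show S + X ^ (n + 2) * W - C p = X * H + X ^ (n + 2) * W by rw [← hSH]; ring,
      hSH]
    ring
  have hS1 : constantCoeff (d⁄dX ℝ S) = PowerSeries.coeff 1 S := by
    rw [← coeff_zero_eq_constantCoeff_apply, coeff_derivative]; simp
  rw [key, map_add]
  congr 1
  rw [coeff_X_pow_mul', if_pos le_rfl, Nat.sub_self, coeff_zero_eq_constantCoeff_apply]
  simp only [map_add, map_sub, map_mul, constantCoeff_C, constantCoeff_X, map_pow, hS, hH0, hS1]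
  ring

/-- A series solving the linearised equation, with vanishing constant term, vanishes. -/
lemma eq_zero_of_linearized {m e : ℝ} {Z H Q T V : PowerSeries ℝ} (hm : m ≠ 0)
    (hH : constantCoeff H ≠ 0) (hQ : constantCoeff Q ≠ 0)
    (hV : constantCoeff V = constantCoeff H) (hZ : constantCoeff Z = 0)
    (h : (C m + X) * (Z * (Q - X * H) * V + X * H * Q * d⁄dX ℝ Z) = C e * X * T * Z) : Z = 0 := by
  by_contra hne
  -- Look at the lowest nonzero coefficient of Z, in degree k + 1. The equation multiplies it by a
  -- nonzero number containing k + 2, so it must vanish.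
  obtain ⟨k, W, hW, hW0⟩ : ∃ k W, Z = X ^ k * W ∧ constantCoeff W ≠ 0 := by
    refine ⟨Z.order.toNat, Z.divXPowOrder, X_pow_order_mul_divXPowOrder.symm, ?_⟩
    rw [constantCoeff_divXPowOrder]
    exact coeff_order hne
  rcases k with _ | k
  · rw [hW, pow_zero, one_mul] at hZ; exact hW0 hZ
  have hd : d⁄dX ℝ (X ^ (k + 1) * W) =
      X ^ k * (X * d⁄dX ℝ W + C (k + 1 : ℝ) * W) := by
    rw [Derivation.leibniz, derivative_pow, derivative_X, smul_eq_mul, smul_eq_mul]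
    simp only [map_add, map_natCast, Nat.add_sub_cancel, map_one]
    push_cast
    ring_nf
  rw [hW, hd] at h
  have h2 : (C m + X) * (W * (Q - X * H) * V + H * Q * (X * d⁄dX ℝ W + C (k + 1 : ℝ) * W)) =
      C e * X * T * W := by
    apply mul_left_cancel₀ (pow_ne_zero (k + 1) (X_ne_zero (R := ℝ)))
    linear_combination h
  have h3 := congrArg constantCoeff h2
  simp only [map_add, map_sub, map_mul, constantCoeff_C, constantCoeff_X, hV] at h3
  have h4 : m * constantCoeff H * constantCoeff Q * constantCoeff W * (k + 2 : ℝ) = 0 := by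
    linear_combination h3
  have h5 : (k + 2 : ℝ) ≠ 0 := by positivity
  simp only [mul_eq_zero, hm, hH, hQ, hW0, h5, or_self] at h4

end FormalOde

/-! ### Coefficientwise derivatives of families of power series. -/

section CoeffDeriv

/-- Coefficientwise derivative of a family of power series. -/
def HasCoeffDerivAt (T : ℝ → PowerSeries ℝ) (T' : PowerSeries ℝ) (z : ℝ) : Prop :=
  ∀ k, HasDerivAt (fun x => PowerSeries.coeff k (T x)) (PowerSeries.coeff k T') z

variable {T U : ℝ → PowerSeries ℝ} {T' U' : PowerSeries ℝ} {z : ℝ}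

lemma HasCoeffDerivAt.const (S : PowerSeries ℝ) (z : ℝ) : HasCoeffDerivAt (fun _ => S) 0 z := by
  intro k; simpa using hasDerivAt_const z (PowerSeries.coeff k S)

lemma HasCoeffDerivAt.ofC {g : ℝ → ℝ} {g' : ℝ} (h : HasDerivAt g g' z) :
    HasCoeffDerivAt (fun x => C (g x)) (C g') z := by
  intro k
  simp only [coeff_C]
  split_ifs
  · exact h
  · exact hasDerivAt_const z 0

lemma HasCoeffDerivAt.sub (hT : HasCoeffDerivAt T T' z) (hU : HasCoeffDerivAt U U' z) :
    HasCoeffDerivAt (fun x => T x - U x) (T' - U') z := by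
  intro k; simp only [map_sub]; exact (hT k).sub (hU k)

lemma HasCoeffDerivAt.mul (hT : HasCoeffDerivAt T T' z) (hU : HasCoeffDerivAt U U' z) :
    HasCoeffDerivAt (fun x => T x * U x) (T' * U z + T z * U') z := by
  intro k
  simp only [map_add, PowerSeries.coeff_mul, ← Finset.sum_add_distrib]
  exact HasDerivAt.fun_sum fun i _ => (hT i.1).mul (hU i.2)

lemma HasCoeffDerivAt.derivative (hT : HasCoeffDerivAt T T' z) :
    HasCoeffDerivAt (fun x => d⁄dX ℝ (T x)) (d⁄dX ℝ T') z := by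
  intro k
  simp only [coeff_derivative]
  exact (hT (k + 1)).mul_const _

lemma HasCoeffDerivAt.unique (hT : HasCoeffDerivAt T T' z) (hU : HasCoeffDerivAt T U' z) :
    T' = U' := by
  ext k; exact (hT k).unique (hU k)

lemma HasCoeffDerivAt.congr (hT : HasCoeffDerivAt T T' z) (h : ∀ᶠ x in 𝓝 z, U x = T x) :
    HasCoeffDerivAt U T' z := by
  intro k
  exact (hT k).congr_of_eventuallyEq (h.mono fun x hx => by simp only [hx])

/-- The recursion for the coefficients of an inverse series shows that they are differentiable; the
value of the derivative then follows by differentiating T · T⁻¹ = 1. -/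
lemma HasCoeffDerivAt.inv (hT : HasCoeffDerivAt T T' z) (h0 : constantCoeff (T z) ≠ 0) :
    HasCoeffDerivAt (fun x => (T x)⁻¹) (-(T z)⁻¹ ^ 2 * T') z := by
  have hc : HasDerivAt (fun x => constantCoeff (T x)) (constantCoeff T') z := by
    simpa only [coeff_zero_eq_constantCoeff_apply] using hT 0
  have hdiff : ∀ k, DifferentiableAt ℝ (fun x => PowerSeries.coeff k (T x)⁻¹) z := by
    intro k
    induction k using Nat.strong_induction_on with
    | _ k ih =>
      have he : (fun x => PowerSeries.coeff k (T x)⁻¹) = _ :=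
        funext fun x => PowerSeries.coeff_inv k (T x)
      rw [he]
      split_ifs with hk
      · exact (hc.inv h0).differentiableAt
      · refine ((hc.inv h0).differentiableAt.neg).mul (DifferentiableAt.fun_sum fun i _ => ?_)
        split_ifs with hi
        · exact (hT _).differentiableAt.mul (ih _ hi)
        · exact differentiableAt_const _
  have hI : HasCoeffDerivAt (fun x => (T x)⁻¹)
      (PowerSeries.mk fun k => deriv (fun x => PowerSeries.coeff k (T x)⁻¹) z) z := by
    intro k
    rw [coeff_mk]
    exact (hdiff k).hasDerivAt
  set D := PowerSeries.mk fun k => deriv (fun x => PowerSeries.coeff k (T x)⁻¹) z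
  have h1 : ∀ᶠ x in 𝓝 z, T x * (T x)⁻¹ = 1 := by
    filter_upwards [hc.continuousAt.eventually_ne h0] with x hx
    exact PowerSeries.mul_inv_cancel _ hx
  have h2 := ((hT.mul hI).unique ((HasCoeffDerivAt.const 1 z).congr h1))
  have h3 : D = -(T z)⁻¹ ^ 2 * T' := by
    have := PowerSeries.mul_inv_cancel _ h0
    linear_combination (T z)⁻¹ * h2 - D * this
  rw [← h3]
  exact hI

lemma HasCoeffDerivAt.partsOp (m : ℝ) (hT : HasCoeffDerivAt T T' z) :
    HasCoeffDerivAt (fun x => partsOp m (T x)) (partsOp m T') z := by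
  intro k
  simp only [coeff_partsOp]
  exact (((hT (k + 2)).const_mul _).const_mul m).add ((hT (k + 1)).const_mul _)

lemma HasCoeffDerivAt.partsCoeff (m : ℝ) (n : ℕ) (hT : HasCoeffDerivAt T T' z) :
    HasDerivAt (fun x => partsCoeff m n (T x)) (partsCoeff m n T') z := by
  induction n generalizing T T' with
  | zero => simpa only [partsCoeff_zero, coeff_zero_eq_constantCoeff_apply] using hT 0
  | succ n ih => simp only [partsCoeff_succ]; exact ih (hT.partsOp m)

end CoeffDeriv

/-! ### Coefficientwise limits of families of power series. -/

section CoeffLimit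

/-- Coefficientwise convergence of a family of power series. -/
def CoeffTendsto (T : ℝ → PowerSeries ℝ) (S : PowerSeries ℝ) : Prop :=
  ∀ k, Tendsto (fun z => PowerSeries.coeff k (T z)) atTop (𝓝 (PowerSeries.coeff k S))

variable {T U : ℝ → PowerSeries ℝ} {S V : PowerSeries ℝ}

lemma CoeffTendsto.const (S : PowerSeries ℝ) : CoeffTendsto (fun _ => S) S :=
  fun _ => tendsto_const_nhds

lemma CoeffTendsto.ofC {g : ℝ → ℝ} {r : ℝ} (h : Tendsto g atTop (𝓝 r)) :
    CoeffTendsto (fun x => C (g x)) (C r) := by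
  intro k
  simp only [coeff_C]
  split_ifs
  · exact h
  · exact tendsto_const_nhds

lemma CoeffTendsto.sub (hT : CoeffTendsto T S) (hU : CoeffTendsto U V) :
    CoeffTendsto (fun x => T x - U x) (S - V) := by
  intro k; simp only [map_sub]; exact (hT k).sub (hU k)

lemma CoeffTendsto.mul (hT : CoeffTendsto T S) (hU : CoeffTendsto U V) :
    CoeffTendsto (fun x => T x * U x) (S * V) := by
  intro k
  simp only [PowerSeries.coeff_mul]
  exact tendsto_finsetSum _ fun i _ => (hT i.1).mul (hU i.2)

lemma CoeffTendsto.derivative (hT : CoeffTendsto T S) :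
    CoeffTendsto (fun x => d⁄dX ℝ (T x)) (d⁄dX ℝ S) := by
  intro k
  simp only [coeff_derivative]
  exact (hT (k + 1)).mul_const _

lemma CoeffTendsto.congr (hT : CoeffTendsto T S) (h : ∀ᶠ x in atTop, U x = T x) :
    CoeffTendsto U S := by
  intro k
  exact (hT k).congr' (h.mono fun x hx => by simp only [hx])

lemma CoeffTendsto.inv (hT : CoeffTendsto T S) (h0 : constantCoeff S ≠ 0) :
    CoeffTendsto (fun x => (T x)⁻¹) S⁻¹ := by
  have hc : Tendsto (fun x => constantCoeff (T x)) atTop (𝓝 (constantCoeff S)) := by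
    simpa only [coeff_zero_eq_constantCoeff_apply] using hT 0
  intro k
  induction k using Nat.strong_induction_on with
  | _ k ih =>
    have he : (fun x => PowerSeries.coeff k (T x)⁻¹) = _ :=
      funext fun x => PowerSeries.coeff_inv k (T x)
    rw [he, PowerSeries.coeff_inv]
    split_ifs with hk
    · exact hc.inv₀ h0
    · refine ((hc.inv₀ h0).neg).mul (tendsto_finsetSum _ fun i _ => ?_)
      split_ifs with hi
      · exact (hT _).mul (ih _ hi)
      · exact tendsto_const_nhds

lemma CoeffTendsto.partsOp (m : ℝ) (hT : CoeffTendsto T S) :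
    CoeffTendsto (fun x => partsOp m (T x)) (partsOp m S) := by
  intro k
  simp only [coeff_partsOp]
  exact (((hT (k + 2)).const_mul _).const_mul m).add ((hT (k + 1)).const_mul _)

lemma CoeffTendsto.partsCoeff (m : ℝ) (n : ℕ) (hT : CoeffTendsto T S) :
    Tendsto (fun x => partsCoeff m n (T x)) atTop (𝓝 (partsCoeff m n S)) := by
  induction n generalizing T S with
  | zero => simpa only [partsCoeff_zero, coeff_zero_eq_constantCoeff_apply] using hT 0
  | succ n ih => simp only [partsCoeff_succ]; exact ih (hT.partsOp m)

end CoeffLimit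

end KummerExpansion
end

noncomputable section

namespace KummerExpansion

open Filter Topology PowerSeries

/-! ### Recursive determination of the Taylor coefficients of t. -/

section Cutoff

/-- The terms of `T` of degree less than `k`. -/
def lowTerms (k : ℕ) (T : PowerSeries ℝ) : PowerSeries ℝ :=
  PowerSeries.mk fun i => if i < k then PowerSeries.coeff i T else 0

lemma coeff_lowTerms (k i : ℕ) (T : PowerSeries ℝ) :
    PowerSeries.coeff i (lowTerms k T) = if i < k then PowerSeries.coeff i T else 0 := by
  simp [lowTerms]

lemma lowTerms_add (k : ℕ) (T : PowerSeries ℝ) :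
    T = lowTerms k T + X ^ k * PowerSeries.mk fun i => PowerSeries.coeff (i + k) T := by
  ext i
  rw [map_add, coeff_lowTerms, coeff_X_pow_mul', coeff_mk]
  by_cases h : i < k
  · rw [if_pos h, if_neg (by omega), add_zero]
  · rw [if_neg h, if_pos (by omega), zero_add, Nat.sub_add_cancel (by omega)]

/-- Solutions of the formal differential equation are determined recursively. -/
lemma coeff_eq_of_odeLhs_eq_zero {m p q e : ℝ} {T : PowerSeries ℝ} (h : odeLhs m p q e T = 0)
    (hp : constantCoeff T = p) (hm : m ≠ 0) (hpq : q - p ≠ 0)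
    (h1 : PowerSeries.coeff 1 T ≠ 0) (n : ℕ) :
    PowerSeries.coeff (n + 2) T = -PowerSeries.coeff (n + 2) (odeLhs m p q e (lowTerms (n + 2) T)) /
      (m * (q - p) * (n + 3) * PowerSeries.coeff 1 T) := by
  have hT := lowTerms_add (n + 2) T
  have hc0 : constantCoeff (lowTerms (n + 2) T) = p := by
    rw [← hp, ← coeff_zero_eq_constantCoeff_apply, coeff_lowTerms, if_pos (by omega),
      coeff_zero_eq_constantCoeff_apply]
  have hc1 : PowerSeries.coeff 1 (lowTerms (n + 2) T) = PowerSeries.coeff 1 T := by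
    rw [coeff_lowTerms, if_pos (by omega)]
  have key := coeff_odeLhs_add m p q e (lowTerms (n + 2) T)
    (PowerSeries.mk fun i => PowerSeries.coeff (i + (n + 2)) T) n hc0
  rw [← hT, h, hc1, ← coeff_zero_eq_constantCoeff_apply, coeff_mk, zero_add, map_zero] at key
  have : (n + 3 : ℝ) ≠ 0 := by positivity
  field_simp
  linear_combination -key

end Cutoff

/-! ### Evolution of the Taylor series of t along a ray. -/

section Ray

variable {a b z : ℝ}

lemma odeLhs_tSeries (ha : 0 < a) (hab : a ≠ b) (hz : 0 < z) :
    odeLhs (b - a) (t0 (a / z) (b / z)) (t1 (a / z) (b / z)) (1 / z) (tSeries a b z) = 0 := by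
  rw [odeLhs, tSeries_ode ha hab hz, sub_self]

lemma mul_mu_eq (a b : ℝ) (ha : 0 < a) (hz : 0 < z) :
    b - a = z * (t0 (a / z) (b / z) * t1 (a / z) (b / z)) := by
  rw [t0_mul_t1 (div_pos ha hz), mu]; field_simp

/-- Cancelling `X` in the differential equation and taking constant terms gives the square of the
coefficient; the sign rule of the transformation selects the positive root. -/
lemma coeff_one_tSeries (ha : 0 < a) (hab : a ≠ b) (hz : 0 < z) :
    PowerSeries.coeff 1 (tSeries a b z) =
      Real.sqrt ((1 - t0 (a / z) (b / z)) / (t1 (a / z) (b / z) * gap (a / z) (b / z))) / z := by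
  obtain ⟨H, hH, hH0⟩ := exists_eq_C_add_X_mul (tSeries a b z)
  rw [constantCoeff_tSeries ha hab hz] at hH
  have hode := tSeries_ode ha hab hz
  have hpos := coeff_one_tSeries_pos ha hab hz
  have hT0 := constantCoeff_tSeries ha hab hz
  have hm := mul_mu_eq a b ha hz
  have hp := t0_ne_zero (div_pos ha hz) (mu_div_ne_zero hab hz)
  have hp1 := t0_lt_one (β := b / z) (div_pos ha hz)
  have hq := one_lt_t1 (β := b / z) (div_pos ha hz)
  have hg := gap_pos (β := b / z) (div_pos ha hz)
  have hD := t1_sub_t0 (a / z) (b / z)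
  have hd0 : constantCoeff (d⁄dX ℝ (tSeries a b z)) = PowerSeries.coeff 1 (tSeries a b z) := by
    rw [← coeff_zero_eq_constantCoeff_apply, coeff_derivative]; simp
  set T := tSeries a b z
  set p := t0 (a / z) (b / z)
  set q := t1 (a / z) (b / z)
  set g := gap (a / z) (b / z)
  set κ := PowerSeries.coeff 1 T
  have h1 : (C (b - a) + X) * H * (C q - T) * d⁄dX ℝ T = C (1 / z) * (T * (1 - T)) := by
    apply mul_left_cancel₀ (X_ne_zero (R := ℝ))
    have : T - C p = X * H := by rw [hH]; ring
    rw [this] at hode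
    linear_combination hode
  have h2 := congrArg constantCoeff h1
  simp only [map_add, map_sub, map_mul, constantCoeff_C, constantCoeff_X, map_one, hT0, hH0, hd0,
    hD] at h2
  rw [hm] at h2
  have h3 : (κ * z) ^ 2 = (1 - p) / (q * g) := by
    have : q ≠ 0 := by linarith
    have h4 : z * p * q * κ * g * κ = 1 / z * (p * (1 - p)) := by linear_combination h2
    field_simp at h4 ⊢
    linear_combination h4
  rw [← h3, Real.sqrt_sq (by positivity)]
  field_simp

lemma HasCoeffDerivAt.odeLhs {p q e : ℝ → ℝ} {p' q' e' : ℝ} {T : ℝ → PowerSeries ℝ}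
    {T' : PowerSeries ℝ} (m : ℝ) (hp : HasDerivAt p p' z) (hq : HasDerivAt q q' z)
    (he : HasDerivAt e e' z) (hT : HasCoeffDerivAt T T' z) :
    HasCoeffDerivAt (fun x => odeLhs m (p x) (q x) (e x) (T x))
      ((C m + X) * ((T' - C p') * (C (q z) - T z) * d⁄dX ℝ (T z)
        + (T z - C (p z)) * (C q' - T') * d⁄dX ℝ (T z)
        + (T z - C (p z)) * (C (q z) - T z) * d⁄dX ℝ T')
        - C e' * X * (T z * (1 - T z)) - C (e z) * X * (T' * (1 - 2 * T z))) z := by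
  have h1 := (((HasCoeffDerivAt.const (C m + X) z).mul (hT.sub (.ofC hp))).mul
    ((HasCoeffDerivAt.ofC hq).sub hT)).mul hT.derivative
  have h2 := ((HasCoeffDerivAt.ofC he).mul (.const X z)).mul
    (hT.mul ((HasCoeffDerivAt.const 1 z).sub hT))
  have h3 := h1.sub h2
  have h4 : (C m + X) * ((T' - C p') * (C (q z) - T z) * d⁄dX ℝ (T z)
        + (T z - C (p z)) * (C q' - T') * d⁄dX ℝ (T z)
        + (T z - C (p z)) * (C (q z) - T z) * d⁄dX ℝ T')
        - C e' * X * (T z * (1 - T z)) - C (e z) * X * (T' * (1 - 2 * T z)) =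
      ((0 * (T z - C (p z)) + (C m + X) * (T' - C p')) * (C (q z) - T z) +
        (C m + X) * (T z - C (p z)) * (C q' - T')) * d⁄dX ℝ (T z) +
        (C m + X) * (T z - C (p z)) * (C (q z) - T z) * d⁄dX ℝ T' -
      ((C e' * X + C (e z) * 0) * (T z * (1 - T z)) +
        C (e z) * X * (T' * (1 - T z) + T z * (0 - T'))) := by ring
  rw [h4]
  exact h3

/-- The transformation is defined by choice separately for each z, so regularity in z is read off
coefficientwise: the first two coefficients are explicit, and the others follow from the recursion.
-/
lemma tSeries_coeff_differentiableAt (ha : 0 < a) (hab : a ≠ b) (hz : 0 < z) (k : ℕ) :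
    DifferentiableAt ℝ (fun x => PowerSeries.coeff k (tSeries a b x)) z := by
  have hα := div_pos ha hz
  have hp1 := t0_lt_one (β := b / z) hα
  have hq := one_lt_t1 (β := b / z) hα
  have hg := gap_pos (β := b / z) hα
  have hd0 := (hasDerivAt_t0 (b := b) ha hz).differentiableAt
  have hd1 := (hasDerivAt_t1 (b := b) ha hz).differentiableAt
  have hdg := (hasDerivAt_gap (b := b) ha hz).differentiableAt
  have hde : DifferentiableAt ℝ (fun x : ℝ => 1 / x) z := (hasDerivAt_const_div 1 hz).differentiableAt
  have hκ : DifferentiableAt ℝ (fun x => PowerSeries.coeff 1 (tSeries a b x)) z := by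
    have h1 : (fun x => PowerSeries.coeff 1 (tSeries a b x)) =ᶠ[𝓝 z] fun x =>
        Real.sqrt ((1 - t0 (a / x) (b / x)) / (t1 (a / x) (b / x) * gap (a / x) (b / x))) / x := by
      filter_upwards [lt_mem_nhds hz] with x hx
      exact coeff_one_tSeries ha hab hx
    refine DifferentiableAt.congr_of_eventuallyEq ?_ h1
    have hpos : 0 < (1 - t0 (a / z) (b / z)) / (t1 (a / z) (b / z) * gap (a / z) (b / z)) :=
      div_pos (by linarith) (mul_pos (by linarith) hg)
    exact (((hd0.const_sub 1).fun_div (hd1.fun_mul hdg) (mul_pos (by linarith) hg).ne').sqrt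
      hpos.ne').fun_div differentiableAt_id hz.ne'
  induction k using Nat.strong_induction_on with
  | _ k ih =>
    rcases k with _ | _ | n
    · refine DifferentiableAt.congr_of_eventuallyEq hd0 ?_
      filter_upwards [lt_mem_nhds hz] with x hx
      rw [coeff_zero_eq_constantCoeff_apply, constantCoeff_tSeries ha hab hx]
    · exact hκ
    · have hlow : HasCoeffDerivAt (fun x => lowTerms (n + 2) (tSeries a b x))
          (PowerSeries.mk fun i => if i < n + 2 then
            deriv (fun x => PowerSeries.coeff i (tSeries a b x)) z else 0) z := by
        intro i
        simp only [coeff_lowTerms, coeff_mk]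
        split_ifs with hi
        · exact (ih i hi).hasDerivAt
        · exact hasDerivAt_const z 0
      have hΦ := (HasCoeffDerivAt.odeLhs (b - a) hd0.hasDerivAt hd1.hasDerivAt hde.hasDerivAt
        hlow) (n + 2)
      have hne : (b - a) * (t1 (a / z) (b / z) - t0 (a / z) (b / z)) * (n + 3 : ℝ) *
          PowerSeries.coeff 1 (tSeries a b z) ≠ 0 := by
        rw [t1_sub_t0]
        have := coeff_one_tSeries_pos ha hab hz
        have h3 : (n + 3 : ℝ) ≠ 0 := by positivity
        exact mul_ne_zero (mul_ne_zero (mul_ne_zero (sub_ne_zero.2 hab.symm) hg.ne') h3) this.ne'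
      refine DifferentiableAt.congr_of_eventuallyEq (hΦ.differentiableAt.fun_neg.fun_div
        ((((hd1.fun_sub hd0).const_mul (b - a)).mul_const (n + 3 : ℝ)).fun_mul hκ) hne) ?_
      filter_upwards [lt_mem_nhds hz] with x hx
      refine coeff_eq_of_odeLhs_eq_zero (odeLhs_tSeries ha hab hx)
        (constantCoeff_tSeries ha hab hx) (sub_ne_zero.2 hab.symm) ?_
        (coeff_one_tSeries_pos ha hab hx).ne' n
      rw [t1_sub_t0]
      exact (gap_pos (div_pos ha hx)).ne'

/-- The formal evolution equation of the transformation along a ray. -/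
lemma hasCoeffDerivAt_tSeries (ha : 0 < a) (hab : a ≠ b) (hz : 0 < z) :
    HasCoeffDerivAt (tSeries a b) (-(C (1 / z) * (tSeries a b z * (1 - tSeries a b z)) *
      (C (t1 (a / z) (b / z)) - tSeries a b z)⁻¹)) z := by
  have hα := div_pos ha hz
  have hp1 := t0_lt_one (β := b / z) hα
  have hq := one_lt_t1 (β := b / z) hα
  have hg := gap_pos (β := b / z) hα
  have hD := t1_sub_t0 (a / z) (b / z)
  have hp0 := t0_ne_zero hα (mu_div_ne_zero hab hz)
  have d0 := hasDerivAt_t0 (b := b) ha hz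
  have d1 := hasDerivAt_t1 (b := b) ha hz
  have de := hasDerivAt_const_div 1 hz
  -- The candidate comes from differentiating zφ(t) − zψ(s) = z𝒜 in z at fixed zs, which gives
  -- zφ'(t) ∂t/∂z = t₀ − t. It is verified by differentiating the formal equation in z: candidate
  -- and true derivative solve the same linearised equation and agree in the constant term.
  have hT : HasCoeffDerivAt (tSeries a b)
      (PowerSeries.mk fun k => deriv (fun x => PowerSeries.coeff k (tSeries a b x)) z) z := by
    intro k
    rw [coeff_mk]
    exact (tSeries_coeff_differentiableAt ha hab hz k).hasDerivAt
  set T' := PowerSeries.mk fun k => deriv (fun x => PowerSeries.coeff k (tSeries a b x)) z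
  have hΦ := HasCoeffDerivAt.odeLhs (b - a) d0 d1 de hT
  have h0 := hΦ.unique ((HasCoeffDerivAt.const 0 z).congr (by
    filter_upwards [lt_mem_nhds hz] with x hx
    exact odeLhs_tSeries ha hab hx))
  have hT0' : constantCoeff T' =
      -(t0 (a / z) (b / z) * (1 - t0 (a / z) (b / z))) / (z * gap (a / z) (b / z)) := by
    have h1 := hT 0
    simp only [coeff_zero_eq_constantCoeff_apply] at h1
    refine h1.unique (d0.congr_of_eventuallyEq ?_)
    filter_upwards [lt_mem_nhds hz] with x hx
    exact constantCoeff_tSeries ha hab hx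
  have hT0 := constantCoeff_tSeries ha hab hz
  have hode := tSeries_ode ha hab hz
  obtain ⟨H, hH, hH0⟩ := exists_eq_C_add_X_mul (tSeries a b z)
  have hκ := coeff_one_tSeries_pos ha hab hz
  have hV : constantCoeff (d⁄dX ℝ (tSeries a b z)) = constantCoeff H := by
    rw [hH0, ← coeff_zero_eq_constantCoeff_apply, coeff_derivative]; simp
  rw [hT0] at hH
  rw [← hH0] at hκ
  rw [← hD] at hT0' h0 hg
  clear_value T'
  generalize tSeries a b z = T at *
  generalize t0 (a / z) (b / z) = p at *
  generalize t1 (a / z) (b / z) = q at *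
  generalize gap (a / z) (b / z) = g at *
  set Q := C q - T with hQdef
  have hQ0 : constantCoeff Q = q - p := by simp [hQdef, hT0]
  have hQi : Q * Q⁻¹ = 1 := PowerSeries.mul_inv_cancel _ (by rw [hQ0]; exact hg.ne')
  have hPp : T - C p = X * H := by rw [hH]; ring
  -- the difference satisfies the linearised equation
  set Z := T' + C (1 / z) * (T * (1 - T)) * Q⁻¹ with hZdef
  have hZ0 : constantCoeff Z = 0 := by
    have hQi0 : constantCoeff Q⁻¹ = (q - p)⁻¹ := by rw [constantCoeff_inv, hQ0]
    simp only [hZdef, map_add, map_mul, map_sub, map_one, constantCoeff_C, hT0', hT0, hQi0]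
    field_simp
    ring
  have hQ' : d⁄dX ℝ Q⁻¹ = Q⁻¹ ^ 2 * d⁄dX ℝ T := by
    rw [derivative_inv']
    simp [hQdef]
  have hZ' : d⁄dX ℝ Z = d⁄dX ℝ T' + C (1 / z) * ((1 - 2 * T) * d⁄dX ℝ T) * Q⁻¹ +
      C (1 / z) * (T * (1 - T)) * (Q⁻¹ ^ 2 * d⁄dX ℝ T) := by
    rw [hZdef, map_add, Derivation.leibniz, hQ', Derivation.leibniz, Derivation.leibniz]
    simp only [smul_eq_mul, derivative_C, map_sub, derivative_one]
    ring
  have hcp : C (-(p * (1 - p)) / (z * (q - p))) * C (q - p) = -(C (1 / z) * (C p * (1 - C p))) := by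
    rw [← map_one C, ← map_sub, ← map_mul, ← map_mul, ← map_mul, ← map_neg]
    congr 1
    field_simp
  have hcq : C (-(q * (q - 1)) / (z * (q - p))) * C (q - p) = -(C (1 / z) * (C q * (C q - 1))) := by
    rw [← map_one C, ← map_sub, ← map_mul, ← map_mul, ← map_mul, ← map_neg]
    congr 1
    field_simp
  have hce : C (-(1 / z) / z) = -(C (1 / z) * C (1 / z)) := by
    rw [← map_mul, ← map_neg]
    congr 1
    field_simp
  have hZeq : Z = 0 := by
    refine eq_zero_of_linearized (m := b - a) (e := 1 / z) (H := H) (Q := Q) (T := 1 - 2 * T)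
      (V := d⁄dX ℝ T) (sub_ne_zero.2 hab.symm) hκ.ne' (by rw [hQ0]; exact hg.ne') hV hZ0 ?_
    -- The z-derivatives of t₀ and t₁ enter through this combination, which is identically zero as a
    -- polynomial in T.
    have hbr : C (-(p * (1 - p)) / (z * (q - p))) * Q -
        (T - C p) * C (-(q * (q - 1)) / (z * (q - p))) + C (1 / z) * (T * (1 - T)) -
        C (1 / z) * (T - C p) * Q = 0 := by
      have hne : C (q - p) ≠ (0 : PowerSeries ℝ) := by
        intro h
        have := congrArg constantCoeff h
        rw [constantCoeff_C, map_zero] at this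
        exact hg.ne' this
      have hsub : C (q - p) = (C q - C p : PowerSeries ℝ) := map_sub _ _ _
      apply mul_right_cancel₀ hne
      rw [hQdef]
      linear_combination (C q - T) * hcp - (T - C p) * hcq + C (1 / z) * (T * (1 - T)) * hsub -
        C (1 / z) * (T - C p) * (C q - T) * hsub
    rw [← hPp, hZ', hZdef]
    linear_combination h0 + (C (b - a) + X) * d⁄dX ℝ T * hbr +
      (C (b - a) + X) * C (1 / z) * (T * (1 - T) * d⁄dX ℝ T +
        (T - C p) * (T * (1 - T)) * d⁄dX ℝ T * Q⁻¹) * hQi +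
      (C (1 / z) * (1 - 2 * T) * Q⁻¹ + C (1 / z)) * hode + X * (T * (1 - T)) * hce
  rw [hZdef] at hZeq
  have : T' = -(C (1 / z) * (T * (1 - T)) * Q⁻¹) := by linear_combination hZeq
  rw [← this]
  exact hT

end Ray

end KummerExpansion
end

noncomputable section

namespace KummerExpansion

open Filter Topology PowerSeries

/-! ### The differential system for the terms of the expansion. -/

section System

variable {a b z : ℝ}

/-- The term `fₙ(μ) / zⁿ` of the expansion (including the factor `f₀(μ)`). -/
def expTerm (a b : ℝ) (n : ℕ) (z : ℝ) : ℝ := partsCoeff (b - a) n (fSeries a b z)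

/-- The series of `1 / (t₁ - t)`. -/
def gSeries (a b z : ℝ) : PowerSeries ℝ := (C (t1 (a / z) (b / z)) - tSeries a b z)⁻¹

/-- The terms of the expansion with additional factor `t - t₀` in the integrand. -/
def auxTerm (a b : ℝ) (n : ℕ) (z : ℝ) : ℝ :=
  partsCoeff (b - a) n (C (1 / z) * (X * gSeries a b z))

lemma coeff_div_pow (ha : 0 < a) (hab : a ≠ b) (hz : 0 < z) (n : ℕ) :
    coeff (a / z) (b / z) n / z ^ n = expTerm a b n z := coeff_div_pow_eq ha hab hz n

lemma mul_gSeries (ha : 0 < a) (hab : a ≠ b) (hz : 0 < z) :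
    (C (t1 (a / z) (b / z)) - tSeries a b z) * gSeries a b z = 1 := by
  refine PowerSeries.mul_inv_cancel _ ?_
  rw [map_sub, constantCoeff_C, constantCoeff_tSeries ha hab hz, t1_sub_t0]
  exact (gap_pos (div_pos ha hz)).ne'

lemma sub_mul_fSeries (ha : 0 < a) (hab : a ≠ b) (hz : 0 < z) :
    (tSeries a b z - C (t0 (a / z) (b / z))) * fSeries a b z =
      C (1 / z) * (X * gSeries a b z) := by
  have h1 := mul_gSeries ha hab hz
  have h2 := fSeries_mul_factors ha hab hz
  linear_combination gSeries a b z * h2 - (tSeries a b z - C (t0 (a / z) (b / z))) *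
    fSeries a b z * h1

/-- The right-hand side has the form (C m + X) · d/dX, that is, `partsOp` applied to `X` times a
series. Hence differentiation in z raises the index of a term by one. -/
lemma hasCoeffDerivAt_fSeries (ha : 0 < a) (hab : a ≠ b) (hz : 0 < z) :
    HasCoeffDerivAt (fSeries a b)
      (-(C (1 / z) * ((C (b - a) + X) * d⁄dX ℝ (gSeries a b z)))) z := by
  have hT := hasCoeffDerivAt_tSeries ha hab hz
  rw [← gSeries] at hT
  have hN := hT.mul ((HasCoeffDerivAt.const 1 z).sub hT)
  have hN0 : constantCoeff (tSeries a b z * (1 - tSeries a b z)) ≠ 0 := by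
    rw [map_mul, map_sub, map_one, constantCoeff_tSeries ha hab hz]
    have h1 := t0_lt_one (β := b / z) (div_pos ha hz)
    exact mul_ne_zero (t0_ne_zero (div_pos ha hz) (mu_div_ne_zero hab hz)) (by linarith)
  obtain ⟨D, hF⟩ : ∃ D, HasCoeffDerivAt (fSeries a b) D z :=
    ⟨_, (((HasCoeffDerivAt.const (C (b - a) + X) z).mul hT.derivative).mul
    (hN.inv hN0)).congr (by
      have hev : ∀ᶠ x in 𝓝 z, constantCoeff (tSeries a b x * (1 - tSeries a b x)) ≠ 0 := by
        have := (hN 0).continuousAt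
        simp only [coeff_zero_eq_constantCoeff_apply] at this
        exact this.eventually_ne hN0
      filter_upwards [hev, lt_mem_nhds hz] with x hx hx0
      rw [← fSeries_mul ha hab hx0, mul_assoc, PowerSeries.mul_inv_cancel _ hx, mul_one])⟩
  have h1 := (hF.mul hN).unique ((((HasCoeffDerivAt.const (C (b - a) + X) z).mul
    hT.derivative)).congr (by
      filter_upwards [lt_mem_nhds hz] with x hx
      exact fSeries_mul ha hab hx))
  have h2 := fSeries_mul ha hab hz
  have h3 : d⁄dX ℝ (-(C (1 / z) * (tSeries a b z * (1 - tSeries a b z)) * gSeries a b z)) =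
      -(C (1 / z) * ((1 - 2 * tSeries a b z) * d⁄dX ℝ (tSeries a b z) * gSeries a b z +
        tSeries a b z * (1 - tSeries a b z) * d⁄dX ℝ (gSeries a b z))) := by
    rw [map_neg, Derivation.leibniz, Derivation.leibniz, Derivation.leibniz]
    simp only [smul_eq_mul, derivative_C, map_sub, derivative_one]
    ring
  rw [h3] at h1
  have h4 : D = -(C (1 / z) * ((C (b - a) + X) * d⁄dX ℝ (gSeries a b z))) := by
    apply mul_right_cancel₀ (tSeries_mul_ne_zero ha hab hz)
    linear_combination h1 + C (1 / z) * (1 - 2 * tSeries a b z) * gSeries a b z * h2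
  rw [← h4]
  exact hF

/-- First equation of the formal system along a ray. -/
lemma hasDerivAt_expTerm (ha : 0 < a) (hab : a ≠ b) (hz : 0 < z) (n : ℕ) :
    HasDerivAt (expTerm a b n) (-auxTerm a b (n + 1) z) z := by
  have h := (hasCoeffDerivAt_fSeries ha hab hz).partsCoeff (b - a) n
  refine h.congr_deriv ?_
  rw [auxTerm, partsCoeff_C_mul, partsCoeff_succ, partsOp_X_mul, ← neg_mul, ← map_neg,
    partsCoeff_C_mul, neg_mul]

lemma auxTerm_zero (a b z : ℝ) : auxTerm a b 0 z = 0 := by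
  rw [auxTerm, partsCoeff_zero]; simp

/-- Second equation of the formal system along a ray. -/
lemma hasDerivAt_auxTerm (ha : 0 < a) (hab : a ≠ b) (hz : 0 < z) (n : ℕ) :
    HasDerivAt (auxTerm a b n)
      (t0 (a / z) (b / z) * (1 - t0 (a / z) (b / z)) / (z * gap (a / z) (b / z)) * expTerm a b n z
        - gap (a / z) (b / z) * auxTerm a b (n + 1) z) z := by
  have hT := hasCoeffDerivAt_tSeries ha hab hz
  rw [← gSeries] at hT
  have h0 := (((hT.sub (.ofC (hasDerivAt_t0 (b := b) ha hz))).mul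
    (hasCoeffDerivAt_fSeries ha hab hz)).congr
    (U := fun x => C (1 / x) * (X * gSeries a b x)) (by
      filter_upwards [lt_mem_nhds hz] with x hx
      exact (sub_mul_fSeries ha hab hx).symm)).partsCoeff (b - a) n
  refine h0.congr_deriv ?_
  have h2 := fSeries_mul ha hab hz
  have h3 := mul_gSeries ha hab hz
  have hg : C (gap (a / z) (b / z)) =
      (C (t1 (a / z) (b / z)) - C (t0 (a / z) (b / z)) : PowerSeries ℝ) := by
    rw [← t1_sub_t0, map_sub]
  rw [auxTerm, expTerm, partsCoeff_C_mul, ← partsCoeff_C_mul, ← partsCoeff_C_mul,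
    ← partsCoeff_C_mul, partsCoeff_succ, partsOp_C_mul, partsOp_C_mul]
  have h4 : C (gap (a / z) (b / z)) * partsOp (b - a) (X * gSeries a b z) =
      (C (b - a) + X) * d⁄dX ℝ ((tSeries a b z - C (t0 (a / z) (b / z))) * gSeries a b z) := by
    rw [← partsOp_X_mul, ← partsOp_C_mul]
    -- Split t₁ − t₀ = (t₁ − t) + (t − t₀): the first part cancels `gSeries` and leaves `X`, which
    -- `partsOp` annihilates.
    have : C (gap (a / z) (b / z)) * (X * gSeries a b z) =
        X * ((tSeries a b z - C (t0 (a / z) (b / z))) * gSeries a b z) + X := by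
      rw [hg]
      linear_combination X * h3
    rw [this]
    have h5 : X * ((tSeries a b z - C (t0 (a / z) (b / z))) * gSeries a b z) + X =
      X * ((tSeries a b z - C (t0 (a / z) (b / z))) * gSeries a b z) - C (-1) * X := by
      simp
    rw [h5, partsOp_sub, partsOp_C_mul, partsOp_X, mul_zero, sub_zero]
  rw [← partsCoeff_sub]
  congr 1
  have h5 : C (-(t0 (a / z) (b / z) * (1 - t0 (a / z) (b / z))) / (z * gap (a / z) (b / z))) =
      -C (t0 (a / z) (b / z) * (1 - t0 (a / z) (b / z)) / (z * gap (a / z) (b / z))) := by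
    rw [← map_neg, neg_div]
  rw [h5, Derivation.leibniz] at *
  have h6 : d⁄dX ℝ (tSeries a b z - C (t0 (a / z) (b / z))) = d⁄dX ℝ (tSeries a b z) := by simp
  simp only [smul_eq_mul, h6] at h4
  linear_combination C (1 / z) * h4 - C (1 / z) * gSeries a b z * h2

/-- The leading term satisfies a first-order equation. -/
lemma gap_mul_auxTerm_one (ha : 0 < a) (hab : a ≠ b) (hz : 0 < z) :
    gap (a / z) (b / z) * auxTerm a b 1 z =
      t0 (a / z) (b / z) * (1 - t0 (a / z) (b / z)) / (z * gap (a / z) (b / z)) *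
        expTerm a b 0 z := by
  have h := hasDerivAt_auxTerm ha hab hz 0
  -- `auxTerm` of index 0 vanishes identically in z, so the formula for its derivative must vanish
  -- too.
  have h2 := h.unique ((hasDerivAt_const z (0 : ℝ)).congr_of_eventuallyEq
    (Eventually.of_forall fun x => auxTerm_zero a b x))
  linarith

end System

/-! ### Initial values of the system at z = ∞. -/

section Limit

variable {a b : ℝ}

lemma tendsto_mul_t0 (ha : 0 < a) (b : ℝ) :
    Tendsto (fun z => z * t0 (a / z) (b / z)) atTop (𝓝 (b - a)) := by
  have h := (tendsto_const_nhds (x := b - a)).div (tendsto_t1 a b) one_ne_zero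
  rw [div_one] at h
  refine h.congr' ?_
  filter_upwards [eventually_gt_atTop 0] with z hz
  have h1 := mul_mu_eq a b ha hz
  have h2 := one_lt_t1 (β := b / z) (div_pos ha hz)
  have : t1 (a / z) (b / z) ≠ 0 := by linarith
  simp only [Pi.div_apply]
  rw [h1]; field_simp

/-- For large z the transformation becomes the identity, and zt tends to zs = (b − a) + X. This
series solves the limit of the differential equation, so the recursion forces all coefficients of
degree at least 2 to tend to 0. -/
lemma coeffTendsto_mul_tSeries (ha : 0 < a) (hab : a ≠ b) :
    CoeffTendsto (fun z => C z * tSeries a b z) (C (b - a) + X) := by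
  have h0 := tendsto_t0 a b
  have h1 := tendsto_t1 a b
  have hg := tendsto_gap a b
  have hinv : Tendsto (fun z : ℝ => 1 / z) atTop (𝓝 0) := tendsto_const_div 1
  have hκ : Tendsto (fun z => z * PowerSeries.coeff 1 (tSeries a b z)) atTop (𝓝 1) := by
    have := ((h0.const_sub 1).div (h1.mul hg) (by norm_num)).sqrt
    simp only [sub_zero, mul_one, div_one, Real.sqrt_one] at this
    refine this.congr' ?_
    filter_upwards [eventually_gt_atTop 0] with z hz
    rw [coeff_one_tSeries ha hab hz]
    simp only [Pi.div_apply]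
    field_simp
  intro k
  induction k using Nat.strong_induction_on with
  | _ k ih =>
    rcases k with _ | _ | n
    · have h2 : Tendsto (fun z => z * t0 (a / z) (b / z)) atTop
          (𝓝 (PowerSeries.coeff 0 (C (b - a) + X))) := by
        simpa using tendsto_mul_t0 ha b
      refine h2.congr' ?_
      filter_upwards [eventually_gt_atTop 0] with z hz
      rw [coeff_C_mul, coeff_zero_eq_constantCoeff_apply, constantCoeff_tSeries ha hab hz]
    · simp only [zero_add, coeff_C_mul]
      simpa [coeff_C] using hκ
    · have hlow : CoeffTendsto (fun z => C z * lowTerms (n + 2) (tSeries a b z))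
          (C (b - a) + X) := by
        intro i
        simp only [coeff_C_mul, coeff_lowTerms]
        by_cases hi : i < n + 2
        · simp only [if_pos hi]
          simpa only [coeff_C_mul] using ih i hi
        · simp only [if_neg hi, mul_zero]
          have : PowerSeries.coeff i (C (b - a) + X) = (0 : ℝ) := by
            rw [map_add, coeff_C, coeff_X, if_neg (by omega), if_neg (by omega), add_zero]
          rw [this]
          exact tendsto_const_nhds
      have hlow0 : CoeffTendsto (fun z => lowTerms (n + 2) (tSeries a b z)) 0 := by
        have := (CoeffTendsto.ofC hinv).mul hlow
        rw [map_zero, zero_mul] at this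
        refine this.congr ?_
        filter_upwards [eventually_gt_atTop 0] with z hz
        rw [← mul_assoc, ← map_mul, one_div_mul_cancel hz.ne', map_one, one_mul]
      have hΦ := ((((CoeffTendsto.const (C (b - a) + X)).mul
        (hlow.sub (.ofC (tendsto_mul_t0 ha b)))).mul ((CoeffTendsto.ofC h1).sub hlow0)).mul
        hlow.derivative).sub ((CoeffTendsto.const X).mul
          (hlow.mul ((CoeffTendsto.const 1).sub hlow0)))
      have hlim : (C (b - a) + X) * (C (b - a) + X - C (b - a)) * (C 1 - 0) *
          d⁄dX ℝ (C (b - a) + X) - X * ((C (b - a) + X) * (1 - 0)) = (0 : PowerSeries ℝ) := by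
        simp only [map_add, derivative_C, derivative_X, map_one]; ring
      rw [hlim] at hΦ
      have hden : Tendsto (fun z => (b - a) * gap (a / z) (b / z) * (n + 3 : ℝ) *
          (z * PowerSeries.coeff 1 (tSeries a b z))) atTop
          (𝓝 ((b - a) * 1 * (n + 3 : ℝ) * 1)) :=
        ((hg.const_mul (b - a)).mul_const _).mul hκ
      have hne : (b - a) * 1 * (n + 3 : ℝ) * 1 ≠ 0 := by
        have h3 : (n + 3 : ℝ) ≠ 0 := by positivity
        have := sub_ne_zero.2 hab.symm
        simp only [mul_one]
        exact mul_ne_zero this h3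
      have hq := ((hΦ (n + 2)).neg).div hden hne
      have hz0 : PowerSeries.coeff (n + 2) (C (b - a) + X) = (0 : ℝ) := by
        rw [map_add, coeff_C, coeff_X, if_neg (by omega), if_neg (by omega), add_zero]
      rw [map_zero, neg_zero, zero_div] at hq
      rw [hz0]
      refine hq.congr' ?_
      filter_upwards [eventually_gt_atTop 0] with z hz
      have hgz := gap_pos (β := b / z) (div_pos ha hz)
      have hcz := coeff_one_tSeries_pos ha hab hz
      simp only [Pi.div_apply]
      rw [coeff_C_mul, coeff_eq_of_odeLhs_eq_zero (odeLhs_tSeries ha hab hz)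
        (constantCoeff_tSeries ha hab hz) (sub_ne_zero.2 hab.symm)
        (by rw [t1_sub_t0]; exact hgz.ne') hcz.ne' n, t1_sub_t0]
      -- The equation is multiplied by z²: one factor z for the unknown in T − t₀, one for its
      -- derivative. Only in this scaling does it have a nontrivial limit.
      have hS : (C (b - a) + X) * (C z * lowTerms (n + 2) (tSeries a b z) -
          C (z * t0 (a / z) (b / z))) * (C (t1 (a / z) (b / z)) - lowTerms (n + 2) (tSeries a b z)) *
          d⁄dX ℝ (C z * lowTerms (n + 2) (tSeries a b z)) -
          X * (C z * lowTerms (n + 2) (tSeries a b z) * (1 - lowTerms (n + 2) (tSeries a b z))) =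
          C (z ^ 2) * odeLhs (b - a) (t0 (a / z) (b / z)) (t1 (a / z) (b / z)) (1 / z)
            (lowTerms (n + 2) (tSeries a b z)) := by
        rw [Derivation.leibniz, derivative_C, smul_zero, add_zero, smul_eq_mul, odeLhs, map_mul C z,
          map_pow]
        have : C (1 / z) * C z = (1 : PowerSeries ℝ) := by
          rw [← map_mul, one_div_mul_cancel hz.ne', map_one]
        linear_combination C z * X * (lowTerms (n + 2) (tSeries a b z) *
          (1 - lowTerms (n + 2) (tSeries a b z))) * this
      rw [hS, coeff_C_mul]
      have h3 : (n + 3 : ℝ) ≠ 0 := by positivity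
      have := sub_ne_zero.2 hab.symm
      field_simp

lemma coeffTendsto_fSeries (ha : 0 < a) (hab : a ≠ b) : CoeffTendsto (fSeries a b) 1 := by
  have hY := coeffTendsto_mul_tSeries ha hab
  have hT : CoeffTendsto (tSeries a b) 0 := by
    have := (CoeffTendsto.ofC (tendsto_const_div 1)).mul hY
    rw [map_zero, zero_mul] at this
    refine this.congr ?_
    filter_upwards [eventually_gt_atTop 0] with z hz
    rw [← mul_assoc, ← map_mul, one_div_mul_cancel hz.ne', map_one, one_mul]
  have hN := hY.mul ((CoeffTendsto.const 1).sub hT)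
  have hc : constantCoeff ((C (b - a) + X) * (1 - 0) : PowerSeries ℝ) ≠ 0 := by
    simpa using sub_ne_zero.2 hab.symm
  have hF := ((CoeffTendsto.const (C (b - a) + X)).mul hY.derivative).mul (hN.inv hc)
  have hlim : (C (b - a) + X) * d⁄dX ℝ (C (b - a) + X) * ((C (b - a) + X) * (1 - 0))⁻¹ =
      (1 : PowerSeries ℝ) := by
    rw [sub_zero, mul_one] at hc ⊢
    simp only [map_add, derivative_C, derivative_X, zero_add, mul_one]
    exact PowerSeries.mul_inv_cancel _ hc
  rw [hlim] at hF
  refine hF.congr ?_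
  have hev : ∀ᶠ z in atTop, constantCoeff (C z * tSeries a b z * (1 - tSeries a b z)) ≠ 0 := by
    have := hN 0
    simp only [coeff_zero_eq_constantCoeff_apply] at this
    exact this.eventually_ne hc
  filter_upwards [hev, eventually_gt_atTop 0] with z hz hz0
  have h1 := fSeries_mul ha hab hz0
  have h2 := PowerSeries.mul_inv_cancel _ hz
  rw [Derivation.leibniz, derivative_C, smul_zero, add_zero, smul_eq_mul]
  linear_combination -fSeries a b z * h2 + C z * (C z * tSeries a b z * (1 - tSeries a b z))⁻¹ * h1

lemma tendsto_expTerm_zero (ha : 0 < a) (hab : a ≠ b) :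
    Tendsto (expTerm a b 0) atTop (𝓝 1) := by
  have := (coeffTendsto_fSeries ha hab).partsCoeff (b - a) 0
  rw [partsCoeff_zero, map_one] at this
  exact this

/-- `partsOp` kills the constant limit series 1. This fixes the integration constants when the
recursion is integrated from infinity. -/
lemma tendsto_expTerm_succ (ha : 0 < a) (hab : a ≠ b) (n : ℕ) :
    Tendsto (expTerm a b (n + 1)) atTop (𝓝 0) := by
  have := (coeffTendsto_fSeries ha hab).partsCoeff (b - a) (n + 1)
  rwa [partsCoeff_succ, show partsOp (b - a) 1 = 0 by ext k; simp [coeff_partsOp, coeff_one],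
    partsCoeff_zero_series] at this

end Limit

end KummerExpansion
end

noncomputable section

namespace KummerExpansion

open Filter Topology PowerSeries

/-! ### Closed forms of the first coefficients. -/

section FirstCoefficients

/-- The `e` hypotheses are the coefficients of F · H · (q − T) = 1 with T = p + X·H, and the `d`
hypotheses those of F · T(1 − T) = (s) · T'. They are solved successively for f₀, f₁, h₁, h₂ and f₂.
-/
lemma second_coeff_algebra {p q κ f0 f1 f2 h1 h2 : ℝ} (hp : p ≠ 0) (hp1 : p < 1) (hq : 1 < q)
    (hκ : κ ^ 2 * (q * (q - p)) = 1 - p) (e0 : f0 * κ * (q - p) = 1)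
    (e1 : f1 * κ * (q - p) + f0 * (h1 * (q - p) - κ ^ 2) = 0)
    (e2 : f2 * κ * (q - p) + f1 * (h1 * (q - p) - κ ^ 2) + f0 * (h2 * (q - p) - 2 * κ * h1) = 0)
    (d1 : f1 * (p * (1 - p)) + f0 * (κ * (1 - 2 * p)) = 2 * (p * q) * h1 + κ)
    (d2 : f2 * (p * (1 - p)) + f1 * (κ * (1 - 2 * p)) + f0 * (h1 * (1 - 2 * p) - κ ^ 2) =
      3 * (p * q) * h2 + 2 * h1) :
    p * q * f2 / f0 = (p * q) * (1 / q) ^ 2 * ((p * q) ^ 2 * (1 / q) ^ 5 - 13 * (p * q) ^ 2 * (1 / q) ^ 4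
      - (p * q) * (1 / q) ^ 4 + 21 * (1 / q) ^ 3 * (p * q) + 4 * (p * q) * (1 / q) ^ 2
      - 9 * (1 / q) ^ 2 - 2 * (1 / q) - 1)
            / (12 * ((p * q) * (1 / q) ^ 2 - 1) ^ 3 * (1 - (p * q) * (1 / q))) := by
  have hg : q - p ≠ 0 := by linarith
  have hq0 : q ≠ 0 := by linarith
  have h1p : 1 - p ≠ 0 := by linarith
  have hκ0 : κ ≠ 0 := by rintro rfl; simp at e0
  set g := q - p with hgdef
  set m := p * q with hm
  have hm0 : m ≠ 0 := mul_ne_zero hp hq0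
  set K := (1 - p) / (q * g) with hK
  have hK0 : K ≠ 0 := div_ne_zero h1p (mul_ne_zero hq0 hg)
  have hκK : κ ^ 2 = K := by rw [hK]; field_simp; linear_combination hκ
  have hpK : p * (1 - p) = m * K * g := by rw [hK, hm]; field_simp
  have hf0 : f0 = 1 / (κ * g) := by field_simp; linear_combination e0
  have hf1 : f1 = 1 / g ^ 2 - h1 / (K * g) := by
    rw [hf0] at e1
    rw [← hκK]
    field_simp at e1 ⊢
    linear_combination e1
  have hh1 : h1 = (m * K + 1 - 2 * p) / (3 * m * g) - κ / (3 * m) := by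
    rw [hpK, hf0, hf1] at d1
    have hx : 1 / (κ * g) * (κ * (1 - 2 * p)) = (1 - 2 * p) / g := by field_simp
    rw [hx] at d1
    field_simp at d1 ⊢
    linear_combination -d1
  have hh2 : h2 = -κ * (f2 * κ * g + f1 * (h1 * g - K) - 2 * h1 / g) := by
    rw [hf0, hκK] at e2
    field_simp at e2 ⊢
    linear_combination e2
  have hmain : 4 * K * (m * f2 * κ * g) = -3 * m * K * f1 * (h1 * g - K) + 6 * m * K * h1 / g +
      2 * κ * h1 - f1 * K * (1 - 2 * p) - (h1 * (1 - 2 * p) - K) / g := by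
    rw [hpK, hf0, hκK, hh2] at d2
    have hx : 1 / (κ * g) * (h1 * (1 - 2 * p) - K) * κ = (h1 * (1 - 2 * p) - K) / g := by field_simp
    have hy : 3 * m * (2 * h1 / g) = 6 * m * h1 / g := by ring
    linear_combination κ * d2 - hx + (-3 * m * f2 * κ * g - f1 * (1 - 2 * p) - 3 * m * f1 * (h1 * g - K) + 6 * m * h1 / g) * hκK
  -- Only κ² is rational in p and q. The quantities h₁ and f₁ are split into a rational part and a
  -- rational multiple of κ; `hE1` says that the multiples of κ cancel in the end.
  obtain ⟨A, hA⟩ : ∃ A, A = (m * K + 1 - 2 * p) / (3 * m * g) := ⟨_, rfl⟩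
  obtain ⟨B, hB⟩ : ∃ B, B = 1 / (3 * m) := ⟨_, rfl⟩
  obtain ⟨A', hA'⟩ : ∃ A', A' = 1 / g ^ 2 - A / (K * g) := ⟨_, rfl⟩
  obtain ⟨B', hB'⟩ : ∃ B', B' = B / (K * g) := ⟨_, rfl⟩
  have hh1' : h1 = A - κ * B := by rw [hh1, hA, hB]; ring
  have hf1' : f1 = A' + κ * B' := by rw [hf1, hA', hB', hh1']; ring
  have hE1 : -3 * m * K * (B' * (A * g - K) - A' * B * g) - 6 * m * K * B / g + 2 * A -
      B' * K * (1 - 2 * p) + B * (1 - 2 * p) / g = 0 := by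
    rw [hB', hA', hB]; field_simp; ring
  have hE : 4 * K * (m * f2 * κ * g) = -3 * m * K * (A' * (A * g - K) - K * B' * B * g) +
      6 * m * K * A / g - 2 * K * B - A' * K * (1 - 2 * p) - (A * (1 - 2 * p) - K) / g := by
    rw [hmain, hf1', hh1']
    linear_combination κ * hE1 + (3 * m * K * B' * B * g - 2 * B) * hκK
  have hgoal : m * f2 / f0 = m * f2 * κ * g := by rw [hf0]; field_simp
  have hE' : m * f2 * κ * g = (-3 * m * K * (A' * (A * g - K) - K * B' * B * g) +
      6 * m * K * A / g - 2 * K * B - A' * K * (1 - 2 * p) - (A * (1 - 2 * p) - K) / g) / (4 * K) := by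
    rw [← hE]; field_simp
  have hden : m * (1 / q) ^ 2 - 1 ≠ 0 := by
    have : m * (1 / q) ^ 2 - 1 = -(g / q) := by rw [hm, hgdef]; field_simp; ring
    rw [this]; exact neg_ne_zero.2 (div_ne_zero hg hq0)
  have hden' : m * (1 / q) ^ 2 - 1 = -(g / q) := by rw [hm, hgdef]; field_simp; ring
  have hden2 : m * (1 / q) = p := by rw [hm]; field_simp
  rw [hgoal, hE', hden', hden2, hB', hA', hA, hB, hK, hm]
  clear hE' hgoal hE hE1 hf1' hh1' hB' hA' hB hA hmain hh2 hh1 hf1 hf0 hpK hκK d1 d2 e0 e1 e2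
  field_simp
  rw [hgdef]
  ring

variable {α β : ℝ}

lemma coeff_one_C_add_X_mul (p : ℝ) (H : PowerSeries ℝ) (k : ℕ) :
    PowerSeries.coeff (k + 1) (C p + X * H) = PowerSeries.coeff k H := by
  rw [map_add, coeff_succ_X_mul, coeff_C, if_neg (by omega), zero_add]

lemma coeff_zero_mul' (S T : PowerSeries ℝ) : PowerSeries.coeff 0 (S * T) =
    PowerSeries.coeff 0 S * PowerSeries.coeff 0 T := by
  simp [coeff_zero_eq_constantCoeff_apply]

lemma coeff_one_mul (S T : PowerSeries ℝ) : PowerSeries.coeff 1 (S * T) =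
    PowerSeries.coeff 0 S * PowerSeries.coeff 1 T +
      PowerSeries.coeff 1 S * PowerSeries.coeff 0 T := by
  rw [PowerSeries.coeff_mul, Finset.Nat.sum_antidiagonal_eq_sum_range_succ_mk]
  simp [Finset.sum_range_succ]

lemma coeff_two_mul (S T : PowerSeries ℝ) : PowerSeries.coeff 2 (S * T) =
    PowerSeries.coeff 0 S * PowerSeries.coeff 2 T +
      PowerSeries.coeff 1 S * PowerSeries.coeff 1 T +
      PowerSeries.coeff 2 S * PowerSeries.coeff 0 T := by
  rw [PowerSeries.coeff_mul, Finset.Nat.sum_antidiagonal_eq_sum_range_succ_mk]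
  simp [Finset.sum_range_succ]

lemma first_coefficients_of_ne (hα : 0 < α) (hμ : mu α β ≠ 0) :
    coeff α β 0 = Real.sqrt (t1 α β / (gap α β * (1 - t0 α β))) ∧
    ncoeff α β 1 = mu α β * tau α β ^ 2 * (mu α β ^ 2 * tau α β ^ 5 - 13 * mu α β ^ 2 * tau α β ^ 4
      - mu α β * tau α β ^ 4 + 21 * tau α β ^ 3 * mu α β + 4 * mu α β * tau α β ^ 2
      - 9 * tau α β ^ 2 - 2 * tau α β - 1)
            / (12 * (mu α β * tau α β ^ 2 - 1) ^ 3 * (1 - mu α β * tau α β)) := by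
  have hab : α ≠ β := by rintro rfl; simp [mu] at hμ
  -- At z = 1 the rescaled series are the original ones, with a = α and b = β.
  have h0 := coeff_div_pow hα hab one_pos 0
  have h1 := coeff_div_pow hα hab one_pos 1
  have hT0 := constantCoeff_tSeries hα hab one_pos
  have hT1 := coeff_one_tSeries hα hab one_pos
  have hpos := coeff_one_tSeries_pos hα hab one_pos
  have hfac := fSeries_mul_factors hα hab one_pos
  have hfm := fSeries_mul hα hab one_pos
  simp only [div_one, one_pow, pow_zero, map_one, one_mul] at h0 h1 hT0 hT1 hpos hfac hfm
  have hp := t0_ne_zero hα hμ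
  have hp1 := t0_lt_one (β := β) hα
  have hq := one_lt_t1 (β := β) hα
  have hg := gap_pos (β := β) hα
  have hD := t1_sub_t0 α β
  have hm := t0_mul_t1 (β := β) hα
  have hmab : β - α = mu α β := rfl
  obtain ⟨H, hH, hH0⟩ := exists_eq_C_add_X_mul (tSeries α β 1)
  rw [hT0] at hH
  rw [h0.trans rfl, ncoeff, h0, h1, tau_eq, ← hm]
  rw [hmab] at hfm
  simp only [expTerm, hmab]
  rw [partsCoeff_succ, partsCoeff_zero, partsCoeff_zero, ← coeff_zero_eq_constantCoeff_apply,
    ← coeff_zero_eq_constantCoeff_apply, coeff_partsOp]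
  rw [← hD] at hg hT1
  have hfac' : fSeries α β 1 * (H * (C (t1 α β) - tSeries α β 1)) = 1 := by
    apply mul_left_cancel₀ (X_ne_zero (R := ℝ))
    have : tSeries α β 1 - C (t0 α β) = X * H := by rw [hH]; ring
    rw [this] at hfac
    linear_combination hfac
  set T := tSeries α β 1
  set F := fSeries α β 1
  set p := t0 α β
  set q := t1 α β
  have hκ : PowerSeries.coeff 1 T ^ 2 * (q * (q - p)) = 1 - p := by
    have : q ≠ 0 := by linarith
    rw [hT1, Real.sq_sqrt (div_nonneg (by linarith) (mul_nonneg (by linarith) hg.le))]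
    field_simp
  set κ := PowerSeries.coeff 1 T
  have c0 : PowerSeries.coeff 0 T = p := by rw [coeff_zero_eq_constantCoeff_apply, hT0]
  have c2 : PowerSeries.coeff 2 T = PowerSeries.coeff 1 H := by
    rw [hH, coeff_one_C_add_X_mul]
  have c3 : PowerSeries.coeff 3 T = PowerSeries.coeff 2 H := by
    rw [hH, coeff_one_C_add_X_mul]
  have ch0 : PowerSeries.coeff 0 H = κ := by rw [coeff_zero_eq_constantCoeff_apply, hH0]
  have c1 : PowerSeries.coeff 1 T = κ := rfl
  have e0 := congrArg (PowerSeries.coeff 0) hfac'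
  have e1 := congrArg (PowerSeries.coeff 1) hfac'
  have e2 := congrArg (PowerSeries.coeff 2) hfac'
  have d1 := congrArg (PowerSeries.coeff 1) hfm
  have d2 := congrArg (PowerSeries.coeff 2) hfm
  rw [coeff_C_add_X_mul] at d1 d2
  simp only [coeff_one_mul, coeff_two_mul, coeff_zero_mul', map_sub, c0, c1, c2, c3, ch0, coeff_C,
    coeff_one] at e0 e1 e2 d1 d2
  norm_num at e0 e1 e2 d1 d2
  simp only [← coeff_zero_eq_constantCoeff_apply] at e0 e1 e2 d1 d2
  rw [← hm] at d1 d2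
  have f0pos : PowerSeries.coeff 0 F = 1 / (κ * (q - p)) := by
    field_simp; linear_combination e0
  refine ⟨?_, ?_⟩
  · symm
    rw [Real.sqrt_eq_iff_mul_self_eq (div_nonneg (by linarith) (mul_nonneg (gap_pos hα).le
      (by linarith))) (by rw [f0pos]; positivity), f0pos, ← hD, ← hκ]
    have : q ≠ 0 := by linarith
    field_simp
  · have key := second_coeff_algebra (f0 := PowerSeries.coeff 0 F) (f1 := PowerSeries.coeff 1 F)
      (f2 := PowerSeries.coeff 2 F) (h1 := PowerSeries.coeff 1 H) (h2 := PowerSeries.coeff 2 H)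
      hp hp1 hq hκ (by linear_combination e0) (by linear_combination e1) (by linear_combination e2)
      (by linear_combination d1) (by linear_combination d2)
    rw [← key, ← hm]
    norm_num

/-- At μ = 0 the outer factor s in the definition of fₖ₊₁ vanishes at s = μ, while f(0) is the
quotient of t'(0) by itself. -/
lemma first_coefficients_of_eq (hα : 0 < α) (hμ : mu α β = 0) :
    coeff α β 0 = 1 ∧ ∀ n, coeff α β (n + 1) = 0 := by
  refine ⟨?_, fun n => ?_⟩
  · rw [coeff, fIter, hμ, f, dslope_same, tOf_zero hα, sub_zero, mul_one,
      div_self (deriv_tOf_zero_ne hα hμ)]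
  · rw [coeff, fIter, hμ]
    exact zero_mul _

lemma t0_eq_zero (hα : 0 < α) (hμ : mu α β = 0) : t0 α β = 0 := by
  have h1 := t0_mul_t1 (β := β) hα
  have h2 := one_lt_t1 (β := β) hα
  rw [hμ] at h1
  rcases mul_eq_zero.1 h1 with h | h
  · exact h
  · linarith

lemma coeff_zero_eq (hα : 0 < α) :
    coeff α β 0 = Real.sqrt (t1 α β / (gap α β * (1 - t0 α β))) := by
  by_cases hμ : mu α β = 0
  · have h := t1_sub_t0 α β
    have h2 := one_lt_t1 (β := β) hα
    rw [t0_eq_zero hα hμ, sub_zero] at h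
    rw [(first_coefficients_of_eq hα hμ).1, t0_eq_zero hα hμ, h, sub_zero, mul_one, div_self,
      Real.sqrt_one]
    rw [← h]; linarith
  · exact (first_coefficients_of_ne hα hμ).1

lemma coeff_zero_pos (hα : 0 < α) : 0 < coeff α β 0 := by
  rw [coeff_zero_eq hα]
  have h1 := t0_lt_one (β := β) hα
  have h2 := one_lt_t1 (β := β) hα
  exact Real.sqrt_pos.2 (div_pos (by linarith) (mul_pos (gap_pos hα) (by linarith)))

theorem first_coefficients (hα : 0 < α) :
    coeff α β 0 = 1 / Real.sqrt (β * mu α β * tau α β ^ 2 - 2 * mu α β * tau α β + 1) ∧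
    ncoeff α β 0 = 1 ∧
    ncoeff α β 1 = mu α β * tau α β ^ 2 * (mu α β ^ 2 * tau α β ^ 5 - 13 * mu α β ^ 2 * tau α β ^ 4
      - mu α β * tau α β ^ 4 + 21 * tau α β ^ 3 * mu α β + 4 * mu α β * tau α β ^ 2
      - 9 * tau α β ^ 2 - 2 * tau α β - 1)
            / (12 * (mu α β * tau α β ^ 2 - 1) ^ 3 * (1 - mu α β * tau α β)) := by
  refine ⟨?_, div_self (coeff_zero_pos hα).ne', ?_⟩
  · have h2 := one_lt_t1 (β := β) hα
    have hβ : β = t0 α β + t1 α β - 1 := by rw [t0_add_t1]; ring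
    have h3 : β * mu α β * tau α β ^ 2 - 2 * mu α β * tau α β + 1 =
        (t1 α β / (gap α β * (1 - t0 α β)))⁻¹ := by
      have h4 : β * mu α β * tau α β ^ 2 - 2 * mu α β * tau α β + 1 =
        (t0 α β + t1 α β - 1) * (mu α β * tau α β) * tau α β - 2 * (mu α β * tau α β) + 1 := by
        rw [← hβ]; ring
      rw [h4, mu_mul_tau hα, tau_eq, inv_div, ← t1_sub_t0]
      have : t1 α β ≠ 0 := by linarith
      field_simp
      ring
    rw [coeff_zero_eq hα, h3, Real.sqrt_inv, one_div, inv_inv]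
  · by_cases hμ : mu α β = 0
    · rw [ncoeff, (first_coefficients_of_eq hα hμ).2 0, hμ]; simp
    · exact (first_coefficients_of_ne hα hμ).2

end FirstCoefficients

end KummerExpansion
end

noncomputable section

namespace KummerExpansion

open Filter Topology

/-! ### Integration from infinity. -/

section Decay

/-- Subtracting the primitive of the derivative bound makes g monotone with limit 0, hence
nonpositive after the subtraction. -/
lemma le_of_deriv_decay {g g' : ℝ → ℝ} {z C : ℝ} {n : ℕ} (hz : 0 < z)
    (hd : ∀ x, z ≤ x → HasDerivAt g (g' x) x) (hb : ∀ x, z ≤ x → |g' x| ≤ C / x ^ (n + 2))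
    (hl : Tendsto g atTop (𝓝 0)) : g z ≤ C / (n + 1) / z ^ (n + 1) := by
  have hd2 : ∀ x, z ≤ x → HasDerivAt (fun x => g x - C / (n + 1) / x ^ (n + 1))
      (g' x + C / x ^ (n + 2)) x := by
    intro x hx
    have hx0 : x ≠ 0 := (hz.trans_le hx).ne'
    refine ((hd x hx).fun_sub ((hasDerivAt_const x (C / ((n : ℝ) + 1))).fun_div
      (hasDerivAt_pow (n + 1) x) (pow_ne_zero _ hx0))).congr_deriv ?_
    have : (n : ℝ) + 1 ≠ 0 := by positivity
    push_cast
    field_simp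
    ring
  have hmono : MonotoneOn (fun x => g x - C / (n + 1) / x ^ (n + 1)) (Set.Ici z) := by
    refine monotoneOn_of_hasDerivWithinAt_nonneg (convex_Ici z)
      (fun x hx => (hd2 x hx).continuousAt.continuousWithinAt)
      (fun x hx => (hd2 x (interior_subset hx)).hasDerivWithinAt) fun x hx => ?_
    have := (abs_le.1 (hb x (interior_subset hx))).1
    linarith
  have hlim : Tendsto (fun x : ℝ => g x - C / (n + 1) / x ^ (n + 1)) atTop (𝓝 0) := by
    have := hl.sub (tendsto_const_nhds (x := C / ((n : ℝ) + 1)).div_atTop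
      (tendsto_pow_atTop (n := n + 1) (by omega) (α := ℝ)))
    simpa using this
  have := ge_of_tendsto hlim (b := g z - C / (n + 1) / z ^ (n + 1))
    ((eventually_ge_atTop z).mono fun x hx => hmono Set.self_mem_Ici hx hx)
  linarith

/-- A function that tends to `0` is bounded by the integral of the bound of its derivative. -/
lemma abs_le_of_deriv_decay {g g' : ℝ → ℝ} {z C : ℝ} {n : ℕ} (hz : 0 < z)
    (hd : ∀ x, z ≤ x → HasDerivAt g (g' x) x) (hb : ∀ x, z ≤ x → |g' x| ≤ C / x ^ (n + 2))
    (hl : Tendsto g atTop (𝓝 0)) : |g z| ≤ C / (n + 1) / z ^ (n + 1) := by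
  refine abs_le'.2 ⟨le_of_deriv_decay hz hd hb hl, ?_⟩
  refine le_of_deriv_decay (g := fun x => -g x) (g' := fun x => -g' x) hz
    (fun x hx => (hd x hx).fun_neg) (fun x hx => by rw [abs_neg]; exact hb x hx) ?_
  simpa using hl.neg

end Decay

/-! ### A calculus of symbol estimates in z. -/

section Symbols

/-- Bounds `O(z^{-m-j})` for the `z`-derivatives of order `j ≤ k`, uniform on the region `Ω`. -/
def SymbolBound (Ω : ℝ → ℝ → ℝ → Prop) : ℕ → ℕ → (ℝ → ℝ → ℝ → ℝ) → Prop
  | 0, m, g => ∃ C, ∀ a b z, Ω a b z → |g a b z| ≤ C / z ^ m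
  | k + 1, m, g => (∃ C, ∀ a b z, Ω a b z → |g a b z| ≤ C / z ^ m) ∧
      ∃ g', (∀ a b z, Ω a b z → HasDerivAt (g a b) (g' a b z) z) ∧ SymbolBound Ω k (m + 1) g'

variable {Ω : ℝ → ℝ → ℝ → Prop} {k m n : ℕ} {g h : ℝ → ℝ → ℝ → ℝ}

lemma SymbolBound.bound (hg : SymbolBound Ω k m g) :
    ∃ C, ∀ a b z, Ω a b z → |g a b z| ≤ C / z ^ m := by
  cases k with
  | zero => exact hg
  | succ k => exact hg.1

lemma SymbolBound.pred (hg : SymbolBound Ω (k + 1) m g) : SymbolBound Ω k m g := by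
  induction k generalizing m g with
  | zero => exact hg.1
  | succ k ih => exact ⟨hg.1, hg.2.imp fun g' h' => ⟨h'.1, ih h'.2⟩⟩

lemma SymbolBound.congr (hΩ : ∀ a b z, Ω a b z → ∀ᶠ x in 𝓝 z, Ω a b x)
    (hg : SymbolBound Ω k m g) (hgh : ∀ a b z, Ω a b z → h a b z = g a b z) :
    SymbolBound Ω k m h := by
  have hb : ∃ C, ∀ a b z, Ω a b z → |h a b z| ≤ C / z ^ m :=
    hg.bound.imp fun C hC a b z hz => by rw [hgh a b z hz]; exact hC a b z hz
  cases k with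
  | zero => exact hb
  | succ k =>
    refine ⟨hb, hg.2.imp fun g' h' => ⟨fun a b z hz => ?_, h'.2⟩⟩
    exact (h'.1 a b z hz).congr_of_eventuallyEq ((hΩ a b z hz).mono fun x hx => hgh a b x hx)

lemma SymbolBound.of_hasDerivAt (hΩ : ∀ a b z, Ω a b z → ∀ᶠ x in 𝓝 z, Ω a b x)
    (hg : SymbolBound Ω (k + 1) m g) (hgh : ∀ a b z, Ω a b z → HasDerivAt (g a b) (h a b z) z) :
    SymbolBound Ω k (m + 1) h := by
  obtain ⟨-, g', h1, h2⟩ := hg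
  exact h2.congr hΩ fun a b z hz => (hgh a b z hz).unique (h1 a b z hz)

lemma SymbolBound.add (hg : SymbolBound Ω k m g) (hh : SymbolBound Ω k m h) :
    SymbolBound Ω k m (fun a b z => g a b z + h a b z) := by
  induction k generalizing m g h with
  | zero =>
    obtain ⟨C, hC⟩ := hg
    obtain ⟨D, hD⟩ := hh
    refine ⟨C + D, fun a b z hz => ?_⟩
    rw [add_div]
    exact (abs_add_le _ _).trans (add_le_add (hC a b z hz) (hD a b z hz))
  | succ k ih =>
    obtain ⟨⟨C, hC⟩, g', h1, h2⟩ := hg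
    obtain ⟨⟨D, hD⟩, h', h3, h4⟩ := hh
    refine ⟨⟨C + D, fun a b z hz => ?_⟩, _, fun a b z hz => (h1 a b z hz).fun_add (h3 a b z hz),
      ih h2 h4⟩
    rw [add_div]
    exact (abs_add_le _ _).trans (add_le_add (hC a b z hz) (hD a b z hz))

lemma SymbolBound.neg (hg : SymbolBound Ω k m g) :
    SymbolBound Ω k m (fun a b z => -g a b z) := by
  induction k generalizing m g with
  | zero => exact hg.imp fun C hC a b z hz => by rw [abs_neg]; exact hC a b z hz
  | succ k ih =>
    obtain ⟨hC, g', h1, h2⟩ := hg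
    exact ⟨hC.imp fun C hC a b z hz => by rw [abs_neg]; exact hC a b z hz, _,
      fun a b z hz => (h1 a b z hz).fun_neg, ih h2⟩

lemma SymbolBound.sub (hg : SymbolBound Ω k m g) (hh : SymbolBound Ω k m h) :
    SymbolBound Ω k m (fun a b z => g a b z - h a b z) := by
  simpa only [sub_eq_add_neg] using hg.add hh.neg

lemma SymbolBound.zero : SymbolBound Ω k m (fun _ _ _ => 0) := by
  induction k generalizing m with
  | zero => exact ⟨0, fun a b z _ => by simp⟩
  | succ k ih => exact ⟨⟨0, fun a b z _ => by simp⟩, _, fun a b z _ => hasDerivAt_const z 0, ih⟩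

lemma SymbolBound.const (c : ℝ) : SymbolBound Ω k 0 (fun _ _ _ => c) := by
  have hb : ∃ C, ∀ a b z, Ω a b z → |c| ≤ C / z ^ 0 := ⟨|c|, fun a b z _ => by simp⟩
  cases k with
  | zero => exact hb
  | succ k => exact ⟨hb, _, fun a b z _ => hasDerivAt_const z c, .zero⟩

lemma abs_mul_le_of_symbol {x y C D z : ℝ} (hx : |x| ≤ C / z ^ m) (hy : |y| ≤ D / z ^ n) :
    |x * y| ≤ C * D / z ^ (m + n) := by
  rw [abs_mul, pow_add, mul_div_mul_comm]
  exact mul_le_mul hx hy (abs_nonneg _) ((abs_nonneg _).trans hx)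

lemma SymbolBound.mul (hg : SymbolBound Ω k m g) (hh : SymbolBound Ω k n h) :
    SymbolBound Ω k (m + n) (fun a b z => g a b z * h a b z) := by
  induction k generalizing m n g h with
  | zero =>
    obtain ⟨C, hC⟩ := hg
    obtain ⟨D, hD⟩ := hh
    exact ⟨C * D, fun a b z hz => abs_mul_le_of_symbol (hC a b z hz) (hD a b z hz)⟩
  | succ k ih =>
    have hg0 := hg.pred
    have hh0 := hh.pred
    obtain ⟨⟨C, hC⟩, g', h1, h2⟩ := hg
    obtain ⟨⟨D, hD⟩, h', h3, h4⟩ := hh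
    refine ⟨⟨C * D, fun a b z hz => abs_mul_le_of_symbol (hC a b z hz) (hD a b z hz)⟩, _,
      fun a b z hz => (h1 a b z hz).fun_mul (h3 a b z hz), ?_⟩
    have e1 := ih h2 hh0
    have e2 := ih hg0 h4
    rw [show m + 1 + n = m + n + 1 by ring] at e1
    exact e1.add e2

lemma SymbolBound.inv (hΩ : ∀ a b z, Ω a b z → 0 < z) : SymbolBound Ω k 1 (fun _ _ z => 1 / z) := by
  induction k with
  | zero => exact ⟨1, fun a b z hz => by rw [pow_one, abs_of_pos (one_div_pos.2 (hΩ a b z hz))]⟩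
  | succ k ih =>
    refine ⟨ih.bound, fun _ _ z => -(1 / z * (1 / z)), fun a b z hz => ?_, (ih.mul ih).neg⟩
    refine ((hasDerivAt_const_div 1 (hΩ a b z hz))).congr_deriv ?_
    field_simp

end Symbols

/-! ### Uniform bounds for the terms of the expansion. -/

section Region

/-- The part of the parameter space, open and closed under enlarging `z`, where `t₀ / (t₁ - t₀)`
and `1 / (t₁ - t₀)` are bounded by `K`. -/
def InRegion (K a b z : ℝ) : Prop :=
  0 < a ∧ a ≠ b ∧ ∃ w, 0 < w ∧ w < z ∧ ∀ x, w ≤ x →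
    |t0 (a / x) (b / x) / gap (a / x) (b / x)| ≤ K ∧ |1 / gap (a / x) (b / x)| ≤ K

variable {K a b z : ℝ}

lemma InRegion.pos (h : InRegion K a b z) : 0 < z := by
  obtain ⟨-, -, w, h1, h2, -⟩ := h; linarith

lemma InRegion.mono (h : InRegion K a b z) {x : ℝ} (hx : z ≤ x) : InRegion K a b x := by
  obtain ⟨h0, h00, w, h1, h2, h3⟩ := h
  exact ⟨h0, h00, w, h1, h2.trans_le hx, h3⟩

lemma InRegion.eventually (h : InRegion K a b z) : ∀ᶠ x in 𝓝 z, InRegion K a b x := by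
  obtain ⟨h0, h00, w, h1, h2, h3⟩ := h
  filter_upwards [lt_mem_nhds h2] with x hx
  exact ⟨h0, h00, w, h1, hx, h3⟩

/-- The form matters: the derivative with respect to log z of the logarithm of t₁ − t₀ is a
polynomial in the two ratios bounded on the region. -/
lemma hasDerivAt_gap_eq (ha : 0 < a) (hz : 0 < z) :
    HasDerivAt (fun z => gap (a / z) (b / z)) (gap (a / z) (b / z) / z *
      ((2 * (1 / gap (a / z) (b / z)) - 1 - 2 * (t0 (a / z) (b / z) / gap (a / z) (b / z))) *
        (1 + 2 * (t0 (a / z) (b / z) / gap (a / z) (b / z)) - 1 / gap (a / z) (b / z)) -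
        2 * ((1 / gap (a / z) (b / z) - t0 (a / z) (b / z) / gap (a / z) (b / z)) *
          (1 + t0 (a / z) (b / z) / gap (a / z) (b / z) - 1 / gap (a / z) (b / z))))) z := by
  refine (hasDerivAt_gap (b := b) ha hz).congr_deriv ?_
  have hα := div_pos ha hz
  have hg := (gap_pos (β := b / z) hα).ne'
  have h1 := one_sub_t0_mul (β := b / z) hα
  have h2 := t0_add_t1 (a / z) (b / z)
  have h3 := t1_sub_t0 (a / z) (b / z)
  have hb : b / z = 2 * t0 (a / z) (b / z) + gap (a / z) (b / z) - 1 := by linarith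
  have hα' : a / z = (1 - t0 (a / z) (b / z)) * (t0 (a / z) (b / z) + gap (a / z) (b / z) - 1) := by
    rw [← h3]; linear_combination -h1
  generalize t0 (a / z) (b / z) = p at *
  generalize gap (a / z) (b / z) = g at *
  rw [hα', hb]
  have := hz.ne'
  field_simp
  ring

/-- `t₀ / (t₁ - t₀)` as a function of `a, b, z`. -/
def ratioA (a b z : ℝ) : ℝ := t0 (a / z) (b / z) / gap (a / z) (b / z)

/-- `1 / (t₁ - t₀)` as a function of `a, b, z`. -/
def ratioB (a b z : ℝ) : ℝ := 1 / gap (a / z) (b / z)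

/-- The logarithmic derivative of `t₁ - t₀` with respect to `log z`. -/
def ratioD (a b z : ℝ) : ℝ :=
  (2 * ratioB a b z - 1 - 2 * ratioA a b z) * (1 + 2 * ratioA a b z - ratioB a b z) -
    2 * ((ratioB a b z - ratioA a b z) * (1 + ratioA a b z - ratioB a b z))

lemma hasDerivAt_ratioA (ha : 0 < a) (hz : 0 < z) :
    HasDerivAt (ratioA a b) (1 / z * (-(ratioA a b z * (ratioB a b z - ratioA a b z)) -
      ratioA a b z * ratioD a b z)) z := by
  have hg := (gap_pos (β := b / z) (div_pos ha hz)).ne'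
  refine ((hasDerivAt_t0 (b := b) ha hz).fun_div (hasDerivAt_gap_eq ha hz) hg).congr_deriv ?_
  rw [ratioD]
  simp only [ratioA, ratioB]
  have := hz.ne'
  generalize t0 (a / z) (b / z) = p at *
  generalize gap (a / z) (b / z) = g at *
  field_simp

lemma hasDerivAt_ratioB (ha : 0 < a) (hz : 0 < z) :
    HasDerivAt (ratioB a b) (-(1 / z * (ratioB a b z * ratioD a b z))) z := by
  have hg := (gap_pos (β := b / z) (div_pos ha hz)).ne'
  refine ((hasDerivAt_const z (1 : ℝ)).fun_div (hasDerivAt_gap_eq ha hz) hg).congr_deriv ?_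
  rw [ratioD]
  simp only [ratioA, ratioB]
  have := hz.ne'
  generalize t0 (a / z) (b / z) = p at *
  generalize gap (a / z) (b / z) = g at *
  field_simp
  ring

/-- Polynomials in `ratioA` and `ratioB` are closed under z·d/dz, so boundedness of the two
functions already gives symbol bounds of every order. -/
lemma symbolBound_ratio (K : ℝ) (k : ℕ) :
    SymbolBound (InRegion K) k 0 ratioA ∧ SymbolBound (InRegion K) k 0 ratioB := by
  have hA : ∃ C, ∀ a b z, InRegion K a b z → |ratioA a b z| ≤ C / z ^ 0 :=
    ⟨K, fun a b z ⟨_, _, w, _, h2, h3⟩ => by rw [pow_zero, div_one]; exact (h3 z h2.le).1⟩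
  have hB : ∃ C, ∀ a b z, InRegion K a b z → |ratioB a b z| ≤ C / z ^ 0 :=
    ⟨K, fun a b z ⟨_, _, w, _, h2, h3⟩ => by rw [pow_zero, div_one]; exact (h3 z h2.le).2⟩
  induction k with
  | zero => exact ⟨hA, hB⟩
  | succ k ih =>
    obtain ⟨iA, iB⟩ := ih
    have hi : SymbolBound (InRegion K) k 1 (fun _ _ z => 1 / z) := .inv fun a b z h => h.pos
    have iD : SymbolBound (InRegion K) k 0 ratioD :=
      (((((SymbolBound.const 2).mul iB).sub (.const 1)).sub ((SymbolBound.const 2).mul iA)).mul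
        (((SymbolBound.const 1).add ((SymbolBound.const 2).mul iA)).sub iB)).sub
        ((SymbolBound.const 2).mul ((iB.sub iA).mul (((SymbolBound.const 1).add iA).sub iB)))
    exact ⟨⟨hA, _, fun a b z h => hasDerivAt_ratioA h.1 h.pos,
      hi.mul ((iA.mul (iB.sub iA)).neg.sub (iA.mul iD))⟩,
      ⟨hB, _, fun a b z h => hasDerivAt_ratioB h.1 h.pos, (hi.mul (iB.mul iD)).neg⟩⟩

/-- The logarithmic derivative of the leading term. -/
def logDerivZero (a b z : ℝ) : ℝ := 1 / z * -(ratioA a b z * (ratioB a b z - ratioA a b z))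

lemma symbolBound_logDerivZero (K : ℝ) (k : ℕ) :
    SymbolBound (InRegion K) k 1 logDerivZero := by
  obtain ⟨iA, iB⟩ := symbolBound_ratio K k
  exact (SymbolBound.inv fun a b z h => h.pos).mul (iA.mul (iB.sub iA)).neg

lemma expTerm_zero_pos (ha : 0 < a) (hab : a ≠ b) (hz : 0 < z) : 0 < expTerm a b 0 z := by
  rw [← coeff_div_pow ha hab hz, pow_zero, div_one]
  exact coeff_zero_pos (div_pos ha hz)

lemma hasDerivAt_expTerm_zero (ha : 0 < a) (hab : a ≠ b) (hz : 0 < z) :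
    HasDerivAt (expTerm a b 0) (logDerivZero a b z * expTerm a b 0 z) z := by
  refine (hasDerivAt_expTerm ha hab hz 0).congr_deriv ?_
  have h := gap_mul_auxTerm_one ha hab hz
  have hg := (gap_pos (β := b / z) (div_pos ha hz)).ne'
  rw [zero_add, ← mul_right_inj' hg, mul_neg, h]
  simp only [logDerivZero, ratioA, ratioB]
  field_simp

/-- Second derivative of the terms along a ray. -/
def expTermSnd (a b : ℝ) (n : ℕ) (z : ℝ) : ℝ :=
  -(t0 (a / z) (b / z) * (1 - t0 (a / z) (b / z)) / (z * gap (a / z) (b / z)) *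
      expTerm a b (n + 1) z) + gap (a / z) (b / z) * auxTerm a b (n + 2) z

lemma hasDerivAt_neg_auxTerm (ha : 0 < a) (hab : a ≠ b) (hz : 0 < z) (n : ℕ) :
    HasDerivAt (fun z => -auxTerm a b (n + 1) z) (expTermSnd a b n z) z := by
  refine (hasDerivAt_auxTerm ha hab hz (n + 1)).fun_neg.congr_deriv ?_
  rw [expTermSnd]; ring

/-- Dividing the recursion by E₀ removes the zero-order term: (Eₙ₊₁/E₀)' = −Eₙ''/((t₁ − t₀)E₀),
which is O(z^(−n−2)). As Eₙ₊₁/E₀ → 0, integration from infinity gives O(z^(−n−1)). The bounds are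
carried for all orders of differentiation because each index costs two derivatives of the previous
term. -/
lemma symbolBound_expTerm (K : ℝ) (n : ℕ) :
    ∀ k, SymbolBound (InRegion K) k n (fun a b z => expTerm a b n z / expTerm a b 0 z) ∧
      SymbolBound (InRegion K) k (n + 1) (fun a b z => -auxTerm a b (n + 1) z / expTerm a b 0 z) ∧
      SymbolBound (InRegion K) k (n + 2) (fun a b z => expTermSnd a b n z / expTerm a b 0 z) := by
  have hΩ : ∀ a b z, InRegion K a b z → ∀ᶠ x in 𝓝 z, InRegion K a b x :=
    fun a b z h => h.eventually
  -- The derivative of Eₙ/E₀ is Eₙ'/E₀ minus the logarithmic derivative of E₀ times Eₙ/E₀, so Eₙ'/E₀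
  -- inherits a symbol bound; the same argument then treats Eₙ''/E₀.
  have step : ∀ n, (∀ k, SymbolBound (InRegion K) k n
        (fun a b z => expTerm a b n z / expTerm a b 0 z)) →
      ∀ k, SymbolBound (InRegion K) k (n + 1)
        (fun a b z => -auxTerm a b (n + 1) z / expTerm a b 0 z) ∧
      SymbolBound (InRegion K) k (n + 2) (fun a b z => expTermSnd a b n z / expTerm a b 0 z) := by
    intro n hn
    have h1 : ∀ k, SymbolBound (InRegion K) k (n + 1)
        (fun a b z => -auxTerm a b (n + 1) z / expTerm a b 0 z) := by
      intro k
      have hd : SymbolBound (InRegion K) k (n + 1) (fun a b z =>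
          -auxTerm a b (n + 1) z / expTerm a b 0 z -
            logDerivZero a b z * (expTerm a b n z / expTerm a b 0 z)) := by
        refine (hn (k + 1)).of_hasDerivAt hΩ fun a b z hz => ?_
        have h0 := (expTerm_zero_pos hz.1 hz.2.1 hz.pos).ne'
        refine ((hasDerivAt_expTerm hz.1 hz.2.1 hz.pos n).fun_div
          (hasDerivAt_expTerm_zero hz.1 hz.2.1 hz.pos) h0).congr_deriv ?_
        field_simp
      have hl := (symbolBound_logDerivZero K k).mul (hn k)
      rw [add_comm 1 n] at hl
      exact (hd.add hl).congr hΩ fun a b z _ => by ring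
    refine fun k => ⟨h1 k, ?_⟩
    have hd : SymbolBound (InRegion K) k (n + 2) (fun a b z =>
        expTermSnd a b n z / expTerm a b 0 z -
          logDerivZero a b z * (-auxTerm a b (n + 1) z / expTerm a b 0 z)) := by
      refine (h1 (k + 1)).of_hasDerivAt hΩ fun a b z hz => ?_
      have h0 := (expTerm_zero_pos hz.1 hz.2.1 hz.pos).ne'
      refine ((hasDerivAt_neg_auxTerm hz.1 hz.2.1 hz.pos n).fun_div
        (hasDerivAt_expTerm_zero hz.1 hz.2.1 hz.pos) h0).congr_deriv ?_
      field_simp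
    have hl := (symbolBound_logDerivZero K k).mul (h1 k)
    rw [show 1 + (n + 1) = n + 2 by ring] at hl
    exact (hd.add hl).congr hΩ fun a b z _ => by ring
  have main : ∀ n k, SymbolBound (InRegion K) k n
      (fun a b z => expTerm a b n z / expTerm a b 0 z) := by
    intro n
    induction n with
    | zero =>
      refine fun k => (SymbolBound.const 1).congr hΩ fun a b z hz => ?_
      exact div_self (expTerm_zero_pos hz.1 hz.2.1 hz.pos).ne'
    | succ n ih =>
      have hW : ∀ k, SymbolBound (InRegion K) k (n + 2) (fun a b z =>
          -(ratioB a b z * (expTermSnd a b n z / expTerm a b 0 z))) := by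
        intro k
        have := ((symbolBound_ratio K k).2.mul (step n ih k).2).neg
        rwa [zero_add] at this
      have hd : ∀ a b z, InRegion K a b z → HasDerivAt
          (fun z => expTerm a b (n + 1) z / expTerm a b 0 z)
          (-(ratioB a b z * (expTermSnd a b n z / expTerm a b 0 z))) z := by
        intro a b z hz
        have h0 := (expTerm_zero_pos hz.1 hz.2.1 hz.pos).ne'
        have hg := (gap_pos (β := b / z) (div_pos hz.1 hz.pos)).ne'
        have hz0 := hz.pos.ne'
        refine ((hasDerivAt_expTerm hz.1 hz.2.1 hz.pos (n + 1)).fun_div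
          (hasDerivAt_expTerm_zero hz.1 hz.2.1 hz.pos) h0).congr_deriv ?_
        simp only [expTermSnd, logDerivZero, ratioA, ratioB]
        field_simp
        ring
      have hb : ∃ C, ∀ a b z, InRegion K a b z →
          |expTerm a b (n + 1) z / expTerm a b 0 z| ≤ C / z ^ (n + 1) := by
        obtain ⟨C, hC⟩ := (hW 0).bound
        refine ⟨C / (n + 1), fun a b z hz => ?_⟩
        refine abs_le_of_deriv_decay hz.pos (fun x hx => hd a b x (hz.mono hx))
          (fun x hx => hC a b x (hz.mono hx)) ?_
        have := (tendsto_expTerm_succ hz.1 hz.2.1 n).div (tendsto_expTerm_zero hz.1 hz.2.1)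
          one_ne_zero
        rwa [zero_div] at this
      intro k
      cases k with
      | zero => exact hb
      | succ k => exact ⟨hb, _, hd, hW k⟩
  exact fun k => ⟨main n k, step n (main n) k⟩

end Region

end KummerExpansion
end

noncomputable section

namespace KummerExpansion

open Filter Topology

/-! ### Kummer's function: series, differential equation, Riccati equation. -/

section Kummer

/-- The coefficients of Kummer's series. -/
def kummerCoeff (a b : ℝ) (n : ℕ) : ℝ :=
  (ascPochhammer ℝ n).eval a / (ascPochhammer ℝ n).eval b / (n.factorial : ℝ)

variable {a b z : ℝ}

lemma kummerCoeff_pos (ha : 0 < a) (hb : 0 < b) (n : ℕ) : 0 < kummerCoeff a b n :=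
  div_pos (div_pos (ascPochhammer_pos n a ha) (ascPochhammer_pos n b hb))
    (Nat.cast_pos.2 n.factorial_pos)

lemma kummerCoeff_zero (a b : ℝ) : kummerCoeff a b 0 = 1 := by simp [kummerCoeff]

lemma succ_mul_kummerCoeff_succ (a : ℝ) (hb : 0 < b) (n : ℕ) :
    (n + 1) * kummerCoeff a b (n + 1) = kummerCoeff a b n * ((a + n) / (b + n)) := by
  have h1 := (ascPochhammer_pos n b hb).ne'
  have h2 : b + n ≠ 0 := by positivity
  have h3 : (n.factorial : ℝ) ≠ 0 := Nat.cast_ne_zero.2 n.factorial_ne_zero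
  have h4 : (n : ℝ) + 1 ≠ 0 := by positivity
  rw [kummerCoeff, kummerCoeff, ascPochhammer_succ_eval, ascPochhammer_succ_eval,
    Nat.factorial_succ]
  push_cast
  field_simp

lemma kummerCoeff_succ_succ (a : ℝ) (hb : 0 < b) (n : ℕ) :
    a / b * kummerCoeff (a + 1) (b + 1) n = kummerCoeff a b n * ((a + n) / (b + n)) := by
  rw [← succ_mul_kummerCoeff_succ a hb, kummerCoeff, kummerCoeff, ascPochhammer_succ_left,
    Nat.factorial_succ]
  have h1 := (ascPochhammer_pos n (b + 1) (by linarith)).ne'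
  have h3 : (n.factorial : ℝ) ≠ 0 := Nat.cast_ne_zero.2 n.factorial_ne_zero
  have h4 : (n : ℝ) + 1 ≠ 0 := by positivity
  simp only [Polynomial.eval_mul, Polynomial.eval_comp, Polynomial.eval_X, Polynomial.eval_add,
    Polynomial.eval_one]
  push_cast
  field_simp

lemma kummerCoeff_succ_left (ha : 0 < a) (hb : 0 < b) (n : ℕ) :
    kummerCoeff (a + 1) b n = kummerCoeff a b n * ((a + n) / a) := by
  have h := ascPochhammer_succ_eval n a
  rw [ascPochhammer_succ_left] at h
  simp only [Polynomial.eval_mul, Polynomial.eval_comp, Polynomial.eval_X, Polynomial.eval_add,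
    Polynomial.eval_one] at h
  have h1 := (ascPochhammer_pos n b hb).ne'
  have h3 : (n.factorial : ℝ) ≠ 0 := Nat.cast_ne_zero.2 n.factorial_ne_zero
  rw [kummerCoeff, kummerCoeff]
  field_simp
  linear_combination h

lemma summable_kummer (ha : 0 < a) (hb : 0 < b) (z : ℝ) :
    Summable fun n => kummerCoeff a b n * z ^ n := by
  by_cases hz : z = 0
  · refine summable_of_ne_finset_zero (s := {0}) fun n hn => ?_
    rw [hz, zero_pow (by simpa using hn), mul_zero]
  refine summable_of_ratio_test_tendsto_lt_one (l := 0) one_pos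
    (Eventually.of_forall fun n => mul_ne_zero (kummerCoeff_pos ha hb n).ne' (pow_ne_zero _ hz)) ?_
  have h1 : ∀ n : ℕ, ‖kummerCoeff a b (n + 1) * z ^ (n + 1)‖ / ‖kummerCoeff a b n * z ^ n‖ =
      |z| * ((a + n) / (b + n) * (1 / ((n : ℝ) + 1))) := by
    intro n
    have h := succ_mul_kummerCoeff_succ a hb n
    have h2 := kummerCoeff_pos ha hb n
    have h3 := kummerCoeff_pos ha hb (n + 1)
    have h4 : (n : ℝ) + 1 ≠ 0 := by positivity
    have h5 : |z| ≠ 0 := abs_ne_zero.2 hz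
    rw [norm_mul, norm_mul, Real.norm_eq_abs, abs_of_pos h3, Real.norm_eq_abs (kummerCoeff a b n),
      abs_of_pos h2, norm_pow, norm_pow, Real.norm_eq_abs, pow_succ]
    rw [show kummerCoeff a b (n + 1) = kummerCoeff a b n * ((a + n) / (b + n)) / (n + 1) by
      rw [← h]; field_simp]
    field_simp
  simp only [h1]
  have h2 : Tendsto (fun n : ℕ => (a + n) / (b + n) * (1 / ((n : ℝ) + 1))) atTop (𝓝 0) := by
    refine squeeze_zero' (g := fun n : ℕ => (a / b + 1) * (1 / ((n : ℝ) + 1)))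
      (Eventually.of_forall fun n => by positivity) (Eventually.of_forall fun n => ?_) ?_
    · refine mul_le_mul_of_nonneg_right ?_ (by positivity)
      rw [add_div]
      exact add_le_add (div_le_div_of_nonneg_left ha.le hb (by simp))
        ((div_le_one (by positivity)).2 (by linarith))
    · simpa using (tendsto_one_div_add_atTop_nhds_zero_nat (𝕜 := ℝ)).const_mul (a / b + 1)
  simpa using h2.const_mul |z|

lemma kummerM_eq_tsum (a b z : ℝ) : kummerM a b z = ∑' n, kummerCoeff a b n * z ^ n :=
  tsum_congr fun n => by rw [kummerCoeff]; ring

lemma hasSum_kummerM (ha : 0 < a) (hb : 0 < b) (z : ℝ) :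
    HasSum (fun n => kummerCoeff a b n * z ^ n) (kummerM a b z) := by
  rw [kummerM_eq_tsum]; exact (summable_kummer ha hb z).hasSum

/-- The derivative of Kummer's function. -/
def kummerDeriv (a b z : ℝ) : ℝ := a / b * kummerM (a + 1) (b + 1) z

lemma hasSum_kummerDeriv (ha : 0 < a) (hb : 0 < b) (z : ℝ) :
    HasSum (fun n : ℕ => kummerCoeff a b n * ((a + n) / (b + n)) * z ^ n) (kummerDeriv a b z) := by
  have h := (hasSum_kummerM (a := a + 1) (b := b + 1) (by linarith) (by linarith) z).mul_left (a / b)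
  simpa only [← mul_assoc, kummerCoeff_succ_succ a hb, kummerDeriv] using h

lemma hasDerivAt_kummerM (ha : 0 < a) (hb : 0 < b) (z : ℝ) :
    HasDerivAt (kummerM a b) (kummerDeriv a b z) z := by
  have hshift : ∀ x : ℝ, HasSum (fun n : ℕ => kummerCoeff a b n * (n * x ^ (n - 1)))
      (kummerDeriv a b x) := by
    intro x
    have h := hasSum_kummerDeriv ha hb x
    rw [← hasSum_nat_add_iff' 1]
    simp only [Finset.range_one, Finset.sum_singleton, CharP.cast_eq_zero, zero_mul, mul_zero,
      sub_zero, Nat.add_sub_cancel]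
    refine h.congr_fun ?_
    intro n
    rw [← succ_mul_kummerCoeff_succ a hb]
    push_cast; ring
  have h := hasDerivAt_tsum_of_isPreconnected (t := Metric.ball (0 : ℝ) (|z| + 1))
    (g := fun n x => kummerCoeff a b n * x ^ n)
    (g' := fun n x => kummerCoeff a b n * (n * x ^ (n - 1))) (y₀ := z) (y := z)
    (hshift (|z| + 1)).summable Metric.isOpen_ball
    (convex_ball (0 : ℝ) (|z| + 1)).isPreconnected
    (fun n x _ => (hasDerivAt_pow n x).const_mul _) (fun n x hx => ?_) (by simp)
    (summable_kummer ha hb z) (by simp)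
  · rw [(hshift z).tsum_eq] at h
    exact h.congr_of_eventuallyEq (Eventually.of_forall fun x => kummerM_eq_tsum a b x)
  · rw [norm_mul, norm_mul, norm_pow, Real.norm_eq_abs (kummerCoeff a b n),
      abs_of_pos (kummerCoeff_pos ha hb n)]
    have : ‖x‖ ≤ |z| + 1 := (mem_ball_zero_iff.1 hx).le
    simp only [RCLike.norm_natCast]
    gcongr
    exact (kummerCoeff_pos ha hb n).le

lemma hasSum_mul_kummerDeriv (ha : 0 < a) (hb : 0 < b) (z : ℝ) :
    HasSum (fun n : ℕ => n * kummerCoeff a b n * z ^ n) (z * kummerDeriv a b z) := by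
  rw [← hasSum_nat_add_iff' 1]
  simp only [Finset.range_one, Finset.sum_singleton, CharP.cast_eq_zero, zero_mul, sub_zero]
  refine ((hasSum_kummerDeriv ha hb z).mul_left z).congr_fun ?_
  intro n
  rw [← succ_mul_kummerCoeff_succ a hb]
  push_cast; ring

/-- Kummer's equation zM'' + (b − z)M' = aM, solved for M'' and checked on the coefficients of the
series. -/
lemma hasDerivAt_kummerDeriv (ha : 0 < a) (hb : 0 < b) (hz : 0 < z) :
    HasDerivAt (kummerDeriv a b) (a / z * kummerM a b z + (1 - b / z) * kummerDeriv a b z) z := by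
  refine ((hasDerivAt_kummerM (a := a + 1) (b := b + 1) (by linarith) (by linarith)
    z).const_mul (a / b)).congr_deriv ?_
  have h1 := (hasSum_mul_kummerDeriv (a := a + 1) (b := b + 1) (by linarith) (by linarith)
    z).mul_left (a / b)
  have h2 := (hasSum_kummerDeriv ha hb z).mul_left b
  have h3 := (hasSum_mul_kummerDeriv ha hb z).add ((hasSum_kummerM ha hb z).mul_left a)
  have h4 := (h1.add h2).unique (h3.congr_fun fun n => ?_)
  · have h5 : a / b * kummerDeriv (a + 1) (b + 1) z = (z * kummerDeriv a b z +
        a * kummerM a b z - b * kummerDeriv a b z) / z := by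
      rw [eq_div_iff hz.ne']; linear_combination h4
    rw [h5]; field_simp
    ring
  · have hc := kummerCoeff_succ_succ a hb n
    have : b + n ≠ 0 := by positivity
    have h5 : kummerCoeff a b n * (a + n) = kummerCoeff a b n * ((a + n) / (b + n)) * (b + n) := by
      field_simp
    linear_combination (n : ℝ) * z ^ n * hc - z ^ n * h5

lemma kummerM_succ_left (ha : 0 < a) (hb : 0 < b) (z : ℝ) :
    a * kummerM (a + 1) b z = a * kummerM a b z + z * kummerDeriv a b z := by
  have h1 := (hasSum_kummerM (a := a + 1) (by linarith) hb z).mul_left a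
  refine h1.unique ((((hasSum_kummerM ha hb z).mul_left a).add
    (hasSum_mul_kummerDeriv ha hb z)).congr_fun fun n => ?_)
  rw [kummerCoeff_succ_left ha hb]
  field_simp

lemma kummerM_pos (ha : 0 < a) (hb : 0 < b) (hz : 0 ≤ z) : 0 < kummerM a b z := by
  rw [kummerM_eq_tsum]
  exact (summable_kummer ha hb z).tsum_pos
    (fun n => mul_nonneg (kummerCoeff_pos ha hb n).le (pow_nonneg hz n)) 0
    (by simp [kummerCoeff_zero])

lemma kummerDeriv_pos (ha : 0 < a) (hb : 0 < b) (hz : 0 ≤ z) : 0 < kummerDeriv a b z :=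
  mul_pos (div_pos ha hb) (kummerM_pos (by linarith) (by linarith) hz)

/-- The terms of M' are those of M times (a + n)/(b + n), which lies between 1 and a/b. Termwise
comparison gives this bound and the next two. -/
lemma kummerDeriv_le (ha : 0 < a) (hab : a ≤ b) (hz : 0 ≤ z) :
    kummerDeriv a b z ≤ kummerM a b z := by
  have hb := ha.trans_le hab
  refine hasSum_le (fun n => ?_) (hasSum_kummerDeriv ha hb z) (hasSum_kummerM ha hb z)
  refine mul_le_mul_of_nonneg_right (mul_le_of_le_one_right (kummerCoeff_pos ha hb n).le ?_)
    (pow_nonneg hz n)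
  exact (div_le_one (by positivity)).2 (by linarith)

lemma le_kummerDeriv (hb : 0 < b) (hba : b ≤ a) (hz : 0 ≤ z) :
    kummerM a b z ≤ kummerDeriv a b z := by
  have ha := hb.trans_le hba
  refine hasSum_le (fun n => ?_) (hasSum_kummerM ha hb z) (hasSum_kummerDeriv ha hb z)
  refine mul_le_mul_of_nonneg_right (le_mul_of_one_le_right (kummerCoeff_pos ha hb n).le ?_)
    (pow_nonneg hz n)
  exact (one_le_div (by positivity)).2 (by linarith)

lemma kummerDeriv_le_mul (hb : 0 < b) (hba : b ≤ a) (hz : 0 ≤ z) :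
    kummerDeriv a b z ≤ a / b * kummerM a b z := by
  have ha := hb.trans_le hba
  refine hasSum_le (fun n => ?_) (hasSum_kummerDeriv ha hb z)
    ((hasSum_kummerM ha hb z).mul_left (a / b))
  rw [← mul_assoc, mul_comm (a / b)]
  refine mul_le_mul_of_nonneg_right (mul_le_mul_of_nonneg_left ?_ (kummerCoeff_pos ha hb n).le)
    (pow_nonneg hz n)
  rw [div_le_div_iff₀ (by positivity) hb]
  nlinarith [mul_nonneg (Nat.cast_nonneg (α := ℝ) n) (sub_nonneg.2 hba)]

lemma kummerM_self (ha : 0 < a) (z : ℝ) : kummerM a a z = Real.exp z := by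
  rw [Real.exp_eq_exp_ℝ, NormedSpace.exp_eq_tsum_div]
  refine tsum_congr fun n => ?_
  rw [div_self (ascPochhammer_pos n a ha).ne', one_mul]

/-- The logarithmic derivative of Kummer's function. -/
def kummerLogDeriv (a b z : ℝ) : ℝ := kummerDeriv a b z / kummerM a b z

/-- The Riccati equation of M'/M has the instantaneous equilibria 1 − t₀ > 0, which attracts, and 1
− t₁ < 0. -/
lemma hasDerivAt_kummerLogDeriv (ha : 0 < a) (hb : 0 < b) (hz : 0 < z) :
    HasDerivAt (kummerLogDeriv a b) (-((kummerLogDeriv a b z - (1 - t0 (a / z) (b / z))) *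
      (kummerLogDeriv a b z - (1 - t1 (a / z) (b / z))))) z := by
  have hM := (kummerM_pos ha hb hz.le).ne'
  refine ((hasDerivAt_kummerDeriv ha hb hz).fun_div (hasDerivAt_kummerM ha hb z) hM).congr_deriv ?_
  have h1 := one_sub_t0_mul (β := b / z) (div_pos ha hz)
  have h2 := t0_add_t1 (a / z) (b / z)
  generalize t0 _ _ = p at *
  generalize t1 _ _ = q at *
  rw [kummerLogDeriv, ← h1, show b / z = p + q - 1 by linarith]
  field_simp
  ring

/-- The exponential factor of the expansion. -/
def expFactor (a b z : ℝ) : ℝ := Real.exp (z - z * expA (a / z) (b / z)) * z ^ (a - b)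

lemma expFactor_pos (hz : 0 < z) : 0 < expFactor a b z :=
  mul_pos (Real.exp_pos _) (Real.rpow_pos_of_pos hz _)

/-- The logarithmic derivative is the attracting equilibrium, so this is the exponential part of a
WKB solution of Kummer's equation. -/
lemma hasDerivAt_expFactor (ha : 0 < a) (hz : 0 < z) :
    HasDerivAt (expFactor a b) ((1 - t0 (a / z) (b / z)) * expFactor a b z) z := by
  refine (((hasDerivAt_id z).fun_sub (hasDerivAt_mul_expA (b := b) ha hz)).exp.fun_mul
    (Real.hasDerivAt_rpow_const (p := a - b) (.inl hz.ne'))).congr_deriv ?_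
  rw [expFactor, Real.rpow_sub_one hz.ne', mu]
  simp only [id]
  field_simp
  ring

end Kummer

/-! ### A lower bound for M'/M when a ≤ b. -/

section LowerBound

variable {a b z a₀ : ℝ}

/-- The inequality says that c(1 − t₀) is a subsolution of the Riccati equation. It must hold for
all z > 0; writing 1/z = (1 − t₀)(t₁ − 1)/a turns small z harmless, at the price of c ≤ a/2. -/
lemma barrier_le {c : ℝ} (ha : 0 < a) (hz : 0 < z) (hab : a ≤ b) (hc0 : 0 ≤ c) (hc : c ≤ 1 / 2)
    (hca : c ≤ a / 2) :
    c * (t0 (a / z) (b / z) * (1 - t0 (a / z) (b / z)) / (z * gap (a / z) (b / z))) ≤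
      (1 - t0 (a / z) (b / z)) * (1 - c) * (c * (1 - t0 (a / z) (b / z)) +
        (t1 (a / z) (b / z) - 1)) := by
  have hα := div_pos ha hz
  have h1 := one_sub_t0_mul (β := b / z) hα
  have h2 := t1_sub_t0 (a / z) (b / z)
  have h3 := t0_nonneg hα (div_le_div_of_nonneg_right hab hz.le)
  have h4 := t0_lt_one (β := b / z) hα
  have h5 := one_lt_t1 (β := b / z) hα
  rw [← h2]
  have hz' : 1 / z = (1 - t0 (a / z) (b / z)) * (t1 (a / z) (b / z) - 1) / a := by
    rw [h1]; field_simp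
  generalize t0 (a / z) (b / z) = p at *
  generalize t1 (a / z) (b / z) = q at *
  have hqp : 0 < q - p := by linarith
  have e1 : c * (p * (1 - p) / (z * (q - p))) =
      (1 - p) * ((c * p / a) * ((q - 1) * ((1 - p) / (q - p)))) := by
    have : c * (p * (1 - p) / (z * (q - p))) = c * (p * (1 - p) / (q - p)) * (1 / z) := by
      field_simp
    rw [this, hz']; field_simp
  rw [e1, mul_assoc]
  refine mul_le_mul_of_nonneg_left ?_ (by linarith)
  have e2 : c * p / a ≤ 1 / 2 := by
    rw [div_le_iff₀ ha]; nlinarith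
  have e3 : (1 - p) / (q - p) ≤ 1 := (div_le_one hqp).2 (by linarith)
  have e4 : 0 ≤ (1 - p) / (q - p) := div_nonneg (by linarith) hqp.le
  calc (c * p / a) * ((q - 1) * ((1 - p) / (q - p))) ≤ 1 / 2 * ((q - 1) * 1) := by
        gcongr
    _ ≤ (1 - c) * (c * (1 - p) + (q - 1)) := by
        refine mul_le_mul (by linarith) ?_ (by linarith) (by linarith)
        nlinarith

/-- Lower bound for the logarithmic derivative, by comparison with a subsolution of the Riccati
equation. -/
lemma mul_one_sub_t0_le_kummerLogDeriv {c : ℝ} (ha : 0 < a) (hz : 0 < z) (hab : a ≤ b)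
    (hc0 : 0 ≤ c) (hc : c ≤ 1 / 2) (hca : c ≤ a / 2) :
    c * (1 - t0 (a / z) (b / z)) ≤ kummerLogDeriv a b z := by
  have hb := ha.trans_le hab
  set G : ℝ → ℝ := fun x =>
    kummerDeriv a b x - c * (1 - t0 (a / x) (b / x)) * kummerM a b x with hG
  -- w is an integrating factor for the linear inequality satisfied by G, so wG is monotone. Its
  -- factor x^b makes the lower bound for wG tend to 0 at the origin, hence wG ≥ 0.
  set w : ℝ → ℝ := fun x => x ^ b * Real.exp (-x) * expFactor a b x ^ c with hw
  have hw0 : ∀ x, 0 < x → 0 < w x := fun x hx =>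
    mul_pos (mul_pos (Real.rpow_pos_of_pos hx _) (Real.exp_pos _))
      (Real.rpow_pos_of_pos (expFactor_pos hx) _)
  have hwd : ∀ x, 0 < x → HasDerivAt w ((b / x - 1 + c * (1 - t0 (a / x) (b / x))) * w x) x := by
    intro x hx
    have hP := (expFactor_pos (a := a) (b := b) hx).ne'
    refine (((Real.hasDerivAt_rpow_const (p := b) (.inl hx.ne')).fun_mul
      (hasDerivAt_neg x).exp).fun_mul ((hasDerivAt_expFactor (b := b) ha hx).rpow_const
        (p := c) (.inl hP))).congr_deriv ?_
    simp only [hw]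
    rw [Real.rpow_sub_one hx.ne', Real.rpow_sub_one hP]
    field_simp
    ring
  have hGd : ∀ x, 0 < x → HasDerivAt G ((1 - b / x - c * (1 - t0 (a / x) (b / x))) * G x +
      kummerM a b x * ((1 - t0 (a / x) (b / x)) * (1 - c) * (c * (1 - t0 (a / x) (b / x)) +
        (t1 (a / x) (b / x) - 1)) -
        c * (t0 (a / x) (b / x) * (1 - t0 (a / x) (b / x)) / (x * gap (a / x) (b / x))))) x := by
    intro x hx
    refine ((hasDerivAt_kummerDeriv ha hb hx).fun_sub
      ((((hasDerivAt_const x (1 : ℝ)).fun_sub (hasDerivAt_t0 (b := b) ha hx)).const_mul c).fun_mul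
        (hasDerivAt_kummerM ha hb x))).congr_deriv ?_
    have h1 := one_sub_t0_mul (β := b / x) (div_pos ha hx)
    have h2 := t0_add_t1 (a / x) (b / x)
    simp only [hG]
    generalize t0 _ _ = p at *
    generalize t1 _ _ = q at *
    rw [← h1, show b / x = p + q - 1 by linarith]
    ring
  have hmono : MonotoneOn (fun x => w x * G x) (Set.Ioi 0) := by
    refine monotoneOn_of_hasDerivWithinAt_nonneg (convex_Ioi 0)
      (fun x hx => ((hwd x hx).fun_mul (hGd x hx)).continuousAt.continuousWithinAt)
      (fun x hx => ((hwd x (interior_subset hx)).fun_mul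
        (hGd x (interior_subset hx))).hasDerivWithinAt) fun x hx => ?_
    have hx0 : 0 < x := interior_subset hx
    have h1 := barrier_le ha hx0 hab hc0 hc hca
    have h2 := mul_nonneg (hw0 x hx0).le (mul_nonneg (kummerM_pos ha hb hx0.le).le
      (sub_nonneg.2 h1))
    refine h2.trans_eq ?_
    ring
  have hPmono : MonotoneOn (expFactor a b) (Set.Ioi 0) := by
    refine monotoneOn_of_hasDerivWithinAt_nonneg (convex_Ioi 0)
      (fun x hx => (hasDerivAt_expFactor ha hx).continuousAt.continuousWithinAt)
      (fun x hx => (hasDerivAt_expFactor ha (interior_subset hx)).hasDerivWithinAt) fun x hx => ?_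
    have hx0 : 0 < x := interior_subset hx
    exact mul_nonneg (sub_nonneg.2 (t0_lt_one (div_pos ha hx0)).le) (expFactor_pos hx0).le
  have hG1 : ∀ x, 0 < x → -(c * kummerM a b x) ≤ G x := by
    intro x hx
    have h1 := (kummerDeriv_pos ha hb hx.le).le
    have h2 := t0_nonneg (div_pos ha hx) (div_le_div_of_nonneg_right hab hx.le)
    have h3 := mul_nonneg hc0 (mul_nonneg h2 (kummerM_pos ha hb hx.le).le)
    simp only [hG]
    linarith
  have hlow : ∀ x, 0 < x → x ≤ 1 →
      -(x ^ b * 1 * expFactor a b 1 ^ c * (c * kummerM a b x)) ≤ w x * G x := by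
    intro x hx hx1
    have h0 : 0 ≤ c * kummerM a b x := mul_nonneg hc0 (kummerM_pos ha hb hx.le).le
    have h1 : w x ≤ x ^ b * 1 * expFactor a b 1 ^ c := by
      have hxb := (Real.rpow_pos_of_pos hx b).le
      refine mul_le_mul (mul_le_mul_of_nonneg_left (Real.exp_le_one_iff.2 (by linarith)) hxb)
        (Real.rpow_le_rpow (expFactor_pos hx).le (hPmono hx (Set.mem_Ioi.2 one_pos) hx1) hc0)
        (Real.rpow_nonneg (expFactor_pos hx).le _) (by linarith)
    have h2 := mul_le_mul_of_nonneg_left (hG1 x hx) (hw0 x hx).le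
    have h3 := mul_le_mul_of_nonneg_right h1 h0
    linarith
  have hlim : Tendsto (fun x : ℝ => -(x ^ b * 1 * expFactor a b 1 ^ c * (c * kummerM a b x)))
      (𝓝[>] 0) (𝓝 0) := by
    have h1 : Tendsto (fun x : ℝ => x ^ b) (𝓝[>] 0) (𝓝 0) := by
      have := (Real.continuousAt_rpow_const 0 b (.inr hb.le)).tendsto
      rw [Real.zero_rpow hb.ne'] at this
      exact this.mono_left nhdsWithin_le_nhds
    have h2 := ((hasDerivAt_kummerM ha hb 0).continuousAt.tendsto.mono_left
      (nhdsWithin_le_nhds (s := Set.Ioi 0)))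
    have := (((h1.mul_const 1).mul_const (expFactor a b 1 ^ c)).mul (h2.const_mul c)).neg
    simpa using this
  have hnonneg : 0 ≤ w z * G z := by
    refine le_of_tendsto hlim ?_
    have hev : Set.Ioo (0 : ℝ) (min 1 z) ∈ 𝓝[>] (0 : ℝ) :=
      Ioo_mem_nhdsGT (lt_min one_pos hz)
    filter_upwards [hev] with x hx
    exact (hlow x hx.1 (hx.2.le.trans (min_le_left _ _))).trans
      (hmono hx.1 hz (hx.2.le.trans (min_le_right _ _)))
  have hGz := nonneg_of_mul_nonneg_right hnonneg (hw0 z hz)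
  rw [kummerLogDeriv, le_div_iff₀ (kummerM_pos ha hb hz.le)]
  exact sub_nonneg.1 hGz

end LowerBound

end KummerExpansion
end

noncomputable section

namespace KummerExpansion

open Filter Topology

/-! ### The truncated expansion and its residual. -/

section PartialSums

/-- The partial sums of the expansion, including the leading factor. -/
def expSum (a b : ℝ) (N : ℕ) (z : ℝ) : ℝ := ∑ n ∈ Finset.range N, expTerm a b n z

/-- The `z`-derivative of the partial sums. -/
def expSumDeriv (a b : ℝ) (N : ℕ) (z : ℝ) : ℝ := ∑ n ∈ Finset.range N, -auxTerm a b (n + 1) z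

/-- The difference between the logarithmic derivative of Kummer's function and that of the
expansion with `N` terms. -/
def logDiff (a b : ℝ) (N : ℕ) (z : ℝ) : ℝ :=
  kummerLogDeriv a b z - (1 - t0 (a / z) (b / z)) - expSumDeriv a b N z / expSum a b N z

variable {a b z : ℝ}

lemma hasDerivAt_expSum (ha : 0 < a) (hab : a ≠ b) (hz : 0 < z) (N : ℕ) :
    HasDerivAt (expSum a b N) (expSumDeriv a b N z) z := by
  have := HasDerivAt.fun_sum (u := Finset.range N)
    (fun n _ => hasDerivAt_expTerm (n := n) ha hab hz)
  exact this

lemma hasDerivAt_expSumDeriv (ha : 0 < a) (hab : a ≠ b) (hz : 0 < z) (N : ℕ) :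
    HasDerivAt (expSumDeriv a b N) (∑ n ∈ Finset.range N, expTermSnd a b n z) z := by
  have := HasDerivAt.fun_sum (u := Finset.range N)
    (fun n _ => hasDerivAt_neg_auxTerm (n := n) ha hab hz)
  exact this

/-- The residual of the partial sums in the differential equation. -/
lemma expSum_residual (ha : 0 < a) (hab : a ≠ b) (hz : 0 < z) (N : ℕ) :
    ∑ n ∈ Finset.range (N + 1), expTermSnd a b n z +
      gap (a / z) (b / z) * expSumDeriv a b (N + 1) z +
      t0 (a / z) (b / z) * (1 - t0 (a / z) (b / z)) / (z * gap (a / z) (b / z)) *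
        expSum a b (N + 1) z = expTermSnd a b N z := by
  induction N with
  | zero =>
    simp only [expSumDeriv, expSum, zero_add, Finset.range_one, Finset.sum_singleton]
    linear_combination -gap_mul_auxTerm_one ha hab hz
  | succ N ih =>
    have h1 : expSum a b (N + 1 + 1) z = expSum a b (N + 1) z + expTerm a b (N + 1) z :=
      Finset.sum_range_succ _ _
    have h2 : expSumDeriv a b (N + 1 + 1) z = expSumDeriv a b (N + 1) z + -auxTerm a b (N + 2) z :=
      Finset.sum_range_succ _ _
    have h3 : expTermSnd a b N z = -(t0 (a / z) (b / z) * (1 - t0 (a / z) (b / z)) /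
      (z * gap (a / z) (b / z)) * expTerm a b (N + 1) z) +
        gap (a / z) (b / z) * auxTerm a b (N + 2) z := rfl
    rw [Finset.sum_range_succ, h1, h2]
    linear_combination ih + h3

/-- Subtracting two Riccati equations gives an equation linear in the difference, with the sum of
the two solutions in the rate. The forcing is the residual of the truncated sum. -/
lemma hasDerivAt_logDiff (ha : 0 < a) (hb : 0 < b) (hab : a ≠ b) (hz : 0 < z) (N : ℕ)
    (hS : expSum a b (N + 1) z ≠ 0) :
    HasDerivAt (logDiff a b (N + 1))
      (-(kummerLogDeriv a b z + (t1 (a / z) (b / z) - 1) +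
        expSumDeriv a b (N + 1) z / expSum a b (N + 1) z) * logDiff a b (N + 1) z -
        expTermSnd a b N z / expSum a b (N + 1) z) z := by
  refine (((hasDerivAt_kummerLogDeriv ha hb hz).fun_sub
    ((hasDerivAt_const z (1 : ℝ)).fun_sub (hasDerivAt_t0 (b := b) ha hz))).fun_sub
    ((hasDerivAt_expSumDeriv ha hab hz (N + 1)).fun_div (hasDerivAt_expSum ha hab hz (N + 1))
      hS)).congr_deriv ?_
  have hr := expSum_residual ha hab hz N
  rw [logDiff]
  rw [← t1_sub_t0] at hr ⊢
  rw [← hr]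
  have hg : t1 (a / z) (b / z) - t0 (a / z) (b / z) ≠ 0 := by
    rw [t1_sub_t0]; exact (gap_pos (div_pos ha hz)).ne'
  generalize t0 (a / z) (b / z) = p at *
  generalize t1 (a / z) (b / z) = q at *
  field_simp
  ring

lemma expSum_div_sub_one_le (K : ℝ) (N : ℕ) : ∃ C, ∀ a b z, InRegion K a b z → 1 ≤ z →
    |expSum a b (N + 1) z / expTerm a b 0 z - 1| ≤ C / z := by
  induction N with
  | zero =>
    refine ⟨0, fun a b z hz _ => ?_⟩
    have h0 := (expTerm_zero_pos hz.1 hz.2.1 hz.pos).ne'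
    simp [expSum, div_self h0]
  | succ N ih =>
    obtain ⟨C, hC⟩ := ih
    obtain ⟨D, hD⟩ := (symbolBound_expTerm K (N + 1) 0).1.bound
    refine ⟨C + |D|, fun a b z hz h1 => ?_⟩
    have h2 : expSum a b (N + 1 + 1) z / expTerm a b 0 z - 1 =
        (expSum a b (N + 1) z / expTerm a b 0 z - 1) +
          expTerm a b (N + 1) z / expTerm a b 0 z := by
      rw [expSum, Finset.sum_range_succ, ← expSum, add_div]; ring
    rw [h2, add_div]
    refine (abs_add_le _ _).trans (add_le_add (hC a b z hz h1) ((hD a b z hz).trans ?_))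
    refine (div_le_div_of_nonneg_right (le_abs_self D) (pow_nonneg hz.pos.le _)).trans ?_
    exact div_le_div_of_nonneg_left (abs_nonneg D) hz.pos (le_self_pow₀ h1 (by omega))

lemma expSumDeriv_div_le (K : ℝ) (N : ℕ) : ∃ C, ∀ a b z, InRegion K a b z → 1 ≤ z →
    |expSumDeriv a b N z / expTerm a b 0 z| ≤ C / z := by
  induction N with
  | zero => exact ⟨0, fun a b z hz _ => by simp [expSumDeriv]⟩
  | succ N ih =>
    obtain ⟨C, hC⟩ := ih
    obtain ⟨D, hD⟩ := (symbolBound_expTerm K N 0).2.1.bound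
    refine ⟨C + |D|, fun a b z hz h1 => ?_⟩
    rw [expSumDeriv, Finset.sum_range_succ, ← expSumDeriv, add_div, add_div]
    refine (abs_add_le _ _).trans (add_le_add (hC a b z hz h1) ((hD a b z hz).trans ?_))
    refine (div_le_div_of_nonneg_right (le_abs_self D) (pow_nonneg hz.pos.le _)).trans ?_
    exact div_le_div_of_nonneg_left (abs_nonneg D) hz.pos (le_self_pow₀ h1 (by omega))

lemma expSum_bounds (K : ℝ) (N : ℕ) : ∃ C z₁, 0 < C ∧ 1 ≤ z₁ ∧ ∀ a b z, InRegion K a b z →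
    z₁ ≤ z → expTerm a b 0 z / 2 ≤ expSum a b (N + 1) z ∧
      expSum a b (N + 1) z ≤ 2 * expTerm a b 0 z ∧
      |expSumDeriv a b (N + 1) z / expSum a b (N + 1) z| ≤ C / z ∧
      |expTermSnd a b N z / expSum a b (N + 1) z| ≤ C / z ^ (N + 2) := by
  obtain ⟨C1, h1⟩ := expSum_div_sub_one_le K N
  obtain ⟨C2, h2⟩ := expSumDeriv_div_le K (N + 1)
  obtain ⟨C3, h3⟩ := (symbolBound_expTerm K N 0).2.2.bound
  -- For z ≥ 2|C1| + 1 the sum lies within E₀/2 of E₀, so division by the sum instead of E₀ costs a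
  -- factor 2.
  refine ⟨2 * |C2| + 2 * |C3| + 1, 2 * |C1| + 1, by positivity, by linarith [abs_nonneg C1],
    fun a b z hz hz1 => ?_⟩
  have hz0 := hz.pos
  have hF := expTerm_zero_pos hz.1 hz.2.1 hz0
  have hz2 : 1 ≤ z := by linarith [abs_nonneg C1]
  have e1 := h1 a b z hz hz2
  have e2 := h2 a b z hz hz2
  have e3 := h3 a b z hz
  have e4 : C1 / z ≤ 1 / 2 := by
    rw [div_le_iff₀ hz0]; linarith [le_abs_self C1]
  have e5 := abs_le.1 (e1.trans e4)
  have hS : expTerm a b 0 z / 2 ≤ expSum a b (N + 1) z := by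
    have : 1 / 2 ≤ expSum a b (N + 1) z / expTerm a b 0 z := by linarith [e5.1]
    rw [le_div_iff₀ hF] at this
    linarith
  have hS' : expSum a b (N + 1) z ≤ 2 * expTerm a b 0 z := by
    have : expSum a b (N + 1) z / expTerm a b 0 z ≤ 2 := by linarith [e5.2]
    rwa [div_le_iff₀ hF] at this
  have hSpos : 0 < expSum a b (N + 1) z := by linarith
  have hconv : ∀ y : ℝ, |y / expSum a b (N + 1) z| ≤ 2 * |y / expTerm a b 0 z| := by
    intro y
    rw [abs_div, abs_div, abs_of_pos hSpos, abs_of_pos hF, div_le_iff₀ hSpos]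
    have h6 : |y| = |y| / expTerm a b 0 z * expTerm a b 0 z := by field_simp
    have h7 : 0 ≤ |y| / expTerm a b 0 z := by positivity
    calc |y| = |y| / expTerm a b 0 z * expTerm a b 0 z := h6
      _ ≤ |y| / expTerm a b 0 z * (2 * expSum a b (N + 1) z) := by gcongr; linarith
      _ = _ := by ring
  refine ⟨hS, hS', (hconv _).trans ?_, (hconv _).trans ?_⟩
  · refine (mul_le_mul_of_nonneg_left e2 zero_le_two).trans ?_
    rw [← mul_div_assoc]
    gcongr
    linarith [le_abs_self C2, abs_nonneg C3]
  · refine (mul_le_mul_of_nonneg_left e3 zero_le_two).trans ?_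
    rw [← mul_div_assoc]
    gcongr
    linarith [le_abs_self C3, abs_nonneg C2]

end PartialSums

/-! ### Damped linear differential inequalities. -/

section Gronwall

lemma le_of_damped {e r η : ℝ → ℝ} {x₀ x₁ r₀ H : ℝ} (h01 : x₀ ≤ x₁) (hr0 : 0 < r₀)
    (hd : ∀ x ∈ Set.Icc x₀ x₁, HasDerivAt e (-(r x) * e x - η x) x)
    (hr : ∀ x ∈ Set.Icc x₀ x₁, r₀ ≤ r x) (hη : ∀ x ∈ Set.Icc x₀ x₁, |η x| ≤ H) :
    e x₁ ≤ |e x₀| * Real.exp (-(r₀ * (x₁ - x₀))) + H / r₀ := by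
  have hH : 0 ≤ H := (abs_nonneg _).trans (hη x₀ ⟨le_rfl, h01⟩)
  refine le_of_forall_pos_le_add fun ε hε => ?_
  -- The extra term r₀ε makes the derivative inequality at a contact point with the comparison
  -- function B strict; ε is arbitrary at the end.
  have hε' : 0 < r₀ * ε := mul_pos hr0 hε
  set B : ℝ → ℝ := fun x => |e x₀| * Real.exp (-(r₀ * (x - x₀))) + (H + r₀ * ε) / r₀ with hB
  have hBd : ∀ x, HasDerivAt B (-(r₀ * B x) + (H + r₀ * ε)) x := by
    intro x
    refine ((((((hasDerivAt_id x).fun_sub (hasDerivAt_const x x₀)).const_mul r₀).fun_neg.exp).const_mul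
      |e x₀|).add_const ((H + r₀ * ε) / r₀)).congr_deriv ?_
    simp only [hB, id]
    field_simp
    ring
  have hBpos : ∀ x, 0 < B x := fun x => by
    simp only [hB]
    have : 0 < (H + r₀ * ε) / r₀ := by positivity
    positivity
  have key := image_le_of_deriv_right_lt_deriv_boundary' (f := e) (f' := fun x => -(r x) * e x - η x)
    (a := x₀) (b := x₁) (B := B) (B' := fun x => -(r₀ * B x) + (H + r₀ * ε))
    (fun x hx => (hd x hx).continuousAt.continuousWithinAt)
    (fun x hx => (hd x (Set.Ico_subset_Icc_self hx)).hasDerivWithinAt)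
    (by
      simp only [hB, sub_self, mul_zero, neg_zero, Real.exp_zero, mul_one]
      have : 0 < (H + r₀ * ε) / r₀ := by positivity
      linarith [le_abs_self (e x₀)])
    (fun x _ => (hBd x).continuousAt.continuousWithinAt)
    (fun x _ => (hBd x).hasDerivWithinAt)
    (fun x hx hx2 => by
      have h1 := hr x (Set.Ico_subset_Icc_self hx)
      have h2 := (abs_le.1 (hη x (Set.Ico_subset_Icc_self hx))).1
      have h3 := mul_le_mul_of_nonneg_right h1 (hBpos x).le
      rw [hx2]
      linarith) (Set.right_mem_Icc.2 h01)
  refine key.trans_eq ?_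
  simp only [hB]
  field_simp
  ring

lemma abs_le_of_damped {e r η : ℝ → ℝ} {x₀ x₁ r₀ H : ℝ} (h01 : x₀ ≤ x₁) (hr0 : 0 < r₀)
    (hd : ∀ x ∈ Set.Icc x₀ x₁, HasDerivAt e (-(r x) * e x - η x) x)
    (hr : ∀ x ∈ Set.Icc x₀ x₁, r₀ ≤ r x) (hη : ∀ x ∈ Set.Icc x₀ x₁, |η x| ≤ H) :
    |e x₁| ≤ |e x₀| * Real.exp (-(r₀ * (x₁ - x₀))) + H / r₀ := by
  refine abs_le'.2 ⟨le_of_damped h01 hr0 hd hr hη, ?_⟩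
  have := le_of_damped (e := fun x => -e x) (η := fun x => -η x) h01 hr0
    (fun x hx => ((hd x hx).fun_neg).congr_deriv (by ring)) hr
    (fun x hx => by rw [abs_neg]; exact hη x hx)
  rwa [abs_neg] at this

end Gronwall

/-! ### Comparison of the logarithmic derivatives. -/

section Comparison

/-- The logarithmic derivatives of Kummer's function and of the expansion approach each other,
as long as the linearised Riccati equation is sufficiently damped on `[qz, z]`. -/
lemma abs_logDiff_le (K : ℝ) (N : ℕ) {c q D : ℝ} (hc : 0 < c) (hq0 : 0 < q) (hq1 : q < 1)
    (hD : 0 ≤ D) : ∃ C z₁, 1 ≤ z₁ ∧ ∀ a b z s, 0 < b → z₁ ≤ z → 1 ≤ s → InRegion K a b (q * z) →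
      (∀ x, q * z ≤ x → x ≤ z → c * s ≤ kummerLogDeriv a b x + (t1 (a / x) (b / x) - 1)) →
      |kummerLogDeriv a b (q * z) - (1 - t0 (a / (q * z)) (b / (q * z)))| ≤ D * z * s ^ 2 →
      |logDiff a b (N + 1) z| ≤ C / z ^ (N + 2) := by
  obtain ⟨C1, z0, hC1, hz0, hest⟩ := expSum_bounds K N
  -- Half of the rate cs survives after subtracting the O(1/z) term; over a window of length (1 −
  -- q)z this gives the damping factor exp(−θsz). The parameter s ≥ 1 tracks large values of a/z.
  set θ := c / 2 * (1 - q) with hθ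
  have hθ0 : 0 < θ := mul_pos (by linarith) (by linarith)
  refine ⟨(D + c) * ((N + 3).factorial / θ ^ (N + 3)) + C1 / q ^ (N + 2) / (c / 2),
    max 1 (max (z0 / q) (C1 / q / (c / 2))), le_max_left _ _,
    fun a b z s hb hz hs hR hrate hinit => ?_⟩
  have hz1 : 1 ≤ z := (le_max_left _ _).trans hz
  have hzz0 : z0 ≤ q * z := by
    have := ((le_max_left _ _).trans (le_max_right _ _)).trans hz
    rw [div_le_iff₀ hq0] at this; linarith
  have hzC : C1 / (q * z) ≤ c / 2 := by
    have := ((le_max_right _ _).trans (le_max_right _ _)).trans hz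
    have hcc : 0 < c / 2 := by linarith
    rw [div_le_iff₀ hcc, div_le_iff₀ hq0] at this
    rw [div_le_iff₀ (by positivity)]
    linarith
  have hz00 : 0 < z := by linarith
  have hqz : 0 < q * z := by positivity
  have hqz1 : q * z ≤ z := by nlinarith
  have hreg : ∀ x, q * z ≤ x → InRegion K a b x := fun x hx => hR.mono hx
  have hS : ∀ x, q * z ≤ x → 0 < expSum a b (N + 1) x := fun x hx => by
    have h1 := (hest a b x (hreg x hx) (hzz0.trans hx)).1
    have h2 := expTerm_zero_pos hR.1 hR.2.1 (hqz.trans_le hx)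
    linarith
  have hL : ∀ x, q * z ≤ x →
      |expSumDeriv a b (N + 1) x / expSum a b (N + 1) x| ≤ c / 2 := fun x hx => by
    refine ((hest a b x (hreg x hx) (hzz0.trans hx)).2.2.1.trans ?_).trans hzC
    exact div_le_div_of_nonneg_left hC1.le hqz hx
  have hr0 : 0 < c / 2 * s := by positivity
  have key := abs_le_of_damped (e := logDiff a b (N + 1))
    (r := fun x => kummerLogDeriv a b x + (t1 (a / x) (b / x) - 1) +
        expSumDeriv a b (N + 1) x / expSum a b (N + 1) x)
    (η := fun x => expTermSnd a b N x / expSum a b (N + 1) x)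
    (H := C1 / (q * z) ^ (N + 2)) hqz1 hr0
    (fun x hx => hasDerivAt_logDiff hR.1 hb hR.2.1 (hqz.trans_le hx.1) N (hS x hx.1).ne')
    (fun x hx => by
      have h1 := (abs_le.1 (hL x hx.1)).1
      have h2 := hrate x hx.1 hx.2
      have h3 : c / 2 ≤ c / 2 * s := le_mul_of_one_le_right (by linarith) hs
      linarith)
    (fun x hx => ((hest a b x (hreg x hx.1) (hzz0.trans hx.1)).2.2.2).trans
      (div_le_div_of_nonneg_left hC1.le (by positivity) (pow_le_pow_left₀ hqz.le hx.1 _)))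
  refine key.trans ?_
  rw [add_div]
  have hs0 : 0 < s := by linarith
  refine add_le_add ?_ ?_
  · have h1 : |logDiff a b (N + 1) (q * z)| ≤ (D + c) * (z * s ^ 2) := by
      rw [logDiff]
      refine (abs_sub _ _).trans ((add_le_add hinit (hL _ le_rfl)).trans ?_)
      have : 1 ≤ z * s ^ 2 := one_le_mul_of_one_le_of_one_le hz1 (one_le_pow₀ hs)
      nlinarith
    -- From xᵏ/k! ≤ eˣ with k = N + 3: this power beats the initial error of order zs² and leaves
    -- z^(−N−2).
    have h2 : Real.exp (-(c / 2 * s * (z - q * z))) ≤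
        (N + 3).factorial / (θ * s * z) ^ (N + 3) := by
      rw [show c / 2 * s * (z - q * z) = θ * s * z by rw [hθ]; ring, Real.exp_neg]
      have := Real.pow_div_factorial_le_exp (θ * s * z) (by positivity) (N + 3)
      refine (inv_anti₀ (by positivity) this).trans_eq ?_
      rw [inv_div]
    refine (mul_le_mul h1 h2 (Real.exp_pos _).le (by positivity)).trans ?_
    have h3 : (D + c) * (z * s ^ 2) * ((N + 3).factorial / (θ * s * z) ^ (N + 3)) =
        (D + c) * ((N + 3).factorial / θ ^ (N + 3)) / z ^ (N + 2) / s ^ (N + 1) := by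
      field_simp
      ring_nf
    rw [h3]
    exact div_le_self (by positivity) (one_le_pow₀ hs)
  · rw [mul_pow]
    calc C1 / (q ^ (N + 2) * z ^ (N + 2)) / (c / 2 * s) ≤
        C1 / (q ^ (N + 2) * z ^ (N + 2)) / (c / 2) := by
          refine div_le_div_of_nonneg_left (by positivity) (by positivity) ?_
          exact le_mul_of_one_le_right (by positivity) hs
      _ = C1 / q ^ (N + 2) / (c / 2) / z ^ (N + 2) := by field_simp

end Comparison

/-! ### The two parameter ranges. -/

section Regions

variable {a b z : ℝ}

/-- The saddle equation in the form zt₀ = (b − a) − a·t₀/(1 − t₀), cleared of denominators; at fixed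
a and b the right side decreases in t₀. -/
lemma ray_relation (ha : 0 < a) (hz : 0 < z) :
    z * t0 (a / z) (b / z) * (1 - t0 (a / z) (b / z)) =
      (b - a) * (1 - t0 (a / z) (b / z)) - a * t0 (a / z) (b / z) := by
  have h1 := one_sub_t0_mul (β := b / z) (div_pos ha hz)
  have h2 := t0_add_t1 (a / z) (b / z)
  have h3 : a = z * ((1 - t0 (a / z) (b / z)) * (t1 (a / z) (b / z) - 1)) := by
    rw [h1]; field_simp
  have h4 : b = z * (t0 (a / z) (b / z) + t1 (a / z) (b / z) - 1) := by
    rw [h2]; field_simp; ring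
  generalize t0 _ _ = p at *
  generalize t1 _ _ = q at *
  rw [h3, h4]; ring

/-- Along a ray, `z t₀` is an increasing function of `1 - t₀`. -/
lemma mul_t0_le_mul_t0 (ha : 0 < a) (hz : 0 < z) {x : ℝ} (hx : 0 < x)
    (h : t0 (a / z) (b / z) ≤ t0 (a / x) (b / x)) :
    x * t0 (a / x) (b / x) ≤ z * t0 (a / z) (b / z) := by
  have h1 := ray_relation (b := b) ha hz
  have h2 := ray_relation (b := b) ha hx
  have h3 := t0_lt_one (β := b / z) (div_pos ha hz)
  have h4 := t0_lt_one (β := b / x) (div_pos ha hx)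
  generalize t0 (a / z) _ = p at *
  generalize t0 (a / x) _ = q at *
  have e1 : z * p = (b - a) - a * (p / (1 - p)) := by
    have : 1 - p ≠ 0 := by linarith
    field_simp; linear_combination h1
  have e2 : x * q = (b - a) - a * (q / (1 - q)) := by
    have : 1 - q ≠ 0 := by linarith
    field_simp; linear_combination h2
  rw [e1, e2]
  have : p / (1 - p) ≤ q / (1 - q) := by
    rw [div_le_div_iff₀ (by linarith) (by linarith)]; linarith
  have := mul_le_mul_of_nonneg_left this ha.le
  linarith

/-- If t₀ exceeded ρ' at x, it would exceed its value at z, so x·t₀(x) ≤ z·t₀(z) ≤ zρ, too small for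
such an x. This leaves a window below z on which t₀ stays away from 1. -/
lemma t0_le_of_le {ρ ρ' : ℝ} (hρ : 0 < ρ) (hρ' : ρ ≤ ρ') (ha : 0 < a) (hz : 0 < z)
    (h : t0 (a / z) (b / z) ≤ ρ) {x : ℝ} (hx : ρ / ρ' * z ≤ x) : t0 (a / x) (b / x) ≤ ρ' := by
  have hρ0 : 0 < ρ' := hρ.trans_le hρ'
  have hx0 : 0 < x := lt_of_lt_of_le (by positivity) hx
  by_contra! hcon
  have h1 := mul_t0_le_mul_t0 ha hz hx0 (h.trans (hρ'.trans hcon.le))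
  have h2 : z * t0 (a / z) (b / z) ≤ z * ρ := mul_le_mul_of_nonneg_left h hz.le
  have h3 : x * ρ' < x * t0 (a / x) (b / x) := mul_lt_mul_of_pos_left hcon hx0
  rw [div_mul_eq_mul_div, div_le_iff₀ hρ0] at hx
  linarith

lemma inRegion_of_t0_nonneg {ρ w : ℝ} (ha : 0 < a) (hab : a < b) (hρ : ρ < 1) (hw : 0 < w)
    (hwz : w < z) (h : ∀ x, w ≤ x → t0 (a / x) (b / x) ≤ ρ) : InRegion (1 / (1 - ρ)) a b z := by
  refine ⟨ha, hab.ne, w, hw, hwz, fun x hx => ?_⟩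
  have hx0 := hw.trans_le hx
  have hα := div_pos ha hx0
  have h1 := t1_sub_t0 (a / x) (b / x)
  have h2 := one_lt_t1 (β := b / x) hα
  have h3 := t0_nonneg hα (div_le_div_of_nonneg_right hab.le hx0.le)
  have h4 := h x hx
  have h5 : 1 - ρ ≤ gap (a / x) (b / x) := by linarith
  have h6 : 0 < 1 - ρ := by linarith
  constructor
  · rw [abs_of_nonneg (div_nonneg h3 (by linarith))]
    exact div_le_div₀ zero_le_one (by linarith) h6 h5
  · rw [abs_of_nonneg (div_nonneg zero_le_one (by linarith))]
    exact one_div_le_one_div_of_le h6 h5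

/-- For t₀ ≤ 0 the distance t₁ − t₀ = t₁ + |t₀| exceeds both 1 and |t₀|, so no further condition on
the parameters is needed. -/
lemma inRegion_of_t0_nonpos {w : ℝ} (hb : 0 < b) (hab : b < a) (hw : 0 < w) (hwz : w < z) :
    InRegion 1 a b z := by
  have ha := hb.trans hab
  refine ⟨ha, hab.ne', w, hw, hwz, fun x hx => ?_⟩
  have hx0 := hw.trans_le hx
  have hα := div_pos ha hx0
  have h1 := t1_sub_t0 (a / x) (b / x)
  have h2 := one_lt_t1 (β := b / x) hα
  have h3 := t0_nonpos hα (div_le_div_of_nonneg_right hab.le hx0.le)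
  have h5 : 0 < gap (a / x) (b / x) := by linarith
  constructor
  · rw [abs_div, abs_of_nonpos h3, abs_of_pos h5, div_le_one h5]; linarith
  · rw [abs_of_pos (one_div_pos.2 h5), div_le_one h5]; linarith

lemma kummerLogDeriv_mem_of_le (ha : 0 < a) (hab : a ≤ b) (hz : 0 < z) :
    0 ≤ kummerLogDeriv a b z ∧ kummerLogDeriv a b z ≤ 1 := by
  have hM := kummerM_pos ha (ha.trans_le hab) hz.le
  exact ⟨div_nonneg (kummerDeriv_pos ha (ha.trans_le hab) hz.le).le hM.le,
    (div_le_one hM).2 (kummerDeriv_le ha hab hz.le)⟩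

lemma kummerLogDeriv_mem_of_ge (hb : 0 < b) (hba : b ≤ a) (hz : 0 < z) :
    1 ≤ kummerLogDeriv a b z ∧ kummerLogDeriv a b z ≤ a / b := by
  have hM := kummerM_pos (hb.trans_le hba) hb hz.le
  exact ⟨(one_le_div hM).2 (le_kummerDeriv hb hba hz.le),
    (div_le_iff₀ hM).2 (kummerDeriv_le_mul hb hba hz.le)⟩

lemma abs_logDiff_le_of_lt {a₀ ρ : ℝ} (ha₀ : 0 < a₀) (hρ0 : 0 < ρ) (hρ : ρ < 1) :
    ∃ K, ∀ N : ℕ, ∃ C z₁, 1 ≤ z₁ ∧ ∀ a b z, z₁ ≤ z → a₀ ≤ a → a < b →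
      t0 (a / z) (b / z) ≤ ρ → InRegion K a b z ∧ |logDiff a b (N + 1) z| ≤ C / z ^ (N + 2) := by
  -- ρ' is halfway between ρ and 1, so t₀ ≤ ρ' down to κz. The window starts at (1 + κ)z/2 rather
  -- than κz because the region requires a strictly smaller base point.
  set ρ' := (1 + ρ) / 2 with hρ'
  have hρ1 : ρ < ρ' := by linarith
  have hρ2 : ρ' < 1 := by linarith
  have hρ'0 : 0 < ρ' := by linarith
  set κ := ρ / ρ' with hκ
  have hκ0 : 0 < κ := div_pos hρ0 hρ'0
  have hκ1 : κ < 1 := (div_lt_one hρ'0).2 hρ1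
  set c := min (1 / 2) (a₀ / 2) with hc
  have hc0 : 0 < c := lt_min (by norm_num) (by linarith)
  have hc1 : c ≤ 1 / 2 := min_le_left _ _
  have hc2 : c ≤ a₀ / 2 := min_le_right _ _
  refine ⟨1 / (1 - ρ'), fun N => ?_⟩
  obtain ⟨C, z1, hz1, H⟩ := abs_logDiff_le (1 / (1 - ρ')) N (c := c * (1 - ρ')) (q := (1 + κ) / 2)
    (D := 1) (mul_pos hc0 (by linarith)) (by linarith) (by linarith) zero_le_one
  refine ⟨C, z1, hz1, fun a b z hz ha hab ht => ?_⟩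
  have ha0 := ha₀.trans_le ha
  have hz0 : 0 < z := by linarith
  have ht' : ∀ x, κ * z ≤ x → t0 (a / x) (b / x) ≤ ρ' := fun x hx =>
    t0_le_of_le hρ0 hρ1.le ha0 hz0 ht hx
  have hq : κ * z < (1 + κ) / 2 * z := mul_lt_mul_of_pos_right (by linarith) hz0
  have hκz : 0 < κ * z := mul_pos hκ0 hz0
  refine ⟨inRegion_of_t0_nonneg ha0 hab hρ2 hκz (by nlinarith) ht', ?_⟩
  refine H a b z 1 (ha0.trans hab) hz le_rfl
    (inRegion_of_t0_nonneg ha0 hab hρ2 hκz hq ht') (fun x hx _ => ?_) ?_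
  · have hx0 : 0 < x := (hκz.trans hq).trans_le hx
    have h1 := mul_one_sub_t0_le_kummerLogDeriv ha0 hx0 hab.le hc0.le hc1
      (hc2.trans (by linarith))
    have h2 := one_lt_t1 (β := b / x) (div_pos ha0 hx0)
    have h3 := mul_le_mul_of_nonneg_left (sub_le_sub_left (ht' x (hq.le.trans hx)) 1) hc0.le
    linarith
  · have hx0 : 0 < (1 + κ) / 2 * z := hκz.trans hq
    obtain ⟨h1, h2⟩ := kummerLogDeriv_mem_of_le ha0 hab.le hx0
    have h3 := t0_nonneg (div_pos ha0 hx0) (div_le_div_of_nonneg_right hab.le hx0.le)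
    have h4 := ht' _ hq.le
    rw [one_pow, mul_one, one_mul, abs_le]
    constructor <;> linarith

/-- Both factors of α = (1 − t₀)(t₁ − 1) are below t₁, as 1 − t₀ = t₁ − β. Thus the damping rate
grows at least like √(a/z), which gives uniformity for unbounded a. -/
lemma le_t1_sq (ha : 0 < a) (hb : 0 < b) (hz : 0 < z) : a / z ≤ t1 (a / z) (b / z) ^ 2 := by
  have hα := div_pos ha hz
  have hβ := div_pos hb hz
  have h1 := one_sub_t0_mul (β := b / z) hα
  have h2 := t0_add_t1 (a / z) (b / z)
  have h3 := one_lt_t1 (β := b / z) hα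
  nlinarith

lemma one_sub_t0_le (hb : 0 < b) (hba : b ≤ a) (hz : 0 < z) :
    1 - t0 (a / z) (b / z) ≤ 1 + a / z := by
  have ha := hb.trans_le hba
  have hα := div_pos ha hz
  have hβ := div_pos hb hz
  have h1 := t0_mul_t1 (β := b / z) hα
  have h3 := one_lt_t1 (β := b / z) hα
  have h4 := t0_nonpos hα (div_le_div_of_nonneg_right hba hz.le)
  rw [mu] at h1
  nlinarith

lemma abs_logDiff_le_of_gt {b₀ : ℝ} (hb₀ : 0 < b₀) (N : ℕ) :
    ∃ C z₁, 1 ≤ z₁ ∧ ∀ a b z, z₁ ≤ z → b₀ ≤ b → b < a →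
      |logDiff a b (N + 1) z| ≤ C / z ^ (N + 2) := by
  obtain ⟨C, z1, hz1, H⟩ := abs_logDiff_le 1 N (c := 1) (q := 3 / 4) (D := 1 / b₀ + 3)
    one_pos (by norm_num) (by norm_num) (by positivity)
  refine ⟨C, z1, hz1, fun a b z hz hb hba => ?_⟩
  have hb0 := hb₀.trans_le hb
  have ha0 := hb0.trans hba
  have hz0 : 0 < z := by linarith
  have hz2 : 1 ≤ z := by linarith
  -- Here M'/M may be as large as a/b ≤ zs²/b₀, where b₀ enters; the rate is at least t₁ ≥ s.
  set s := max 1 (Real.sqrt (a / z)) with hs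
  have hs1 : 1 ≤ s := le_max_left _ _
  have hs2 : a / z ≤ s ^ 2 := (Real.sqrt_le_left (by linarith)).1 (le_max_right _ _)
  refine H a b z s hb0 hz hs1 (inRegion_of_t0_nonpos (w := 1 / 2 * z) hb0 hba (by positivity)
    (by linarith)) (fun x hx hxz => ?_) ?_
  · have hx0 : 0 < x := lt_of_lt_of_le (by positivity) hx
    have h1 := (kummerLogDeriv_mem_of_ge hb0 hba.le hx0).1
    have h2 := one_lt_t1 (β := b / x) (div_pos ha0 hx0)
    have h3 : s ≤ t1 (a / x) (b / x) := by
      refine max_le h2.le ?_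
      rw [Real.sqrt_le_left (by linarith)]
      exact (div_le_div_of_nonneg_left ha0.le hx0 hxz).trans (le_t1_sq ha0 hb0 hx0)
    linarith
  · have hx0 : 0 < 3 / 4 * z := by positivity
    obtain ⟨h1, h2⟩ := kummerLogDeriv_mem_of_ge hb0 hba.le hx0
    have h3 := one_sub_t0_le hb0 hba.le hx0
    have h4 := t0_nonpos (div_pos ha0 hx0) (div_le_div_of_nonneg_right hba.le hx0.le)
    have e1 : a ≤ z * s ^ 2 := by
      rw [div_le_iff₀ hz0] at hs2; linarith
    have e2 : a / b ≤ 1 / b₀ * (z * s ^ 2) := by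
      rw [one_div, inv_mul_eq_div]
      exact div_le_div₀ (by positivity) e1 hb₀ hb
    have e3 : 1 ≤ s ^ 2 := one_le_pow₀ hs1
    have e4 : 1 ≤ z * s ^ 2 := one_le_mul_of_one_le_of_one_le hz2 e3
    have e5 : a / (3 / 4 * z) ≤ 4 / 3 * (z * s ^ 2) := by
      have : a / (3 / 4 * z) = 4 / 3 * (a / z) := by field_simp
      rw [this]
      have : a / z ≤ z * s ^ 2 := (div_le_self ha0.le hz2).trans e1
      linarith
    have e6 : 0 ≤ 1 / b₀ * (z * s ^ 2) := by positivity
    rw [abs_le]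
    constructor <;> nlinarith

end Regions

end KummerExpansion
end

noncomputable section

namespace KummerExpansion

open Filter Topology

/-! ### Leading behaviour for fixed a and b. -/

section FixedParameters

variable {a b z : ℝ}

lemma tendsto_zero_of_abs_le_div_pow {g : ℝ → ℝ} {C : ℝ} {n : ℕ} (hn : n ≠ 0)
    (h : ∀ᶠ z in atTop, |g z| ≤ C / z ^ n) : Tendsto g atTop (𝓝 0) := by
  refine squeeze_zero_norm' h ?_
  exact tendsto_const_nhds.div_atTop (tendsto_pow_atTop hn)

lemma exists_inRegion_abs_logDiff_le (ha : 0 < a) (hb : 0 < b) (hab : a ≠ b) :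
    ∃ K C, ∀ᶠ z in atTop, InRegion K a b z ∧ |logDiff a b 1 z| ≤ C / z ^ 2 := by
  rcases lt_or_gt_of_ne hab with h | h
  · obtain ⟨K, hK⟩ := abs_logDiff_le_of_lt ha (ρ := 1 / 2) (by norm_num) (by norm_num)
    obtain ⟨C, z1, -, H⟩ := hK 0
    refine ⟨K, C, ?_⟩
    filter_upwards [eventually_ge_atTop z1,
      (tendsto_t0 a b).eventually_le_const (by norm_num : (0 : ℝ) < 1 / 2)] with z h1 h2
    exact H a b z h1 le_rfl h h2
  · obtain ⟨C, z1, hz1, H⟩ := abs_logDiff_le_of_gt hb 0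
    refine ⟨1, C, ?_⟩
    filter_upwards [eventually_ge_atTop z1] with z h1
    exact ⟨inRegion_of_t0_nonpos (w := z / 2) hb h (by linarith) (by linarith),
      H a b z h1 le_rfl h⟩

lemma tendsto_kummerLogDeriv (ha : 0 < a) (hb : 0 < b) :
    Tendsto (kummerLogDeriv a b) atTop (𝓝 1) := by
  by_cases hab : a = b
  · subst hab
    refine tendsto_const_nhds.congr fun z => ?_
    rw [kummerLogDeriv, kummerDeriv, kummerM_self ha, kummerM_self (by linarith), div_self ha.ne',
      one_mul, div_self (Real.exp_pos z).ne']
  obtain ⟨K, C, hC⟩ := exists_inRegion_abs_logDiff_le ha hb hab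
  obtain ⟨D, z1, -, hz1, H⟩ := expSum_bounds K 0
  have h1 : Tendsto (logDiff a b 1) atTop (𝓝 0) :=
    tendsto_zero_of_abs_le_div_pow two_ne_zero (hC.mono fun z h => h.2)
  have h2 : Tendsto (fun z => expSumDeriv a b 1 z / expSum a b 1 z) atTop (𝓝 0) := by
    refine tendsto_zero_of_abs_le_div_pow (C := D) one_ne_zero ?_
    filter_upwards [hC, eventually_ge_atTop z1] with z h h'
    rw [pow_one]
    exact (H a b z h.1 h').2.2.1
  have h3 := (h1.add ((tendsto_const_nhds (x := (1 : ℝ))).sub (tendsto_t0 a b))).add h2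
  rw [zero_add, sub_zero, add_zero] at h3
  refine h3.congr fun z => ?_
  rw [logDiff]; ring

/-- The contiguous relation aM(a+1) = aM + zM' in scaled form. Its factor tends to 1, so the limit 1
passes from a to a + 1 and back. -/
lemma scaledM_succ_left (ha : 0 < a) (hb : 0 < b) (hz : 0 < z) :
    scaledM (a + 1) b z = scaledM a b z * (a / z + kummerLogDeriv a b z) := by
  have h := kummerM_succ_left ha hb z
  have hM := (kummerM_pos ha hb hz.le).ne'
  have h1 := (Real.Gamma_pos_of_pos ha).ne'
  have h2 := (Real.Gamma_pos_of_pos hb).ne'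
  have h3 := (Real.rpow_pos_of_pos hz (a - b)).ne'
  have h4 := (Real.exp_pos z).ne'
  have h5 : kummerM (a + 1) b z = (a * kummerM a b z + z * kummerDeriv a b z) / a := by
    rw [← h]; field_simp
  rw [scaledM, scaledM, kummerLogDeriv, Real.Gamma_add_one ha.ne',
    show a + 1 - b = a - b + 1 by ring, Real.rpow_add_one hz.ne', h5]
  field_simp

lemma scaledM_pos (ha : 0 < a) (hb : 0 < b) (hz : 0 < z) : 0 < scaledM a b z :=
  div_pos (kummerM_pos ha hb hz.le) (mul_pos (mul_pos (Real.exp_pos _)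
    (div_pos (Real.Gamma_pos_of_pos hb) (Real.Gamma_pos_of_pos ha))) (Real.rpow_pos_of_pos hz _))

lemma tendsto_ratio (ha : 0 < a) (hb : 0 < b) :
    Tendsto (fun z => a / z + kummerLogDeriv a b z) atTop (𝓝 1) := by
  simpa using (tendsto_const_div a).add (tendsto_kummerLogDeriv ha hb)

lemma tendsto_scaledM_succ (ha : 0 < a) (hb : 0 < b) (h : Tendsto (scaledM a b) atTop (𝓝 1)) :
    Tendsto (scaledM (a + 1) b) atTop (𝓝 1) := by
  have h1 := h.mul (tendsto_ratio ha hb)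
  rw [one_mul] at h1
  refine h1.congr' ?_
  filter_upwards [eventually_gt_atTop 0] with z hz
  rw [scaledM_succ_left ha hb hz]

lemma tendsto_scaledM_of_succ (ha : 0 < a) (hb : 0 < b)
    (h : Tendsto (scaledM (a + 1) b) atTop (𝓝 1)) : Tendsto (scaledM a b) atTop (𝓝 1) := by
  have h1 := h.div (tendsto_ratio ha hb) one_ne_zero
  rw [div_one] at h1
  refine h1.congr' ?_
  filter_upwards [eventually_gt_atTop 0,
    (tendsto_ratio ha hb).eventually (lt_mem_nhds one_pos)] with z hz h2
  rw [Pi.div_apply, scaledM_succ_left ha hb hz,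
    mul_div_cancel_right₀ _ h2.ne']

lemma Gamma_mul_ascPochhammer (ha : 0 < a) (n : ℕ) :
    Real.Gamma a * (ascPochhammer ℝ n).eval a = Real.Gamma (a + n) := by
  induction n with
  | zero => simp
  | succ n ih =>
    have : a + n ≠ 0 := by positivity
    rw [ascPochhammer_succ_eval, ← mul_assoc, ih, Nat.cast_succ, ← add_assoc,
      Real.Gamma_add_one this, mul_comm]

lemma hasSum_Gamma_mul_kummerM (ha : 0 < a) (hb : 0 < b) (z : ℝ) :
    HasSum (fun n : ℕ => Real.Gamma (a + n) * (z ^ n / ((ascPochhammer ℝ n).eval b * n.factorial)))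
      (Real.Gamma a * kummerM a b z) := by
  refine ((hasSum_kummerM ha hb z).mul_left (Real.Gamma a)).congr_fun fun n => ?_
  rw [← Gamma_mul_ascPochhammer ha, kummerCoeff, div_div]
  ring

/-- `Γ(a) M(a,b,z)` is logarithmically convex in `a`. -/
lemma Gamma_mul_kummerM_le {x y l : ℝ} (hx : 0 < x) (hy : 0 < y) (hb : 0 < b) (hl0 : 0 < l)
    (hl1 : l < 1) (hz : 0 < z) :
    Real.Gamma (l * x + (1 - l) * y) * kummerM (l * x + (1 - l) * y) b z ≤
      (Real.Gamma x * kummerM x b z) ^ l * (Real.Gamma y * kummerM y b z) ^ (1 - l) := by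
  have hl : 0 < 1 - l := by linarith
  have hA : 0 < Real.Gamma x * kummerM x b z :=
    mul_pos (Real.Gamma_pos_of_pos hx) (kummerM_pos hx hb hz.le)
  have hB : 0 < Real.Gamma y * kummerM y b z :=
    mul_pos (Real.Gamma_pos_of_pos hy) (kummerM_pos hy hb hz.le)
  have h0 := hasSum_Gamma_mul_kummerM (a := l * x + (1 - l) * y) (by positivity) hb z
  have h1 := (((hasSum_Gamma_mul_kummerM hx hb z).mul_left
    (l / (Real.Gamma x * kummerM x b z))).add ((hasSum_Gamma_mul_kummerM hy hb z).mul_left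
    ((1 - l) / (Real.Gamma y * kummerM y b z)))).mul_left
    ((Real.Gamma x * kummerM x b z) ^ l * (Real.Gamma y * kummerM y b z) ^ (1 - l))
  rw [div_mul_cancel₀ _ hA.ne', div_mul_cancel₀ _ hB.ne', add_sub_cancel, mul_one] at h1
  refine hasSum_le (fun n => ?_) h0 h1
  set w := z ^ n / ((ascPochhammer ℝ n).eval b * n.factorial) with hw
  have hw0 : 0 < w := div_pos (pow_pos hz n) (mul_pos (ascPochhammer_pos n b hb)
    (Nat.cast_pos.2 n.factorial_pos))
  have hxn : 0 < x + n := by positivity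
  have hyn : 0 < y + n := by positivity
  have hG := Real.Gamma_mul_add_mul_le_rpow_Gamma_mul_rpow_Gamma hxn hyn hl0 hl (by ring)
  rw [show l * (x + n) + (1 - l) * (y + n) = l * x + (1 - l) * y + n by ring] at hG
  have hp := Real.Gamma_pos_of_pos hxn
  have hq := Real.Gamma_pos_of_pos hyn
  generalize Real.Gamma x * kummerM x b z = A at *
  generalize Real.Gamma y * kummerM y b z = B at *
  generalize Real.Gamma (x + n) = p at *
  generalize Real.Gamma (y + n) = q at *
  -- Hölder's inequality for the series: the weighted mean inequality is applied to each term after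
  -- dividing the two series by their sums.
  have hAG := Real.geom_mean_le_arith_mean2_weighted hl0.le hl.le
    (div_pos (mul_pos hp hw0) hA).le (div_pos (mul_pos hq hw0) hB).le (by ring)
  rw [Real.div_rpow (mul_pos hp hw0).le hA.le, Real.div_rpow (mul_pos hq hw0).le hB.le,
    Real.mul_rpow hp.le hw0.le, Real.mul_rpow hq.le hw0.le] at hAG
  have hww : w ^ l * w ^ (1 - l) = w := by
    rw [← Real.rpow_add hw0]; simp
  have hAl := Real.rpow_pos_of_pos hA l
  have hBl := Real.rpow_pos_of_pos hB (1 - l)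
  calc _ ≤ p ^ l * q ^ (1 - l) * w := mul_le_mul_of_nonneg_right hG hw0.le
    _ = A ^ l * B ^ (1 - l) * (p ^ l * w ^ l / A ^ l * (q ^ (1 - l) * w ^ (1 - l) / B ^ (1 - l))) := by
        nth_rewrite 1 [← hww]
        field_simp
    _ ≤ A ^ l * B ^ (1 - l) * (l * (p * w / A) + (1 - l) * (q * w / B)) := by gcongr
    _ = _ := by ring

lemma scaledM_eq (ha : 0 < a) (hb : 0 < b) (hz : 0 < z) :
    scaledM a b z = Real.Gamma a * kummerM a b z * (z ^ (-a) * (z ^ b / (Real.exp z * Real.Gamma b))) := by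
  have h1 := (Real.Gamma_pos_of_pos ha).ne'
  have h2 := (Real.Gamma_pos_of_pos hb).ne'
  have h3 := (Real.rpow_pos_of_pos hz a).ne'
  have h4 := (Real.rpow_pos_of_pos hz b).ne'
  rw [scaledM, Real.rpow_sub hz, Real.rpow_neg hz.le]
  field_simp

lemma scaledM_le_interpolate {x y l : ℝ} (hx : 0 < x) (hy : 0 < y) (hb : 0 < b) (hl0 : 0 < l)
    (hl1 : l < 1) (hz : 0 < z) :
    scaledM (l * x + (1 - l) * y) b z ≤ scaledM x b z ^ l * scaledM y b z ^ (1 - l) := by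
  have hl : 0 < 1 - l := by linarith
  have hA : 0 ≤ Real.Gamma x * kummerM x b z :=
    (mul_pos (Real.Gamma_pos_of_pos hx) (kummerM_pos hx hb hz.le)).le
  have hB : 0 ≤ Real.Gamma y * kummerM y b z :=
    (mul_pos (Real.Gamma_pos_of_pos hy) (kummerM_pos hy hb hz.le)).le
  have h := Gamma_mul_kummerM_le hx hy hb hl0 hl1 hz
  have hQ : 0 < z ^ b / (Real.exp z * Real.Gamma b) := div_pos (Real.rpow_pos_of_pos hz b)
    (mul_pos (Real.exp_pos z) (Real.Gamma_pos_of_pos hb))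
  have hzx := Real.rpow_pos_of_pos hz (-x)
  have hzy := Real.rpow_pos_of_pos hz (-y)
  rw [scaledM_eq (by positivity) hb hz, scaledM_eq hx hb hz, scaledM_eq hy hb hz]
  generalize z ^ b / (Real.exp z * Real.Gamma b) = Q at *
  have e1 : z ^ (-(l * x + (1 - l) * y)) = (z ^ (-x)) ^ l * (z ^ (-y)) ^ (1 - l) := by
    rw [← Real.rpow_mul hz.le, ← Real.rpow_mul hz.le, ← Real.rpow_add hz]; congr 1; ring
  have e2 : Q = Q ^ l * Q ^ (1 - l) := by rw [← Real.rpow_add hQ]; simp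
  rw [Real.mul_rpow hA (by positivity), Real.mul_rpow hB (by positivity),
    Real.mul_rpow hzx.le hQ.le, Real.mul_rpow hzy.le hQ.le, e1]
  nth_rewrite 1 [e2]
  refine (mul_le_mul_of_nonneg_right h (by positivity)).trans_eq ?_
  ring

lemma tendsto_scaledM_add_nat (hb : 0 < b) (k : ℕ) :
    Tendsto (scaledM (b + k) b) atTop (𝓝 1) := by
  induction k with
  | zero =>
    refine tendsto_const_nhds.congr fun z => ?_
    rw [Nat.cast_zero, add_zero, scaledM, kummerM_self hb, div_self (Real.Gamma_pos_of_pos hb).ne',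
      sub_self, Real.rpow_zero, mul_one, mul_one, div_self (Real.exp_pos z).ne']
  | succ k ih =>
    rw [Nat.cast_succ, ← add_assoc]
    exact tendsto_scaledM_succ (by positivity) hb ih

/-- The limit is known for a = b + k, starting from M(b,b,z) = e^z. Logarithmic convexity in a
interpolates: an upper bound from the neighbours b + k and b + k + 1, and a lower one because b + k
+ 1 lies between a and b + k + 2. -/
lemma tendsto_scaledM_of_le (hb : 0 < b) (hba : b ≤ a) : Tendsto (scaledM a b) atTop (𝓝 1) := by
  set k := ⌊a - b⌋₊ with hk
  have hk1 : b + k ≤ a := by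
    have := Nat.floor_le (sub_nonneg.2 hba); linarith
  have hk2 : a < b + k + 1 := by
    have := Nat.lt_floor_add_one (a - b); linarith
  have h0 := tendsto_scaledM_add_nat hb k
  have h1 := tendsto_scaledM_add_nat hb (k + 1)
  have h2 := tendsto_scaledM_add_nat hb (k + 2)
  push_cast at h1 h2
  rcases hk1.eq_or_lt with h | h
  · rwa [← h]
  have hk0 : 0 < b + k := by positivity
  have ha := hk0.trans h
  set l := b + k + 1 - a with hl
  have hl0 : 0 < l := by linarith
  have hl1 : l < 1 := by linarith
  set m := 1 / (b + k + 2 - a) with hm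
  have hm' : 1 < b + k + 2 - a := by linarith
  have hm0 : 0 < m := by positivity
  have hm1 : m < 1 := (div_lt_one (by linarith)).2 hm'
  have e1 : l * (b + k) + (1 - l) * (b + (k + 1)) = a := by rw [hl]; ring
  have e2 : m * a + (1 - m) * (b + (k + 2)) = b + (k + 1) := by
    rw [hm]
    have : b + k + 2 - a ≠ 0 := by linarith
    field_simp
    ring
  have hup : Tendsto (fun z => scaledM (b + k) b z ^ l * scaledM (b + (k + 1)) b z ^ (1 - l)) atTop
      (𝓝 1) := by
    simpa using (h0.rpow_const (p := l) (.inl one_ne_zero)).mul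
      (h1.rpow_const (p := 1 - l) (.inl one_ne_zero))
  have hlo : Tendsto (fun z => (scaledM (b + (k + 1)) b z /
      scaledM (b + (k + 2)) b z ^ (1 - m)) ^ (1 / m)) atTop (𝓝 1) := by
    have := (h1.div (h2.rpow_const (p := 1 - m) (.inl one_ne_zero)) (by simp)).rpow_const
      (p := 1 / m) (.inl (by simp))
    simpa using this
  refine tendsto_of_tendsto_of_tendsto_of_le_of_le' hlo hup ?_ ?_
  · filter_upwards [eventually_gt_atTop 0] with z hz
    have h3 := scaledM_le_interpolate (x := a) (y := b + (k + 2)) ha (by positivity) hb hm0 hm1 hz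
    rw [e2] at h3
    have h4 := scaledM_pos ha hb hz
    have h5 := Real.rpow_pos_of_pos
      (scaledM_pos (a := b + (k + 2)) (by positivity) hb hz) (1 - m)
    have h6 := scaledM_pos (a := b + (k + 1)) (by positivity) hb hz
    rw [← div_le_iff₀ h5] at h3
    refine (Real.rpow_le_rpow (by positivity) h3 (by positivity)).trans_eq ?_
    rw [← Real.rpow_mul h4.le, mul_one_div_cancel hm0.ne', Real.rpow_one]
  · filter_upwards [eventually_gt_atTop 0] with z hz
    have h3 := scaledM_le_interpolate (x := b + k) (y := b + (k + 1)) hk0 (by positivity) hb hl0 hl1 hz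
    rwa [e1] at h3

/-- The leading behaviour of Kummer's function for fixed parameters. -/
lemma tendsto_scaledM (ha : 0 < a) (hb : 0 < b) : Tendsto (scaledM a b) atTop (𝓝 1) := by
  obtain ⟨k, hk⟩ := exists_nat_ge (b - a)
  have h := tendsto_scaledM_of_le (a := a + k) hb (by linarith)
  clear hk
  induction k with
  | zero => simpa using h
  | succ k ih =>
    refine ih (tendsto_scaledM_of_succ (by positivity) hb ?_)
    rwa [Nat.cast_succ, ← add_assoc] at h

end FixedParameters

end KummerExpansion
end

noncomputable section

namespace KummerExpansion

open Filter Topology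

/-! ### Integration of the logarithmic derivatives and the uniform expansion. -/

section Expansion

variable {a b z : ℝ}

lemma front_eq (ha : 0 < a) (hab : a ≠ b) (hz : 0 < z) :
    front a b z = Real.Gamma b / Real.Gamma a * expFactor a b z * expTerm a b 0 z := by
  rw [front, expFactor, ← coeff_div_pow ha hab hz, pow_zero, div_one]
  ring

lemma front_mul_partialSum (ha : 0 < a) (hab : a ≠ b) (hz : 0 < z) (N : ℕ) :
    front a b z * partialSum a b z N =
      Real.Gamma b / Real.Gamma a * expFactor a b z * expSum a b N z := by
  rw [front_eq ha hab hz, mul_assoc]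
  congr 1
  rw [partialSum, expSum, Finset.mul_sum]
  refine Finset.sum_congr rfl fun n _ => ?_
  rw [← coeff_div_pow ha hab hz n, ← coeff_div_pow ha hab hz 0, ncoeff, pow_zero, div_one]
  have := (coeff_zero_pos (β := b / z) (div_pos ha hz)).ne'
  field_simp

lemma front_pos (ha : 0 < a) (hb : 0 < b) (hz : 0 < z) : 0 < front a b z :=
  mul_pos (mul_pos (mul_pos (Real.exp_pos _)
    (div_pos (Real.Gamma_pos_of_pos hb) (Real.Gamma_pos_of_pos ha))) (Real.rpow_pos_of_pos hz _))
    (coeff_zero_pos (div_pos ha hz))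

lemma tendsto_expSum_succ (ha : 0 < a) (hab : a ≠ b) (N : ℕ) :
    Tendsto (expSum a b (N + 1)) atTop (𝓝 1) := by
  induction N with
  | zero =>
    refine (tendsto_expTerm_zero ha hab).congr fun z => ?_
    simp [expSum]
  | succ N ih =>
    have := ih.add (tendsto_expTerm_succ ha hab N)
    rw [add_zero] at this
    refine this.congr fun z => ?_
    rw [expSum, expSum, Finset.sum_range_succ _ (N + 1)]

/-- The z-derivative of this logarithm is `logDiff`, and its limit at infinity is 0 for fixed a and
b. The limit need not be uniform: the bound at z uses only the derivative estimate on [z, ∞). -/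
lemma abs_log_quotient_le (ha : 0 < a) (hb : 0 < b) (hab : a ≠ b) (hz : 0 < z) (N : ℕ) {C : ℝ}
    (hS : ∀ x, z ≤ x → 0 < expSum a b (N + 1) x)
    (hC : ∀ x, z ≤ x → |logDiff a b (N + 1) x| ≤ C / x ^ (N + 2)) :
    |Real.log (kummerM a b z) - Real.log (Real.Gamma b / Real.Gamma a) -
      Real.log (expFactor a b z) - Real.log (expSum a b (N + 1) z)| ≤
      C / (N + 1) / z ^ (N + 1) := by
  have hG : 0 < Real.Gamma b / Real.Gamma a :=
    div_pos (Real.Gamma_pos_of_pos hb) (Real.Gamma_pos_of_pos ha)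
  refine abs_le_of_deriv_decay (g := fun z => Real.log (kummerM a b z) -
    Real.log (Real.Gamma b / Real.Gamma a) - Real.log (expFactor a b z) -
    Real.log (expSum a b (N + 1) z)) hz (fun x hx => ?_) hC ?_
  · have hx0 := hz.trans_le hx
    have hM := (kummerM_pos ha hb hx0.le).ne'
    have hP := (expFactor_pos (a := a) (b := b) hx0).ne'
    refine (((((hasDerivAt_kummerM ha hb x).log hM).fun_sub (hasDerivAt_const x _)).fun_sub
      ((hasDerivAt_expFactor ha hx0).log hP)).fun_sub
      ((hasDerivAt_expSum ha hab hx0 (N + 1)).log (hS x hx).ne')).congr_deriv ?_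
    rw [logDiff, kummerLogDeriv, mul_div_cancel_right₀ _ hP, sub_zero]
  · have h1 := (tendsto_scaledM ha hb).log one_ne_zero
    have h2 := (tendsto_expSum_succ ha hab N).log one_ne_zero
    have h3 := (h1.add (tendsto_mul_expA (b := b) ha)).sub h2
    rw [Real.log_one, zero_add, sub_zero] at h3
    refine h3.congr' ?_
    filter_upwards [eventually_gt_atTop 0] with x hx
    have hM := (kummerM_pos ha hb hx.le).ne'
    have hp := (Real.rpow_pos_of_pos hx (a - b)).ne'
    rw [scaledM, expFactor, Real.log_div hM (mul_ne_zero (mul_ne_zero (Real.exp_pos _).ne' hG.ne')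
      hp), Real.log_mul (mul_ne_zero (Real.exp_pos _).ne' hG.ne') hp,
      Real.log_mul (Real.exp_pos _).ne' hG.ne', Real.log_mul (Real.exp_pos _).ne' hp,
      Real.log_exp, Real.log_exp]
    ring

/-- The expansion on a region that is closed under enlarging `z`, from an estimate of the
logarithmic derivatives. -/
lemma expansion_of_abs_logDiff_le {Q : ℝ → ℝ → ℝ → Prop} {K C₁ z₁ : ℝ} {N : ℕ}
    (hb : ∀ a b z, Q a b z → 0 < b) (hQ : ∀ a b z x, 0 < z → Q a b z → z ≤ x → Q a b x)
    (h : ∀ a b z, z₁ ≤ z → Q a b z → InRegion K a b z ∧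
      |logDiff a b (N + 1) z| ≤ C₁ / z ^ (N + 2)) :
    ∃ C z₀, 1 ≤ z₀ ∧ ∀ a b z, z₀ ≤ z → Q a b z →
      |kummerM a b z - front a b z * partialSum a b z (N + 1)| ≤
        C * front a b z / z ^ (N + 1) := by
  obtain ⟨_, z2, -, hz2, H⟩ := expSum_bounds K N
  set D := |C₁| / (N + 1) with hD
  have hD0 : 0 ≤ D := by positivity
  -- One factor 2 comes from the bound of the sum by 2E₀, the other from |e^W − 1| ≤ 2|W|; z ≥ D
  -- ensures |W| ≤ 1.
  refine ⟨4 * D, max (max z₁ z2) (max 1 D), (le_max_left _ _).trans (le_max_right _ _),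
    fun a b z hz hQz => ?_⟩
  have hz1 : z₁ ≤ z := ((le_max_left _ _).trans (le_max_left _ _)).trans hz
  have hzz2 : z2 ≤ z := ((le_max_right _ _).trans (le_max_left _ _)).trans hz
  have hz3 : 1 ≤ z := ((le_max_left _ _).trans (le_max_right _ _)).trans hz
  have hz4 : D ≤ z := ((le_max_right _ _).trans (le_max_right _ _)).trans hz
  have hz0 : 0 < z := by linarith
  have hb0 := hb a b z hQz
  obtain ⟨ha0, hab, -⟩ := (h a b z hz1 hQz).1
  have hx : ∀ x, z ≤ x → InRegion K a b x ∧ |logDiff a b (N + 1) x| ≤ C₁ / x ^ (N + 2) :=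
    fun x hx => h a b x (hz1.trans hx) (hQ a b z x hz0 hQz hx)
  have hF : ∀ x, z ≤ x → 0 < expTerm a b 0 x := fun x hx =>
    expTerm_zero_pos ha0 hab (hz0.trans_le hx)
  have hS : ∀ x, z ≤ x → 0 < expSum a b (N + 1) x := fun x hzx => by
    linarith [(H a b x (hx x hzx).1 (hzz2.trans hzx)).1, hF x hzx]
  have hlog := abs_log_quotient_le ha0 hb0 hab hz0 N hS fun x hzx => (hx x hzx).2
  have hS2 := (H a b z (hx z le_rfl).1 hzz2).2.1
  have hG : 0 < Real.Gamma b / Real.Gamma a :=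
    div_pos (Real.Gamma_pos_of_pos hb0) (Real.Gamma_pos_of_pos ha0)
  have hM := kummerM_pos ha0 hb0 hz0.le
  have hP := expFactor_pos (a := a) (b := b) hz0
  have hSz := hS z le_rfl
  rw [front_mul_partialSum ha0 hab hz0, front_eq ha0 hab hz0]
  set W := Real.log (kummerM a b z) - Real.log (Real.Gamma b / Real.Gamma a) -
      Real.log (expFactor a b z) - Real.log (expSum a b (N + 1) z) with hW
  have hMeq : kummerM a b z =
      Real.Gamma b / Real.Gamma a * expFactor a b z * expSum a b (N + 1) z * Real.exp W := by
    rw [hW, Real.exp_sub, Real.exp_sub, Real.exp_sub, Real.exp_log hM, Real.exp_log hG,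
      Real.exp_log hP, Real.exp_log hSz]
    field_simp
  have hW1 : |W| ≤ D / z ^ (N + 1) := by
    refine hlog.trans ?_
    rw [hD]
    gcongr
    exact le_abs_self C₁
  have hW2 : |W| ≤ 1 := by
    refine hW1.trans ((div_le_one (by positivity)).2 (hz4.trans ?_))
    exact le_self_pow₀ hz3 (by omega)
  have hexp := Real.abs_exp_sub_one_le hW2
  generalize Real.Gamma b / Real.Gamma a * expFactor a b z = E at *
  have hE : 0 < E := by
    by_contra! hE
    have : E * expSum a b (N + 1) z * Real.exp W ≤ 0 :=
      mul_nonpos_of_nonpos_of_nonneg (mul_nonpos_of_nonpos_of_nonneg hE hSz.le) (Real.exp_pos _).le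
    linarith
  calc |kummerM a b z - E * expSum a b (N + 1) z|
      = E * expSum a b (N + 1) z * |Real.exp W - 1| := by
        rw [hMeq, show E * expSum a b (N + 1) z * Real.exp W - E * expSum a b (N + 1) z =
          E * expSum a b (N + 1) z * (Real.exp W - 1) by ring, abs_mul, abs_of_pos (by positivity)]
    _ ≤ E * (2 * expTerm a b 0 z) * (2 * (D / z ^ (N + 1))) := by
        have := hF z le_rfl
        gcongr
        linarith
    _ = _ := by ring

/-- The uniform expansion of Kummer's function, with at least one term and for `a ≠ b`. -/
lemma expansion_of_ne {a₀ b₀ ρ : ℝ} (ha₀ : 0 < a₀) (hb₀ : 0 < b₀) (hρ : ρ < 1) (N : ℕ) :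
    ∃ C z₀, 0 ≤ C ∧ 1 ≤ z₀ ∧ ∀ a b z, z₀ ≤ z → a ≠ b →
      ((a₀ ≤ a ∧ a ≤ b ∧ t0 (a / z) (b / z) ≤ ρ) ∨ (b₀ ≤ b ∧ b ≤ a)) →
      |kummerM a b z - front a b z * partialSum a b z (N + 1)| ≤
        C * front a b z / z ^ (N + 1) := by
  -- ρ may be zero or negative, while the estimates along the ray need a positive bound.
  set σ := max ρ (1 / 2) with hσ
  have hσ0 : 0 < σ := lt_of_lt_of_le (by norm_num) (le_max_right _ _)
  have hσ1 : σ < 1 := max_lt hρ (by norm_num)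
  obtain ⟨K, hK⟩ := abs_logDiff_le_of_lt ha₀ hσ0 hσ1
  obtain ⟨C1, z1, hz1, H1⟩ := hK N
  obtain ⟨C2, z2, hz2, H2⟩ := abs_logDiff_le_of_gt hb₀ N
  obtain ⟨C3, z3, hz3, H3⟩ := expansion_of_abs_logDiff_le (K := K) (C₁ := C1) (z₁ := z1) (N := N)
    (Q := fun a b z => a₀ ≤ a ∧ a < b ∧ t0 (a / z) (b / z) ≤ σ)
    (fun a b z h => ha₀.trans (h.1.trans_lt h.2.1))
    (fun a b z x hz h hx => ⟨h.1, h.2.1, t0_le_of_le hσ0 le_rfl (ha₀.trans_le h.1) hz h.2.2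
      (by rwa [div_self hσ0.ne', one_mul])⟩)
    (fun a b z hz h => H1 a b z hz h.1 h.2.1 h.2.2)
  obtain ⟨C4, z4, hz4, H4⟩ := expansion_of_abs_logDiff_le (K := 1) (C₁ := C2) (z₁ := z2) (N := N)
    (Q := fun a b _ => b₀ ≤ b ∧ b < a) (fun a b z h => hb₀.trans_le h.1)
    (fun a b z x _ h _ => h)
    (fun a b z hz h => ⟨inRegion_of_t0_nonpos (w := z / 2) (hb₀.trans_le h.1) h.2
      (by linarith) (by linarith), H2 a b z hz h.1 h.2⟩)
  refine ⟨|C3| + |C4|, max z3 z4, by positivity, hz3.trans (le_max_left _ _),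
    fun a b z hz hab h => ?_⟩
  have hz0 : 0 < z := by linarith [le_max_left z3 z4]
  rcases h with ⟨h1, h2, h3⟩ | ⟨h1, h2⟩
  · have hf := (front_pos (ha₀.trans_le h1) (ha₀.trans_le (h1.trans h2)) hz0).le
    refine (H3 a b z ((le_max_left _ _).trans hz)
      ⟨h1, lt_of_le_of_ne h2 hab, h3.trans (le_max_left _ _)⟩).trans ?_
    gcongr
    linarith [le_abs_self C3, abs_nonneg C4]
  · have hf := (front_pos (hb₀.trans_le (h1.trans h2)) (hb₀.trans_le h1) hz0).le
    refine (H4 a b z ((le_max_right _ _).trans hz) ⟨h1, lt_of_le_of_ne h2 hab.symm⟩).trans ?_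
    gcongr
    linarith [le_abs_self C4, abs_nonneg C3]

lemma front_self (ha : 0 < a) (hz : 0 < z) : front a a z = Real.exp z := by
  have hμ : mu (a / z) (a / z) = 0 := sub_self _
  rw [front, (first_coefficients_of_eq (div_pos ha hz) hμ).1, expA, hμ,
    div_self (Real.Gamma_pos_of_pos ha).ne']
  simp

lemma partialSum_self (ha : 0 < a) (hz : 0 < z) (N : ℕ) : partialSum a a z (N + 1) = 1 := by
  have h := first_coefficients_of_eq (div_pos ha hz) (sub_self (a / z))
  rw [partialSum, Finset.sum_range_succ', Finset.sum_eq_zero fun n _ => by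
    rw [ncoeff, h.2 n, zero_div, zero_div], ncoeff, h.1]
  simp

/-- The uniform expansion of Kummer's function. -/
theorem expansion_kummerM {a₀ b₀ ρ : ℝ} (ha₀ : 0 < a₀) (hb₀ : 0 < b₀) (hρ : ρ < 1) (N : ℕ) :
    ∃ C z₀, 1 ≤ z₀ ∧ ∀ a b z, z₀ ≤ z →
      ((a₀ ≤ a ∧ a ≤ b ∧ t0 (a / z) (b / z) ≤ ρ) ∨ (b₀ ≤ b ∧ b ≤ a)) →
      |kummerM a b z - front a b z * partialSum a b z N| ≤ C * front a b z / z ^ N := by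
  have hsucc : ∀ N, ∃ C z₀, 0 ≤ C ∧ 1 ≤ z₀ ∧ ∀ a b z, z₀ ≤ z →
      ((a₀ ≤ a ∧ a ≤ b ∧ t0 (a / z) (b / z) ≤ ρ) ∨ (b₀ ≤ b ∧ b ≤ a)) →
      |kummerM a b z - front a b z * partialSum a b z (N + 1)| ≤
        C * front a b z / z ^ (N + 1) := by
    intro N
    obtain ⟨C, z₀, hC, hz₀, H⟩ := expansion_of_ne ha₀ hb₀ hρ N
    refine ⟨C, z₀, hC, hz₀, fun a b z hz h => ?_⟩
    -- The formal recursion divides by b − a. For a = b both M and the truncated expansion equal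
    -- e^z.
    by_cases hab : a = b
    · subst hab
      have ha : 0 < a := by
        rcases h with h | h
        · exact ha₀.trans_le h.1
        · exact hb₀.trans_le h.1
      have hz0 : 0 < z := by linarith
      rw [front_self ha hz0, partialSum_self ha hz0, kummerM_self ha, mul_one, sub_self, abs_zero]
      positivity
    · exact H a b z hz hab h
  cases N with
  | succ N =>
    obtain ⟨C, z₀, -, hz₀, H⟩ := hsucc N
    exact ⟨C, z₀, hz₀, H⟩
  -- With no terms, the claim is M ≤ C times the front factor; it follows from the one-term
  -- estimate, the omitted leading term adding 1 to the constant.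
  | zero =>
    obtain ⟨C, z₀, hC, hz₀, H⟩ := hsucc 0
    refine ⟨C + 1, z₀, hz₀, fun a b z hz h => ?_⟩
    have hpos : 0 < a ∧ 0 < b := by
      rcases h with h | h
      · exact ⟨ha₀.trans_le h.1, ha₀.trans_le (h.1.trans h.2.1)⟩
      · exact ⟨hb₀.trans_le (h.1.trans h.2), hb₀.trans_le h.1⟩
    have hz0 : 0 < z := by linarith
    have hf := front_pos hpos.1 hpos.2 hz0
    have h1 := H a b z hz h
    have h2 : partialSum a b z (0 + 1) = 1 := by
      have := (coeff_zero_pos (β := b / z) (div_pos hpos.1 hz0)).ne'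
      simp [partialSum, ncoeff, div_self this]
    have h3 : C * front a b z / z ^ (0 + 1) ≤ C * front a b z :=
      div_le_self (by positivity) (one_le_pow₀ (by linarith))
    rw [h2, mul_one] at h1
    have h4 := abs_le.1 (h1.trans h3)
    have h5 : partialSum a b z 0 = 0 := by simp [partialSum]
    rw [h5, mul_zero, sub_zero, pow_zero, div_one, abs_le]
    constructor <;> nlinarith

lemma front_eq_mul_frontScaled (a b z : ℝ) :
    front a b z = Real.exp z * (Real.Gamma b / Real.Gamma a) * z ^ (a - b) * frontScaled a b z := by
  rw [front, frontScaled, sub_eq_add_neg, Real.exp_add, neg_mul]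
  ring

end Expansion

end KummerExpansion
end

theorem corollary1 :
    -- the first coefficients, for all positive `α`, `β` (so for `μ` of either sign)
    (∀ α β : ℝ, 0 < α → 0 < β →
      KummerExpansion.coeff α β 0 =
          1 / Real.sqrt (β * KummerExpansion.mu α β * KummerExpansion.tau α β ^ 2
            - 2 * KummerExpansion.mu α β * KummerExpansion.tau α β + 1) ∧
      KummerExpansion.ncoeff α β 0 = 1 ∧
      ∀ μ τ : ℝ, μ = KummerExpansion.mu α β → τ = KummerExpansion.tau α β →
        KummerExpansion.ncoeff α β 1 =
          μ * τ ^ 2 * (μ ^ 2 * τ ^ 5 - 13 * μ ^ 2 * τ ^ 4 - μ * τ ^ 4 + 21 * τ ^ 3 * μ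
              + 4 * μ * τ ^ 2 - 9 * τ ^ 2 - 2 * τ - 1)
            / (12 * (μ * τ ^ 2 - 1) ^ 3 * (1 - μ * τ))) ∧
    -- the uniform expansions of `M` and of `M̃` as `z → ∞`, in both ranges
    (∀ a₀ b₀ ρ : ℝ, 0 < a₀ → 0 < b₀ → ρ < 1 → ∀ N : ℕ, ∃ C z₀ : ℝ, 0 < z₀ ∧
      ∀ a b z : ℝ, z₀ ≤ z →
        ((a₀ ≤ a ∧ a ≤ b ∧ KummerExpansion.t0 (a / z) (b / z) ≤ ρ) ∨ (b₀ ≤ b ∧ b ≤ a)) →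
          |KummerExpansion.kummerM a b z
              - KummerExpansion.front a b z * KummerExpansion.partialSum a b z N|
            ≤ C * KummerExpansion.front a b z / z ^ N ∧
          |KummerExpansion.scaledM a b z
              - KummerExpansion.frontScaled a b z * KummerExpansion.partialSum a b z N|
            ≤ C * KummerExpansion.frontScaled a b z / z ^ N) := by
  refine ⟨fun α β hα _ => ?_, fun a₀ b₀ ρ ha₀ hb₀ hρ N => ?_⟩
  · obtain ⟨h0, h1, h2⟩ := KummerExpansion.first_coefficients (β := β) hα
    exact ⟨h0, h1, fun μ τ hμ hτ => by rw [hμ, hτ]; exact h2⟩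
  obtain ⟨C, z₀, hz₀, H⟩ := KummerExpansion.expansion_kummerM ha₀ hb₀ hρ N
  refine ⟨C, z₀, by linarith, fun a b z hz h => ⟨H a b z hz h, ?_⟩⟩
  have hpos : 0 < a ∧ 0 < b := by
    rcases h with h | h
    · exact ⟨ha₀.trans_le h.1, ha₀.trans_le (h.1.trans h.2.1)⟩
    · exact ⟨hb₀.trans_le (h.1.trans h.2), hb₀.trans_le h.1⟩
  have hz0 : 0 < z := by linarith
  have hE : 0 < Real.exp z * (Real.Gamma b / Real.Gamma a) * z ^ (a - b) :=
    mul_pos (mul_pos (Real.exp_pos _) (div_pos (Real.Gamma_pos_of_pos hpos.2)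
      (Real.Gamma_pos_of_pos hpos.1))) (Real.rpow_pos_of_pos hz0 _)
  have key := H a b z hz h
  rw [KummerExpansion.front_eq_mul_frontScaled] at key
  rw [KummerExpansion.scaledM]
  generalize Real.exp z * (Real.Gamma b / Real.Gamma a) * z ^ (a - b) = E at *
  have e1 : KummerExpansion.kummerM a b z / E -
      KummerExpansion.frontScaled a b z * KummerExpansion.partialSum a b z N =
      (KummerExpansion.kummerM a b z - E * KummerExpansion.frontScaled a b z *
        KummerExpansion.partialSum a b z N) / E := by
    field_simp
  rw [e1, abs_div, abs_of_pos hE, div_le_iff₀ hE]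
  refine key.trans_eq ?_
  ring
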